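/- Let $n$ events with times $0,1,\dots,n-1$ be given, the event of time $t$ being a point $p_t\in\mathbb R^2$. Let $T$ be the dyadic tree over time: the node $(\ell,b)$ stands for the times $b2^\ell\le t<(b+1)2^\ell$, its canonical subset consists of the events with these times, and the root has height $\lceil\log_2 n\rceil$. Every node stores the convex hull of its canonical subset as an array of its vertices in clockwise order, beginning with the lexicographically greatest one, together with the position of the lexicographically least one. The canonical cover of a window $[i,j]$, $0\le i\le j<n$, consists of the maximal nodes all of whose times lie in $[i,j]$; the hulls stored there are the canonical sub-hulls. Let $D$ be the circular list, in clockwise angular order, of the outward normals of the facets (edges) of all canonical sub-hulls of the window (a sub-hull with one vertex has no facet, one with two vertices has two facets with opposite normals). Two elements $n_1,n_2$ of $D$ are adjacent if no element of $D$ is met strictly between them when turning clockwise from $n_1$ to $n_2$ (a full turn if they have the same direction). A direction is between $n_1$ and $n_2$ if, turning clockwise from $n_1$, it is met before $n_2$ or is that of $n_2$ itself. Let $w=j-i+1$ be the number of events in the window. **Lemma.** There are a program for a real RAM (unit-cost addition, subtraction and comparison of integers and of reals, halving of integers, multiplication of reals, indirect addressing, no rounding of reals) and a constant $K$, both independent of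 the input, such that the following holds. For all $n$ and all events, the precomputed tree $T$ can be augmented, independently of the queries, by integer words of absolute value $O(n)$, with $O(|C|)$ words at a node with canonical subset $C$ (hence $O(n\log n)$ words in all for $n\ge 2$), so that for every window $[i,j]$ and every directed line $Q$: if $Q$ intersects the convex hull of the points of the window (the complete hull) and $D$ is not empty, then the program, with read access to the events, the augmented tree, the window and $Q$, halts after at most $K\,(\lfloor\log_2 w\rfloor+1)^2$ steps, that is, in $O(\log^2 w)$ time, and outputs two facets of canonical sub-hulls whose normals $n_1$ and $n_2$ are adjacent in $D$ and such that the outward normal of the facet of the complete hull stabbed by $Q$ is between $n_1$ and $n_2$. Here the stabbed facet is the facet of the complete hull through which $Q$ leaves it: it contains the point of $Q$ and the complete hull that is furthest in the direction of $Q$, and its outward normal has a non-negative inner product with that direction. If there is more than one such facet (for instance because $Q$ leaves through a vertex), the claim is that one of them has its normal between $n_1$ and $n_2$. -/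

import Mathlib

namespace WindowedHull

/-! ## Plane geometry -/

abbrev Pt := ℝ × ℝ

def cross (u v : Pt) : ℝ := u.1 * v.2 - u.2 * v.1

def dot (u v : Pt) : ℝ := u.1 * v.1 + u.2 * v.2

/-- The edge vector `b - a` turned counterclockwise by a right angle.  When a convex polygon is
traversed clockwise its interior lies to the right of each edge, so this is the outward normal. -/
def edgeNormal (a b : Pt) : Pt := (a.2 - b.2, b.1 - a.1)

/-- The clockwise angle from `u` to `v`, in `(0, 2π]`. -/
noncomputable def cwAngle (u v : Pt) : ℝ :=
  toIocMod Real.two_pi_pos 0 (Complex.arg ⟨u.1, u.2⟩ - Complex.arg ⟨v.1, v.2⟩)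

/-- Turning clockwise from `u`, the direction `x` is met before `v`. -/
def StrictlyBetween (u x v : Pt) : Prop := cwAngle u x < cwAngle u v

/-- Turning clockwise from `u`, the direction `x` is met before `v` or it is `v` itself. -/
def Between (u x v : Pt) : Prop := cwAngle u x ≤ cwAngle u v

/-- `a → b` is a facet (edge), traversed clockwise, of the convex hull of the set `S`. -/
def IsFacet (S : Set Pt) (a b : Pt) : Prop :=
  a ∈ (convexHull ℝ S).extremePoints ℝ ∧ b ∈ (convexHull ℝ S).extremePoints ℝ ∧ a ≠ b ∧
    ∀ x ∈ S, cross (b - a) (x - a) ≤ 0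

/-- The directed line through the point `o` with direction `q`, as a set of points. -/
def line (o q : Pt) : Set Pt := {x | ∃ t : ℝ, x = o + t • q}

/-- `a → b` is a facet of the convex hull of `S` through which the directed line `(o, q)` leaves
the hull: it contains the point of the line and the hull that is furthest in the direction `q`,
and its outward normal does not point against `q`. -/
def IsStabbedFacet (S : Set Pt) (o q : Pt) (a b : Pt) : Prop :=
  IsFacet S a b ∧
  (∃ t : ℝ, o + t • q ∈ segment ℝ a b ∧ ∀ s : ℝ, o + s • q ∈ convexHull ℝ S → s ≤ t) ∧
  0 ≤ dot (edgeNormal a b) q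

/-! ## The decomposition tree

The events have times `0, …, n - 1`.  The tree is the dyadic tree over time: the node `(ℓ, b)`, of
height `ℓ`, stands for the times `t` with `b * 2 ^ ℓ ≤ t < (b + 1) * 2 ^ ℓ`.  The leaf of time `t`
is `(0, t)`, the children of `(ℓ + 1, b)` are `(ℓ, 2 * b)` and `(ℓ, 2 * b + 1)`, the root is
`(Nat.clog 2 n, 0)`, and the level links go from `(ℓ, b)` to `(ℓ, b - 1)` and `(ℓ, b + 1)`. -/

/-- The canonical subset of the node `(ℓ, b)`. -/
def canonicalSubset (n ℓ b : ℕ) : Finset (Fin n) :=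
  Finset.univ.filter fun t => t.val / 2 ^ ℓ = b

/-- The `k`-th point, with `k` read cyclically, of the list `L` of events. -/
noncomputable def vertex {n : ℕ} (p : Fin n → Pt) (L : List (Fin n)) (k : ℕ) : Pt :=
  (L.map p).getD (k % L.length) 0

/-- `L` lists the vertices of the convex hull of the points `p t`, `t ∈ C`, each of them once, in
clockwise order, beginning with the lexicographically greatest one. -/
structure IsHullList {n : ℕ} (p : Fin n → Pt) (C : Finset (Fin n)) (L : List (Fin n)) :
    Prop where
  mem : ∀ t ∈ L, t ∈ C
  nodup : (L.map p).Nodup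
  vertices : {x | x ∈ L.map p} = (convexHull ℝ (p '' (C : Set (Fin n)))).extremePoints ℝ
  clockwise : ∀ k < L.length, ∀ t ∈ C,
    cross (vertex p L (k + 1) - vertex p L k) (p t - vertex p L k) ≤ 0
  start : L ≠ [] → ∀ t ∈ C, toLex (p t) ≤ toLex (vertex p L 0)

/-- The precomputed decomposition of the events `p`: every node stores the convex hull of its
canonical subset and the position of the lexicographically least vertex. -/
structure DecompTree {n : ℕ} (p : Fin n → Pt) where
  hull : ℕ → ℕ → List (Fin n)
  leastPos : ℕ → ℕ → ℕ
  hull_spec : ∀ ℓ b, ℓ ≤ Nat.clog 2 n → IsHullList p (canonicalSubset n ℓ b) (hull ℓ b)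
  leastPos_spec : ∀ ℓ b, ℓ ≤ Nat.clog 2 n → hull ℓ b ≠ [] →
    leastPos ℓ b < (hull ℓ b).length ∧
      ∀ t ∈ canonicalSubset n ℓ b, toLex (vertex p (hull ℓ b) (leastPos ℓ b)) ≤ toLex (p t)
  hull_above : ∀ ℓ b, Nat.clog 2 n < ℓ → hull ℓ b = []
  leastPos_above : ∀ ℓ b, Nat.clog 2 n < ℓ → leastPos ℓ b = 0

/-- All times of the node `(ℓ, b)` lie in the window `[i, j]`. -/
def InWindow (i j ℓ b : ℕ) : Prop := ∀ t : ℕ, t / 2 ^ ℓ = b → i ≤ t ∧ t ≤ j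

/-- The node `(ℓ, b)` belongs to the canonical cover of the window `[i, j]`: it is a maximal node
inside the window. -/
def InCover (i j ℓ b : ℕ) : Prop := InWindow i j ℓ b ∧ ¬ InWindow i j (ℓ + 1) (b / 2)

/-- The name of a facet of a sub-hull: a node and the position of the facet's first vertex. -/
structure SubFacet where
  level : ℕ
  block : ℕ
  pos : ℕ

/-- `f` names a facet of one of the canonical sub-hulls of the window `[i, j]`; a hull with only
one vertex has no facets, and one with two vertices has two, with opposite normals. -/
def SubFacet.Valid {n : ℕ} {p : Fin n → Pt} (T : DecompTree p) (i j : ℕ) (f : SubFacet) : Prop :=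
  InCover i j f.level f.block ∧ 2 ≤ (T.hull f.level f.block).length ∧
    f.pos < (T.hull f.level f.block).length

noncomputable def SubFacet.normal {n : ℕ} {p : Fin n → Pt} (T : DecompTree p) (f : SubFacet) :
    Pt :=
  edgeNormal (vertex p (T.hull f.level f.block) f.pos)
    (vertex p (T.hull f.level f.block) (f.pos + 1))

/-- The merged family `D` of the facet normals of the canonical sub-hulls of the window. -/
def mergedNormals {n : ℕ} {p : Fin n → Pt} (T : DecompTree p) (i j : ℕ) : Set Pt :=
  {x | ∃ f : SubFacet, f.Valid T i j ∧ f.normal T = x}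

/-- `u` and `v` belong to `D` and `v` comes right after `u` in the clockwise order of `D`. -/
def Adjacent (D : Set Pt) (u v : Pt) : Prop :=
  u ∈ D ∧ v ∈ D ∧ ∀ x ∈ D, ¬ StrictlyBetween u x v

/-- The points of the events in the window `[i, j]`. -/
def windowPoints {n : ℕ} (p : Fin n → Pt) (i j : ℕ) : Set Pt :=
  {x | ∃ t : Fin n, i ≤ t.val ∧ t.val ≤ j ∧ p t = x}

/-! ## The machine: a real RAM

The input is read-only.  The working memory has integer cells and real cells; every elementary
operation costs one step.  Integers can be added, subtracted, halved and compared, reals can be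
added, subtracted, multiplied and compared, and there is no rounding of a real. -/

/-- The read-only input: the events, the decomposition tree, further integer words stored at its
nodes (`extra ℓ b k` is the `k`-th one at the node `(ℓ, b)`), the window and the query line. -/
structure Input where
  numEvents : ℕ
  point : Fin numEvents → Pt
  tree : DecompTree point
  extra : ℕ → ℕ → ℕ → ℤ
  first : ℕ
  last : ℕ
  base : Pt
  dir : Pt

structure State where
  ints : ℤ → ℤ
  reals : ℤ → ℝ

def State.initial : State := ⟨fun _ => 0, fun _ => 0⟩

inductive IntExpr where
  | lit (c : ℤ)
  | cell (a : IntExpr)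
  | add (a b : IntExpr)
  | sub (a b : IntExpr)
  | half (a : IntExpr)
  | numEvents
  | first
  | last
  | hullSize (l b : IntExpr)
  | leastPos (l b : IntExpr)
  | hullAt (l b k : IntExpr)
  | extra (l b k : IntExpr)

/-- The event at position `k` of a list, and `0` past the end of the list. -/
def eventAt {n : ℕ} (L : List (Fin n)) (k : ℕ) : ℤ := (L.map fun t => (t.val : ℤ)).getD k 0

def IntExpr.eval (x : Input) (s : State) : IntExpr → ℤ
  | lit c => c
  | cell a => s.ints (a.eval x s)
  | add a b => a.eval x s + b.eval x s
  | sub a b => a.eval x s - b.eval x s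
  | half a => a.eval x s / 2
  | numEvents => x.numEvents
  | first => x.first
  | last => x.last
  | hullSize l b => ((x.tree.hull (l.eval x s).toNat (b.eval x s).toNat).length : ℤ)
  | leastPos l b => (x.tree.leastPos (l.eval x s).toNat (b.eval x s).toNat : ℤ)
  | hullAt l b k => eventAt (x.tree.hull (l.eval x s).toNat (b.eval x s).toNat) (k.eval x s).toNat
  | extra l b k => x.extra (l.eval x s).toNat (b.eval x s).toNat (k.eval x s).toNat

def IntExpr.cost : IntExpr → ℕ
  | lit _ => 1
  | cell a => a.cost + 1
  | add a b => a.cost + b.cost + 1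
  | sub a b => a.cost + b.cost + 1
  | half a => a.cost + 1
  | numEvents => 1
  | first => 1
  | last => 1
  | hullSize l b => l.cost + b.cost + 1
  | leastPos l b => l.cost + b.cost + 1
  | hullAt l b k => l.cost + b.cost + k.cost + 1
  | extra l b k => l.cost + b.cost + k.cost + 1

inductive RealExpr where
  | lit (c : ℤ)
  | cell (a : IntExpr)
  | add (a b : RealExpr)
  | sub (a b : RealExpr)
  | mul (a b : RealExpr)
  | pointX (t : IntExpr)
  | pointY (t : IntExpr)
  | baseX
  | baseY
  | dirX
  | dirY

/-- The point of the event of time `t`, and `0` if there is no such event. -/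
noncomputable def Input.pointAt (x : Input) (t : ℤ) : Pt :=
  if h : t.toNat < x.numEvents then x.point ⟨t.toNat, h⟩ else 0

noncomputable def RealExpr.eval (x : Input) (s : State) : RealExpr → ℝ
  | lit c => (c : ℝ)
  | cell a => s.reals (a.eval x s)
  | add a b => a.eval x s + b.eval x s
  | sub a b => a.eval x s - b.eval x s
  | mul a b => a.eval x s * b.eval x s
  | pointX t => (x.pointAt (t.eval x s)).1
  | pointY t => (x.pointAt (t.eval x s)).2
  | baseX => x.base.1
  | baseY => x.base.2
  | dirX => x.dir.1
  | dirY => x.dir.2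

def RealExpr.cost : RealExpr → ℕ
  | lit _ => 1
  | cell a => a.cost + 1
  | add a b => a.cost + b.cost + 1
  | sub a b => a.cost + b.cost + 1
  | mul a b => a.cost + b.cost + 1
  | pointX t => t.cost + 1
  | pointY t => t.cost + 1
  | baseX => 1
  | baseY => 1
  | dirX => 1
  | dirY => 1

inductive Test where
  | intLe (a b : IntExpr)
  | realLe (a b : RealExpr)
  | neg (c : Test)

def Test.Holds (x : Input) (s : State) : Test → Prop
  | intLe a b => a.eval x s ≤ b.eval x s
  | realLe a b => a.eval x s ≤ b.eval x s
  | neg c => ¬ c.Holds x s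

def Test.cost : Test → ℕ
  | intLe a b => a.cost + b.cost + 1
  | realLe a b => a.cost + b.cost + 1
  | neg c => c.cost + 1

inductive Prog where
  | skip
  | setInt (a v : IntExpr)
  | setReal (a : IntExpr) (v : RealExpr)
  | seq (P R : Prog)
  | cond (c : Test) (P R : Prog)
  | loop (c : Test) (P : Prog)

/-- `Exec x P s m s'`: on the input `x`, the program `P` started in the state `s` halts in the
state `s'` after exactly `m` steps. -/
inductive Exec (x : Input) : Prog → State → ℕ → State → Prop where
  | skip (s : State) : Exec x .skip s 1 s
  | setInt (a v : IntExpr) (s : State) :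
      Exec x (.setInt a v) s (a.cost + v.cost + 1)
        ⟨Function.update s.ints (a.eval x s) (v.eval x s), s.reals⟩
  | setReal (a : IntExpr) (v : RealExpr) (s : State) :
      Exec x (.setReal a v) s (a.cost + v.cost + 1)
        ⟨s.ints, Function.update s.reals (a.eval x s) (v.eval x s)⟩
  | seq {P R : Prog} {s s₁ s₂ : State} {m₁ m₂ : ℕ} :
      Exec x P s m₁ s₁ → Exec x R s₁ m₂ s₂ → Exec x (.seq P R) s (m₁ + m₂) s₂
  | condTrue {c : Test} {P R : Prog} {s s' : State} {m : ℕ} :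
      c.Holds x s → Exec x P s m s' → Exec x (.cond c P R) s (c.cost + m) s'
  | condFalse {c : Test} {P R : Prog} {s s' : State} {m : ℕ} :
      ¬ c.Holds x s → Exec x R s m s' → Exec x (.cond c P R) s (c.cost + m) s'
  | loopStep {c : Test} {P : Prog} {s s₁ s₂ : State} {m₁ m₂ : ℕ} :
      c.Holds x s → Exec x P s m₁ s₁ → Exec x (.loop c P) s₁ m₂ s₂ →
        Exec x (.loop c P) s (c.cost + m₁ + m₂) s₂
  | loopEnd {c : Test} {P : Prog} {s : State} :
      ¬ c.Holds x s → Exec x (.loop c P) s c.cost s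

/-- The facet whose name is in the integer cells `a`, `a + 1`, `a + 2`. -/
def State.facetAt (s : State) (a : ℤ) : SubFacet :=
  ⟨(s.ints a).toNat, (s.ints (a + 1)).toNat, (s.ints (a + 2)).toNat⟩

/-- The extra words take linear space at every node, `A` words for each event in its canonical
subset, and each of them is an integer of absolute value at most `A * n`. -/
def SmallExtra (A n : ℕ) (extra : ℕ → ℕ → ℕ → ℤ) : Prop :=
  ∀ ℓ b k, |extra ℓ b k| ≤ (A * n : ℕ) ∧
    (extra ℓ b k ≠ 0 → ℓ ≤ Nat.clog 2 n ∧ k < A * (canonicalSubset n ℓ b).card)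

end WindowedHull

/-! Let `N` be the normal of a stabbed facet, and for a direction `u` let `e(u)` be the point of the
window that is extreme in direction `u`, ties being broken clockwise (`Dominates`). The proof rests
on a comparison with the unknown `N`. Where the hull boundary faces `q`, walking along it clockwise
leads from the left of the line to its right, and it changes sides at the stabbed facet. So if `u`
has positive inner product with `q`, then `e(u)` lies to the left of the line exactly when `u` comes
before `N` (`leftSide_iff_of_crossing`). For the other `u` the signs of two products decide, because
`N` does not point against `q` (`cwAngle_neg_lt_iff`). Hence comparing `u` with `N` costs at most
one maximization over the window.

The maximization asks every sub-hull for its extreme vertex, which is known once the rank of `u`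
among the sorted facet normals is known (`IsHullList.vertex_dominates`). These ranks are found by
fractional cascading. Each node keeps a sorted table of its own facets and of every second entry of
the tables of its children. The tables stay linear in size (`length_table_le`), and the rank in a
table fixes the rank in the node's own hull exactly (`link_eq_rank`) and the rank in a child's table
up to one (`rank_le_link_add_one`). The nodes of the canonical cover are siblings of nodes on the
two paths towards the times just before and just after the window (`inCover_iff`), and none is
higher than `log₂ w`. A walk down these paths therefore starts at height `log₂ w` with full binary
searches and afterwards makes at most one comparison per visited node: `O(log w)` comparisons for
any property of keys that holds up to some point (`runs_walkP`, `runs_coverP`).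

The same walk is used twice. The inner one compares with a given direction in constant time and
yields a maximization in `O(log w)`. The outer one compares with `N`, each comparison being an inner
walk, which gives `O(log² w)`. For the outer walk, "before `N`, counted from `-q`" must become an
initial segment of the fixed order `key` in which the tables are sorted; this is
`exists_key_threshold`. Every sub-hull then offers its first and its last facet in the clockwise
order that begins at `N`. The first and the last facet over all sub-hulls are adjacent in `D`, and
`N` lies between them (`adjacent_between_of_shiftedKey`).

Points on the query line are assigned to a side by `LeftSide`, which amounts to a small parallel
shift of the line; this settles the degenerate cases, including the one where all points lie on the
line. -/

namespace WindowedHull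

/-! ## Directions in clockwise order -/

open Real

/-- The clockwise angle from the direction `(1, 0)` to `u`, in `[0, 2π)`. -/
noncomputable def key (u : Pt) : ℝ := toIcoMod two_pi_pos 0 (-Complex.arg ⟨u.1, u.2⟩)

theorem key_nonneg (u : Pt) : 0 ≤ key u := (toIcoMod_mem_Ico two_pi_pos 0 _).1

theorem key_lt (u : Pt) : key u < 2 * π := by
  have := (toIcoMod_mem_Ico two_pi_pos 0 (-Complex.arg ⟨u.1, u.2⟩)).2
  rwa [zero_add] at this

theorem exists_key_eq (u : Pt) : ∃ z : ℤ, key u = -Complex.arg ⟨u.1, u.2⟩ - z * (2 * π) := by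
  refine ⟨toIcoDiv two_pi_pos 0 (-Complex.arg ⟨u.1, u.2⟩), ?_⟩
  rw [key, ← self_sub_toIcoDiv_zsmul, zsmul_eq_mul]

theorem exists_polar {u : Pt} (hu : u ≠ 0) :
    ∃ r : ℝ, 0 < r ∧ u.1 = r * cos (key u) ∧ u.2 = -(r * sin (key u)) := by
  obtain ⟨z, hz⟩ := exists_key_eq u
  have h0 : (⟨u.1, u.2⟩ : ℂ) ≠ 0 := by
    intro h
    apply hu
    have h1 := congrArg Complex.re h
    have h2 := congrArg Complex.im h
    exact Prod.ext h1 h2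
  refine ⟨‖(⟨u.1, u.2⟩ : ℂ)‖, norm_pos_iff.2 h0, ?_, ?_⟩
  · rw [hz, cos_sub_int_mul_two_pi, cos_neg, Complex.norm_mul_cos_arg]
  · rw [hz, sin_sub_int_mul_two_pi, sin_neg, mul_neg, neg_neg, Complex.norm_mul_sin_arg]

theorem cwAngle_eq_of_key_lt {u v : Pt} (h : key u < key v) : cwAngle u v = key v - key u := by
  obtain ⟨z, hz⟩ := exists_key_eq u
  obtain ⟨w, hw⟩ := exists_key_eq v
  refine (toIocMod_eq_iff _).2 ⟨⟨by linarith, ?_⟩, w - z, ?_⟩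
  · linarith [key_nonneg u, key_lt v]
  · rw [zsmul_eq_mul]; push_cast; linarith

theorem cwAngle_eq_of_key_le {u v : Pt} (h : key v ≤ key u) :
    cwAngle u v = key v - key u + 2 * π := by
  obtain ⟨z, hz⟩ := exists_key_eq u
  obtain ⟨w, hw⟩ := exists_key_eq v
  refine (toIocMod_eq_iff _).2 ⟨⟨?_, by linarith⟩, w - z - 1, ?_⟩
  · linarith [key_nonneg v, key_lt u]
  · rw [zsmul_eq_mul]; push_cast; linarith

theorem cwAngle_pos (u v : Pt) : 0 < cwAngle u v := left_lt_toIocMod _ _ _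

theorem cwAngle_le (u v : Pt) : cwAngle u v ≤ 2 * π := by
  have := toIocMod_le_right two_pi_pos 0 (Complex.arg ⟨u.1, u.2⟩ - Complex.arg ⟨v.1, v.2⟩)
  rwa [zero_add] at this

theorem exists_cross_dot_key {u v : Pt} (hu : u ≠ 0) (hv : v ≠ 0) :
    ∃ r : ℝ, 0 < r ∧ cross u v = -(r * sin (key v - key u)) ∧
      dot u v = r * cos (key v - key u) := by
  obtain ⟨a, ha, h1, h2⟩ := exists_polar hu
  obtain ⟨b, hb, h3, h4⟩ := exists_polar hv
  refine ⟨a * b, mul_pos ha hb, ?_, ?_⟩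
  · rw [cross, h1, h2, h3, h4, sin_sub]; ring
  · rw [dot, h1, h2, h3, h4, cos_sub]; ring

/-- Cross and dot product in terms of the clockwise angle. -/
theorem exists_cross_dot_cwAngle {u v : Pt} (hu : u ≠ 0) (hv : v ≠ 0) :
    ∃ r : ℝ, 0 < r ∧ cross u v = -(r * sin (cwAngle u v)) ∧ dot u v = r * cos (cwAngle u v) := by
  obtain ⟨r, hr, h1, h2⟩ := exists_cross_dot_key hu hv
  refine ⟨r, hr, ?_⟩
  rcases lt_or_ge (key u) (key v) with h | h
  · rw [cwAngle_eq_of_key_lt h]; exact ⟨h1, h2⟩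
  · rw [cwAngle_eq_of_key_le h, sin_add_two_pi, cos_add_two_pi]; exact ⟨h1, h2⟩

/-- The half circle `y < 0`, together with the direction `(1, 0)`, at which the clockwise order
begins. -/
def InLower (u : Pt) : Prop := u.2 < 0 ∨ u.2 = 0 ∧ 0 < u.1

theorem inLower_iff {u : Pt} (hu : u ≠ 0) : InLower u ↔ key u < π := by
  obtain ⟨r, hr, h1, h2⟩ := exists_polar hu
  have h0 := key_nonneg u
  constructor
  · intro h
    by_contra! hk
    have hs : sin (key u) ≤ 0 := by
      have := sin_nonneg_of_nonneg_of_le_pi (x := key u - π) (by linarith) (by linarith [key_lt u])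
      rw [sin_sub_pi] at this
      linarith
    rcases h with h | ⟨h, h'⟩
    · nlinarith
    · have hs0 : sin (key u) = 0 := by
        have : r * sin (key u) = 0 := by linarith
        exact (mul_eq_zero.1 this).resolve_left hr.ne'
      have hkp : key u = π := by
        rcases hk.eq_or_lt with e | e
        · exact e.symm
        · have := sin_pos_of_pos_of_lt_pi (x := key u - π) (by linarith) (by linarith [key_lt u])
          rw [sin_sub_pi] at this
          linarith
      rw [h1, hkp, cos_pi] at h'
      linarith
  · intro h
    rcases h0.eq_or_lt with e | e
    · right
      rw [h1, h2, ← e]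
      simp [hr]
    · left
      have := mul_pos hr (sin_pos_of_pos_of_lt_pi e h)
      linarith

theorem cross_nonpos_iff {u v : Pt} (hu : u ≠ 0) (hv : v ≠ 0) (h1 : key u - key v < π)
    (h2 : key v - key u < π) : cross u v ≤ 0 ↔ key u ≤ key v := by
  obtain ⟨r, hr, h, -⟩ := exists_cross_dot_key hu hv
  rw [h, neg_nonpos, mul_nonneg_iff_of_pos_left hr]
  constructor
  · intro h3
    by_contra! h4
    have := sin_pos_of_pos_of_lt_pi (x := -(key v - key u)) (by linarith) (by linarith)
    rw [sin_neg] at this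
    linarith
  · intro h3
    exact sin_nonneg_of_nonneg_of_le_pi (by linarith) h2.le

theorem cross_anticomm (u v : Pt) : cross u v = -cross v u := by
  simp only [cross]; ring

theorem cross_neg_iff {u v : Pt} (hu : u ≠ 0) (hv : v ≠ 0) (h1 : key u - key v < π)
    (h2 : key v - key u < π) : cross u v < 0 ↔ key u < key v := by
  have := cross_nonpos_iff hv hu h2 h1
  rw [cross_anticomm v u, neg_nonpos] at this
  rw [← not_le, this, not_le]

/-- The two half circles are half-open, with keys in `[0, π)` and `[π, 2π)`, so inside one of them
the sign of the sine, and with it the cross product, decides the order. -/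
theorem abs_key_sub_lt {u v : Pt} (hu : u ≠ 0) (hv : v ≠ 0) (h : InLower u ↔ InLower v) :
    key u - key v < π ∧ key v - key u < π := by
  rw [inLower_iff hu, inLower_iff hv] at h
  have := key_nonneg u
  have := key_nonneg v
  have := key_lt u
  have := key_lt v
  by_cases hk : key u < π
  · have := h.1 hk
    constructor <;> linarith
  · have : ¬ key v < π := fun h' => hk (h.2 h')
    constructor <;> linarith

theorem key_le_iff_cross {u v : Pt} (hu : u ≠ 0) (hv : v ≠ 0) (h : InLower u ↔ InLower v) :
    key u ≤ key v ↔ cross u v ≤ 0 :=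
  (cross_nonpos_iff hu hv (abs_key_sub_lt hu hv h).1 (abs_key_sub_lt hu hv h).2).symm

theorem key_lt_iff_cross {u v : Pt} (hu : u ≠ 0) (hv : v ≠ 0) (h : InLower u ↔ InLower v) :
    key u < key v ↔ cross u v < 0 :=
  (cross_neg_iff hu hv (abs_key_sub_lt hu hv h).1 (abs_key_sub_lt hu hv h).2).symm

theorem key_lt_of_inLower {u v : Pt} (hu : u ≠ 0) (hv : v ≠ 0) (h : InLower u)
    (h' : ¬ InLower v) : key u < key v := by
  rw [inLower_iff hu] at h
  rw [inLower_iff hv] at h'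
  linarith

open Classical in
/-- The half circle of `u` as a number: `0` for the first one, `1` for the second one. -/
noncomputable def halfClass (u : Pt) : ℤ := if InLower u then 0 else 1

/-- The form in which the machine compares directions: sign tests and one cross product, no angles.
-/
theorem key_le_iff {u v : Pt} (hu : u ≠ 0) (hv : v ≠ 0) :
    key u ≤ key v ↔
      halfClass u < halfClass v ∨ halfClass u = halfClass v ∧ cross u v ≤ 0 := by
  by_cases h : InLower u <;> by_cases h' : InLower v
  · simp [halfClass, h, h', key_le_iff_cross hu hv (iff_of_true h h')]
  · simp [halfClass, h, h', (key_lt_of_inLower hu hv h h').le]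
  · simp [halfClass, h, h', key_lt_of_inLower hv hu h' h]
  · simp [halfClass, h, h', key_le_iff_cross hu hv (iff_of_false h h')]

/-- A direction whose key lies cyclically between those of two others at a clockwise angle of less
than `π`. -/
theorem cross_of_key_between {a b u : Pt} (ha : a ≠ 0) (hb : b ≠ 0) (hu : u ≠ 0)
    (hab : cross a b < 0)
    (h : key a ≤ key u ∧ key u < key b ∨ key b < key a ∧ (key a ≤ key u ∨ key u < key b)) :
    cross a u ≤ 0 ∧ cross u b < 0 := by
  obtain ⟨r, hr, h1, -⟩ := exists_cross_dot_key ha hb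
  obtain ⟨s, hs, h2, -⟩ := exists_cross_dot_key ha hu
  obtain ⟨t, ht, h3, -⟩ := exists_cross_dot_key hu hb
  have a0 := key_nonneg a
  have b0 := key_nonneg b
  have u0 := key_nonneg u
  have a1 := key_lt a
  have b1 := key_lt b
  have u1 := key_lt u
  rw [h1] at hab
  have hab' : 0 < sin (key b - key a) := by
    by_contra! h'
    have := mul_nonneg hr.le (neg_nonneg.2 h')
    linarith
  rw [h2, h3]
  have goal : ∀ x y : ℝ, 0 ≤ sin x → 0 < sin y → -(s * x.sin) ≤ 0 ∧ -(t * y.sin) < 0 := by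
    intro x y hx hy
    have := mul_nonneg hs.le hx
    have := mul_pos ht hy
    constructor <;> linarith
  apply goal
  · rcases h with ⟨h4, h5⟩ | ⟨h4, h5 | h5⟩
    · have : key b - key a < π := by
        by_contra! h6
        have := sin_nonneg_of_nonneg_of_le_pi (x := key b - key a - π) (by linarith)
          (by linarith)
        rw [sin_sub_pi] at this
        linarith
      exact sin_nonneg_of_nonneg_of_le_pi (by linarith) (by linarith)
    all_goals
      have : key b - key a + 2 * π < π := by
        by_contra! h6
        have := sin_nonneg_of_nonneg_of_le_pi (x := key b - key a - π + 2 * π) (by linarith)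
          (by linarith)
        rw [sin_add_two_pi, sin_sub_pi] at this
        linarith
    · exact sin_nonneg_of_nonneg_of_le_pi (by linarith) (by linarith)
    · rw [← sin_add_two_pi]
      exact sin_nonneg_of_nonneg_of_le_pi (by linarith) (by linarith)
  · rcases h with ⟨h4, h5⟩ | ⟨h4, h5 | h5⟩
    · have : key b - key a < π := by
        by_contra! h6
        have := sin_nonneg_of_nonneg_of_le_pi (x := key b - key a - π) (by linarith)
          (by linarith)
        rw [sin_sub_pi] at this
        linarith
      exact sin_pos_of_pos_of_lt_pi (by linarith) (by linarith)
    all_goals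
      have : key b - key a + 2 * π < π := by
        by_contra! h6
        have := sin_nonneg_of_nonneg_of_le_pi (x := key b - key a - π + 2 * π) (by linarith)
          (by linarith)
        rw [sin_add_two_pi, sin_sub_pi] at this
        linarith
    · rw [← sin_add_two_pi]
      exact sin_pos_of_pos_of_lt_pi (by linarith) (by linarith)
    · exact sin_pos_of_pos_of_lt_pi (by linarith) (by linarith)

/-- For directions `u` and `N` that are not both behind `q`, the clockwise order that begins at
`-q`. -/
theorem cwAngle_neg_lt_iff {q u N : Pt} (hq : q ≠ 0) (hu : u ≠ 0) (hN : N ≠ 0)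
    (h : 0 < dot N q ∨ dot N q = 0 ∧ cross q N < 0) :
    cwAngle (-q) u < cwAngle (-q) N ↔
      if dot u q ≤ 0 then 0 < cross q u else cross u N < 0 := by
  have hq' : -q ≠ 0 := neg_ne_zero.2 hq
  obtain ⟨r, hr, h1, h2⟩ := exists_cross_dot_cwAngle hq' hu
  obtain ⟨s, hs, h3, h4⟩ := exists_cross_dot_cwAngle hq' hN
  have a0 := cwAngle_pos (-q) u
  have a1 := cwAngle_le (-q) u
  have b0 := cwAngle_pos (-q) N
  have b1 := cwAngle_le (-q) N
  set x := cwAngle (-q) u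
  set y := cwAngle (-q) N
  have e1 : cross q u = r * sin x := by
    have : cross (-q) u = -cross q u := by simp only [cross, Prod.fst_neg, Prod.snd_neg]; ring
    linarith
  have e2 : dot u q = -(r * cos x) := by
    have : dot (-q) u = -dot u q := by simp only [dot, Prod.fst_neg, Prod.snd_neg]; ring
    linarith
  have e3 : cross q N = s * sin y := by
    have : cross (-q) N = -cross q N := by simp only [cross, Prod.fst_neg, Prod.snd_neg]; ring
    linarith
  have e4 : dot N q = -(s * cos y) := by
    have : dot (-q) N = -dot N q := by simp only [dot, Prod.fst_neg, Prod.snd_neg]; ring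
    linarith
  have pp := pi_pos
  have cpos : ∀ z : ℝ, 0 < z → z < π / 2 → 0 < cos z := fun z hz hz' =>
    cos_pos_of_mem_Ioo ⟨by linarith, hz'⟩
  have cpos' : ∀ z : ℝ, 3 * π / 2 < z → z ≤ 2 * π → 0 < cos z := fun z hz hz' => by
    rw [← cos_sub_two_pi]
    exact cos_pos_of_mem_Ioo ⟨by linarith, by linarith⟩
  have cneg : ∀ z : ℝ, π / 2 < z → z < 3 * π / 2 → cos z < 0 := fun z hz hz' =>
    cos_neg_of_pi_div_two_lt_of_lt hz (by linarith)
  -- `N` faces `q` or is `q` turned clockwise by a right angle. Counted from `-q` this is a half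
  -- turn, open at its beginning and closed at its end.
  have hy : π / 2 < y ∧ y ≤ 3 * π / 2 := by
    have hc : cos y ≤ 0 := by
      by_contra! hc
      have := mul_pos hs hc
      rcases h with h | h <;> linarith [h]
    constructor
    · by_contra! hy
      rcases hy.eq_or_lt with e | e
      · rw [e, cos_pi_div_two] at e4
        rw [e, sin_pi_div_two] at e3
        rcases h with h | h
        · linarith
        · linarith [h.2]
      · linarith [cpos y b0 e]
    · by_contra! hy
      linarith [cpos' y hy b1]
  split_ifs with hd
  -- Here `u` does not face `q`, so it lies in the first or in the last quarter turn after `-q`; the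
  -- first is before `N` and the last is not. The side of `q` tells them apart.
  · have hc : 0 ≤ cos x := by
      by_contra! hc
      have := mul_pos hr (neg_pos.2 hc)
      linarith
    rw [e1]
    constructor
    · intro hxy
      have : x ≤ π / 2 := by
        by_contra! h5
        linarith [cneg x h5 (by linarith)]
      exact mul_pos hr (sin_pos_of_pos_of_lt_pi a0 (by linarith))
    · intro hsx
      have : x ≤ π / 2 := by
        by_contra! h5
        have h6 : 3 * π / 2 ≤ x := by
          by_contra! h6
          linarith [cneg x h5 h6]
        have h7 := sin_nonneg_of_nonneg_of_le_pi (x := x - π) (by linarith) (by linarith)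
        rw [sin_sub_pi] at h7
        have := mul_nonneg hr.le h7
        linarith
      linarith
  · have hc : cos x < 0 := by
      by_contra! hc
      have := mul_nonneg hr.le hc
      linarith
    have x1 : π / 2 < x := by
      by_contra! h5
      have := cos_nonneg_of_mem_Icc (x := x) ⟨by linarith, h5⟩
      linarith
    have x2 : x < 3 * π / 2 := by
      by_contra! h5
      have := cos_nonneg_of_mem_Icc (x := x - 2 * π) ⟨by linarith, by linarith⟩
      rw [cos_sub_two_pi] at this
      linarith
    obtain ⟨t, ht, h5, -⟩ := exists_cross_dot_key hu hN
    -- Clockwise angles from `-q` and differences of keys agree up to full turns.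
    have h6 : sin (key N - key u) = sin (y - x) := by
      have hx : ∃ z : ℤ, x = key u - key (-q) + z * (2 * π) := by
        rcases lt_or_ge (key (-q)) (key u) with h' | h'
        · exact ⟨0, by rw [← cwAngle_eq_of_key_lt h']; simp [x]⟩
        · exact ⟨1, by rw [Int.cast_one, one_mul, ← cwAngle_eq_of_key_le h']⟩
      have hy : ∃ z : ℤ, y = key N - key (-q) + z * (2 * π) := by
        rcases lt_or_ge (key (-q)) (key N) with h' | h'
        · exact ⟨0, by rw [← cwAngle_eq_of_key_lt h']; simp [y]⟩
        · exact ⟨1, by rw [Int.cast_one, one_mul, ← cwAngle_eq_of_key_le h']⟩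
      obtain ⟨z, hz⟩ := hx
      obtain ⟨w, hw⟩ := hy
      have : y - x = key N - key u + ((w - z : ℤ) : ℝ) * (2 * π) := by
        rw [hz, hw]; push_cast; ring
      rw [this, sin_add_int_mul_two_pi]
    rw [h5, h6]
    constructor
    · intro hxy
      have := mul_pos ht (sin_pos_of_pos_of_lt_pi (x := y - x) (by linarith) (by linarith))
      linarith
    · intro hs
      by_contra! hxy
      have h7 := sin_nonneg_of_nonneg_of_le_pi (x := x - y) (by linarith) (by linarith)
      rw [← neg_sub, sin_neg] at h7
      have := mul_nonneg ht.le h7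
      linarith

end WindowedHull

/-! ### Clockwise orders with different starting directions. -/

namespace WindowedHull

open Real

/-- The clockwise order that begins at `-q`, in terms of the one that begins at `(1, 0)`. -/
theorem exists_key_threshold {q N : Pt} (hN : cwAngle (-q) N < 2 * π) :
    ∃ y : ℝ, 0 < y ∧ (y = key N ∨ y = key N + 2 * π ∧ key N = 0) ∧
      ∀ u : Pt, key u < y ↔
        if cwAngle (-q) (1, 0) < cwAngle (-q) N then
          key u ≤ key (-q) ∧ cwAngle (-q) u < cwAngle (-q) N
        else key u ≤ key (-q) ∨ cwAngle (-q) u < cwAngle (-q) N := by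
  have hc : key (1, 0) = 0 := by
    have h0 : ((1, 0) : Pt) ≠ 0 := by simp
    have := key_nonneg (1, 0)
    have h1 : key (1, 0) < π := (inLower_iff h0).1 (Or.inr ⟨rfl, one_pos⟩)
    obtain ⟨r, hr, -, h3⟩ := exists_polar h0
    by_contra hk
    have := mul_pos hr (sin_pos_of_pos_of_lt_pi (lt_of_le_of_ne this (Ne.symm hk)) h1)
    simp only at h3
    linarith
  have k0 := key_nonneg (-q)
  have k1 := key_lt (-q)
  have hψ : ∀ u : Pt, (key (-q) < key u ∧ cwAngle (-q) u = key u - key (-q)) ∨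
      (key u ≤ key (-q) ∧ cwAngle (-q) u = key u - key (-q) + 2 * π) := fun u =>
    (lt_or_ge (key (-q)) (key u)).imp (fun h => ⟨h, cwAngle_eq_of_key_lt h⟩)
      fun h => ⟨h, cwAngle_eq_of_key_le h⟩
  have hc' : cwAngle (-q) (1, 0) = 2 * π - key (-q) := by
    rw [cwAngle_eq_of_key_le (by rw [hc]; exact k0), hc]; ring
  have n0 := key_nonneg N
  have n1 := key_lt N
  have nN := cwAngle_pos (-q) N
  rw [hc']
  split_ifs with h
  · rcases hψ N with ⟨h1, h2⟩ | ⟨h1, h2⟩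
    · linarith
    · refine ⟨key N, by linarith, Or.inl rfl, fun u => ?_⟩
      rcases hψ u with ⟨h3, h4⟩ | ⟨h3, h4⟩
      · constructor
        · intro; linarith
        · intro h5; linarith [h5.1]
      · rw [h2, h4]
        constructor
        · intro; exact ⟨h3, by linarith⟩
        · intro h5; linarith [h5.2]
  · rcases hψ N with ⟨h1, h2⟩ | ⟨h1, h2⟩
    · refine ⟨key N, by linarith, Or.inl rfl, fun u => ?_⟩
      rcases hψ u with ⟨h3, h4⟩ | ⟨h3, h4⟩
      · rw [h2, h4]
        constructor
        · intro; right; linarith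
        · rintro (h5 | h5) <;> linarith
      · constructor
        · intro; exact Or.inl h3
        · intro; linarith
    · have hN0 : key N = 0 := by linarith
      refine ⟨key N + 2 * π, by linarith [pi_pos], Or.inr ⟨rfl, hN0⟩, fun u => ?_⟩
      have u1 := key_lt u
      rcases hψ u with ⟨h3, h4⟩ | ⟨h3, h4⟩
      · rw [h2, h4]
        constructor
        · intro; right; linarith
        · intro; linarith
      · constructor
        · intro; exact Or.inl h3
        · intro; linarith

/-- The clockwise order in which the directions with keys at least `y` come first. -/
noncomputable def shiftedKey (y : ℝ) (u : Pt) : ℝ := key u + if key u < y then 2 * π else 0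

/-- Going clockwise from `u`, a direction that is not later in the shifted order is met only after
the start of that order has been passed, hence the full turn. For equal directions it is the full
turn of the convention for `cwAngle`. -/
theorem cwAngle_eq_shiftedKey {y : ℝ} {u v : Pt}
    (h : shiftedKey y v ≤ shiftedKey y u) :
    cwAngle u v = shiftedKey y v - shiftedKey y u + 2 * π := by
  have := key_nonneg u
  have := key_nonneg v
  have := key_lt u
  have := key_lt v
  have := pi_pos
  unfold shiftedKey at h ⊢
  rcases lt_or_ge (key u) (key v) with h' | h'
  · rw [cwAngle_eq_of_key_lt h']
    split_ifs at h ⊢ <;> linarith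
  · rw [cwAngle_eq_of_key_le h']
    split_ifs at h ⊢ <;> linarith

/-- The last and the first element of `D` in a shifted clockwise order are adjacent, and the
direction at which the shifted order begins is between them. -/
theorem adjacent_between_of_shiftedKey {D : Set Pt} {y : ℝ} {u v N : Pt} (hu : u ∈ D) (hv : v ∈ D)
    (hu' : ∀ x ∈ D, shiftedKey y x ≤ shiftedKey y u)
    (hv' : ∀ x ∈ D, shiftedKey y v ≤ shiftedKey y x)
    (hy : y = key N ∨ y = key N + 2 * π ∧ key N = 0) : Adjacent D u v ∧ Between u N v := by
  refine ⟨⟨hu, hv, fun x hx h => ?_⟩, ?_⟩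
  · rw [StrictlyBetween, cwAngle_eq_shiftedKey (hu' x hx), cwAngle_eq_shiftedKey (hu' v hv)] at h
    linarith [hv' x hx]
  · have key_lt_all := key_lt
    have h1 : ∀ x : Pt, y ≤ shiftedKey y x := fun x => by
      have := key_nonneg x
      have := key_lt N
      unfold shiftedKey
      split_ifs with h
      · rcases hy with hy | hy <;> linarith [pi_pos]
      · linarith
    rw [Between, cwAngle_eq_shiftedKey (hu' v hv)]
    have h2 : cwAngle u N = y - shiftedKey y u + 2 * π := by
      have a1 := h1 u
      have := key_nonneg u
      have := key_lt u
      have := key_lt N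
      have := key_nonneg N
      unfold shiftedKey at a1 ⊢
      rcases lt_or_ge (key u) (key N) with h' | h'
      · rw [cwAngle_eq_of_key_lt h']
        rcases hy with hy | ⟨hy, hy'⟩
        · rw [if_pos (by linarith)]; linarith
        · linarith
      · rw [cwAngle_eq_of_key_le h']
        rcases hy with hy | ⟨hy, hy'⟩
        · rw [if_neg (by linarith)]; linarith
        · rw [if_pos (by linarith)]; linarith
    rw [h2]
    linarith [h1 v]

end WindowedHull

namespace WindowedHull

/-! ## Convex hulls of finite planar sets -/

/-- Krein–Milman; the closure in it is superfluous because the hull of finitely many points is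
already closed. -/
theorem convexHull_extremePoints {S : Set Pt} (hS : S.Finite) :
    convexHull ℝ ((convexHull ℝ S).extremePoints ℝ) = convexHull ℝ S := by
  have h1 : ((convexHull ℝ S).extremePoints ℝ).Finite :=
    hS.subset extremePoints_convexHull_subset
  have h2 := closure_convexHull_extremePoints (hS.isCompact_convexHull ℝ) (convex_convexHull ℝ S)
  rwa [(h1.isCompact_convexHull ℝ).isClosed.closure_eq] at h2

/-- Three different extreme points are not collinear. -/
theorem cross_ne_zero_of_extremePoints {S : Set Pt} {a b c : Pt} (ha : a ∈ S.extremePoints ℝ)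
    (hb : b ∈ S.extremePoints ℝ) (hc : c ∈ S.extremePoints ℝ) (hab : a ≠ b) (hac : a ≠ c)
    (hbc : b ≠ c) : cross (b - a) (c - a) ≠ 0 := by
  intro h
  obtain ⟨s, hs⟩ : ∃ s : ℝ, c = a + s • (b - a) := by
    simp only [cross, Prod.fst_sub, Prod.snd_sub] at h
    by_cases h1 : b.1 - a.1 = 0
    · have h2 : b.2 - a.2 ≠ 0 := fun h2 => hab (Prod.ext (by linarith) (by linarith))
      refine ⟨(c.2 - a.2) / (b.2 - a.2), Prod.ext ?_ ?_⟩
      · simp only [Prod.fst_add, Prod.smul_fst, Prod.fst_sub, smul_eq_mul, h1]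
        rw [h1] at h
        have : c.1 - a.1 = 0 := by
          have : (b.2 - a.2) * (c.1 - a.1) = 0 := by linarith
          exact (mul_eq_zero.1 this).resolve_left h2
        linarith
      · simp only [Prod.snd_add, Prod.smul_snd, Prod.snd_sub, smul_eq_mul]
        rw [div_mul_cancel₀ _ h2]; ring
    · refine ⟨(c.1 - a.1) / (b.1 - a.1), Prod.ext ?_ ?_⟩
      · simp only [Prod.fst_add, Prod.smul_fst, Prod.fst_sub, smul_eq_mul]
        rw [div_mul_cancel₀ _ h1]; ring
      · simp only [Prod.snd_add, Prod.smul_snd, Prod.snd_sub, smul_eq_mul]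
        field_simp
        linarith
  -- On a line one of the three points lies strictly between the others: `a` if `s < 0`, `c` if `0 <
  -- s < 1`, `b` if `s > 1`. That contradicts its extremality.
  rcases lt_trichotomy s 0 with h0 | h0 | h0
  · refine hab (ha.2 hb.1 hc.1 ⟨-s / (1 - s), 1 / (1 - s), ?_, ?_, ?_, ?_⟩).symm
    · exact div_pos (by linarith) (by linarith)
    · exact div_pos (by linarith) (by linarith)
    · field_simp [show 1 - s ≠ 0 by linarith]; ring
    · rw [hs]
      have : 1 - s ≠ 0 := by linarith
      ext <;> simp only [Prod.fst_add, Prod.snd_add, Prod.smul_fst, Prod.smul_snd, Prod.fst_sub,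
        Prod.snd_sub, smul_eq_mul] <;> field_simp <;> ring
  · exact hac (by rw [hs, h0]; simp)
  · rcases lt_trichotomy s 1 with h1 | h1 | h1
    · refine hac (hc.2 ha.1 hb.1 ⟨1 - s, s, by linarith, h0, by ring, ?_⟩)
      rw [hs]
      ext <;> simp only [Prod.fst_add, Prod.snd_add, Prod.smul_fst, Prod.smul_snd, Prod.fst_sub,
        Prod.snd_sub, smul_eq_mul] <;> ring
    · exact hbc (by rw [hs, h1]; simp)
    · refine hab (hb.2 ha.1 hc.1 ⟨(s - 1) / s, 1 / s, ?_, ?_, ?_, ?_⟩)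
      · exact div_pos (by linarith) h0
      · exact div_pos one_pos h0
      · field_simp; ring
      · rw [hs]
        ext <;> simp only [Prod.fst_add, Prod.snd_add, Prod.smul_fst, Prod.smul_snd, Prod.fst_sub,
          Prod.snd_sub, smul_eq_mul] <;> field_simp <;> ring

theorem dot_edgeNormal (a b d : Pt) : dot (edgeNormal a b) d = cross (b - a) d := by
  simp only [dot, edgeNormal, cross, Prod.fst_sub, Prod.snd_sub]; ring

theorem edgeNormal_ne_zero {a b : Pt} (h : a ≠ b) : edgeNormal a b ≠ 0 := by
  intro h0
  have h1 := congrArg Prod.fst h0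
  have h2 := congrArg Prod.snd h0
  simp only [edgeNormal, Prod.fst_zero, Prod.snd_zero] at h1 h2
  exact h (Prod.ext (by linarith) (by linarith))

theorem inLower_edgeNormal (a b : Pt) : InLower (edgeNormal a b) ↔ toLex b < toLex a := by
  rw [Prod.Lex.toLex_lt_toLex]
  simp only [InLower, edgeNormal, sub_neg, sub_eq_zero, sub_pos]

/-- `a` beats all points at displacements `d`: first in the direction `u`, then in the direction
`u` turned clockwise by a right angle. -/
def Dominates (u d : Pt) : Prop := dot u d < 0 ∨ dot u d = 0 ∧ 0 ≤ cross u d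

theorem dominates_zero (u : Pt) : Dominates u 0 := by
  right; simp [dot, cross]

theorem dot_self_pos {u : Pt} (hu : u ≠ 0) : 0 < dot u u := by
  by_contra! h
  simp only [dot] at h
  apply hu
  have h1 := mul_self_nonneg u.1
  have h2 := mul_self_nonneg u.2
  exact Prod.ext (mul_self_eq_zero.1 (by linarith)) (mul_self_eq_zero.1 (by linarith))

/-- By Cramer's rule `u` is a combination of `a` and `b` with non-negative coefficients, so the
bounds for `a` and `b` carry over. If `u` is orthogonal to `d`, the bound for `b`, which lies
strictly clockwise of `u`, fixes the sign of the second coordinate. -/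
theorem dominates_of_cone {a b u d : Pt} (hu : u ≠ 0) (hab : cross a b < 0) (hau : cross a u ≤ 0)
    (hub : cross u b < 0) (ha : dot a d ≤ 0) (hb : dot b d ≤ 0) : Dominates u d := by
  have h1 : cross a b * dot u d = cross u b * dot a d + cross a u * dot b d := by
    simp only [cross, dot]; ring
  have h2 : 0 ≤ cross u b * dot a d := mul_nonneg_of_nonpos_of_nonpos hub.le ha
  have h3 : 0 ≤ cross a u * dot b d := mul_nonneg_of_nonpos_of_nonpos hau hb
  have h4 : dot u d ≤ 0 := by
    by_contra! h
    have := mul_neg_of_neg_of_pos hab h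
    linarith
  rcases h4.lt_or_eq with h | h
  · exact Or.inl h
  · refine Or.inr ⟨h, ?_⟩
    have h5 : dot u u * dot b d = cross u d * cross u b + dot u d * dot u b := by
      simp only [cross, dot]; ring
    rw [h, zero_mul, add_zero] at h5
    by_contra! h6
    have := mul_pos_of_neg_of_neg h6 hub
    have := mul_nonpos_of_nonneg_of_nonpos (dot_self_pos hu).le hb
    linarith

/-- The counterpart of `cross_of_key_between` for a hull with two vertices, whose normals are
opposite and span a half plane instead of a pointed cone. -/
theorem cross_of_key_between_opposite {a b u : Pt} (ha : a ≠ 0) (hb : b ≠ 0) (hu : u ≠ 0)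
    (hab : cross a b = 0) (hab' : dot a b < 0)
    (h : key a ≤ key u ∧ key u < key b ∨ key b < key a ∧ (key a ≤ key u ∨ key u < key b)) :
    cross a u < 0 ∨ cross a u = 0 ∧ 0 < dot a u := by
  obtain ⟨r, hr, h1, h1'⟩ := exists_cross_dot_key ha hb
  obtain ⟨s, hs, h2, h2'⟩ := exists_cross_dot_key ha hu
  have a0 := key_nonneg a
  have b0 := key_nonneg b
  have u0 := key_nonneg u
  have a1 := key_lt a
  have b1 := key_lt b
  have u1 := key_lt u
  have hsin : Real.sin (key b - key a) = 0 := by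
    rw [h1, neg_eq_zero] at hab
    exact (mul_eq_zero.1 hab).resolve_left hr.ne'
  have pp := Real.pi_pos
  have hne : key a ≠ key b := by
    intro e
    rw [h1', e, sub_self, Real.cos_zero] at hab'
    linarith
  have sin_zero : ∀ x : ℝ, 0 < x → x < 2 * Real.pi → Real.sin x = 0 → x = Real.pi := by
    intro x h3 h4 h5
    rcases lt_trichotomy x Real.pi with h6 | h6 | h6
    · linarith [Real.sin_pos_of_pos_of_lt_pi h3 h6]
    · exact h6
    · have := Real.sin_pos_of_pos_of_lt_pi (x := x - Real.pi) (by linarith) (by linarith)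
      rw [Real.sin_sub_pi] at this
      linarith
  rw [h2, h2']
  have fin : ∀ x : ℝ, 0 ≤ x → x < Real.pi →
      -(s * Real.sin x) < 0 ∨ -(s * Real.sin x) = 0 ∧ 0 < s * Real.cos x := by
    intro x h3 h4
    rcases h3.eq_or_lt with e | e
    · right; rw [← e]; simp [hs]
    · left
      have := mul_pos hs (Real.sin_pos_of_pos_of_lt_pi e h4)
      linarith
  rcases h with ⟨h4, h5⟩ | ⟨h4, h5⟩
  · have := sin_zero _ (by linarith) (by linarith) hsin
    exact fin _ (by linarith) (by linarith)
  · have := sin_zero (key a - key b) (by linarith) (by linarith)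
      (by rw [← neg_sub, Real.sin_neg, hsin, neg_zero])
    rcases h5 with h5 | h5
    · exact fin _ (by linarith) (by linarith)
    · rw [← Real.sin_add_two_pi, ← Real.cos_add_two_pi]
      exact fin _ (by linarith) (by linarith)

/-! ## Hull lists -/

namespace IsHullList

variable {n : ℕ} {p : Fin n → Pt} {C : Finset (Fin n)} {L : List (Fin n)}

theorem vertex_eq {k : ℕ} (hk : k < L.length) : vertex p L k = p L[k] := by
  rw [vertex, Nat.mod_eq_of_lt hk, List.getD_eq_getElem _ _ (by simpa using hk), List.getElem_map]

theorem vertex_mod (k : ℕ) : vertex p L (k % L.length) = vertex p L k := by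
  rw [vertex, vertex, Nat.mod_mod]

theorem vertex_add_length (k : ℕ) : vertex p L (k + L.length) = vertex p L k := by
  rw [vertex, vertex, Nat.add_mod_right]

theorem exists_vertex_eq (h : IsHullList p C L) (hL : 0 < L.length) (k : ℕ) :
    ∃ t ∈ C, vertex p L k = p t := by
  have hk := Nat.mod_lt k hL
  exact ⟨L[k % L.length], h.mem _ (List.getElem_mem _), by
    rw [← vertex_mod, vertex_eq hk]⟩

theorem vertex_extreme (h : IsHullList p C L) (hL : 0 < L.length) (k : ℕ) :
    vertex p L k ∈ (convexHull ℝ (p '' (C : Set (Fin n)))).extremePoints ℝ := by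
  have hk := Nat.mod_lt k hL
  rw [← h.vertices, ← vertex_mod, vertex_eq hk]
  exact List.mem_map_of_mem (List.getElem_mem _)

theorem vertex_inj (h : IsHullList p C L) {k l : ℕ} (hk : k < L.length) (hl : l < L.length)
    (e : vertex p L k = vertex p L l) : k = l := by
  rw [vertex_eq hk, vertex_eq hl] at e
  have := h.nodup
  exact (List.Nodup.getElem_inj_iff this (i := k) (j := l) (hi := by simpa using hk)
    (hj := by simpa using hl)).1 (by simpa using e)

theorem vertex_inj_mod (h : IsHullList p C L) (hL : 0 < L.length) {k l : ℕ}
    (e : vertex p L k = vertex p L l) : k % L.length = l % L.length := by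
  rw [← vertex_mod k, ← vertex_mod l] at e
  exact h.vertex_inj (Nat.mod_lt _ hL) (Nat.mod_lt _ hL) e

theorem vertex_ne_succ (h : IsHullList p C L) (hL : 2 ≤ L.length) (k : ℕ) :
    vertex p L k ≠ vertex p L (k + 1) := by
  intro e
  have e' : k ≡ k + 1 [MOD L.length] := h.vertex_inj_mod (by omega) e
  have := (Nat.modEq_iff_dvd' (by omega)).1 e'
  have := Nat.le_of_dvd (by omega) this
  omega

theorem clockwise' (h : IsHullList p C L) (hL : 0 < L.length) (k : ℕ) {t : Fin n} (ht : t ∈ C) :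
    cross (vertex p L (k + 1) - vertex p L k) (p t - vertex p L k) ≤ 0 := by
  have := h.clockwise (k % L.length) (Nat.mod_lt _ hL) t ht
  rw [vertex_mod] at this
  have e : vertex p L (k % L.length + 1) = vertex p L (k + 1) := by
    rw [vertex, vertex, Nat.mod_add_mod]
  rwa [e] at this

theorem length_pos (h : IsHullList p C L) (hC : C.Nonempty) : 0 < L.length := by
  obtain ⟨t, ht⟩ := hC
  by_contra! h0
  have hL : L = [] := List.length_eq_zero_iff.1 (by omega)
  have h1 := h.vertices
  have h2 : (convexHull ℝ (p '' (C : Set (Fin n)))).extremePoints ℝ = ∅ := by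
    rw [← h1, hL]; simp
  have h3 := convexHull_extremePoints (C.finite_toSet.image p)
  rw [h2, convexHull_empty] at h3
  have : p t ∈ convexHull ℝ (p '' (C : Set (Fin n))) :=
    subset_convexHull ℝ _ ⟨t, ht, rfl⟩
  rw [← h3] at this
  exact this

/-- The outward normal of the `k`-th facet. -/
noncomputable def _root_.WindowedHull.facetNormal {n : ℕ} (p : Fin n → Pt) (L : List (Fin n))
    (k : ℕ) : Pt := edgeNormal (vertex p L k) (vertex p L (k + 1))

theorem facetNormal_ne_zero (h : IsHullList p C L) (hL : 2 ≤ L.length) (k : ℕ) :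
    facetNormal p L k ≠ 0 := edgeNormal_ne_zero (h.vertex_ne_succ hL k)

theorem facetNormal_add_length (k : ℕ) :
    facetNormal p L (k + L.length) = facetNormal p L k := by
  rw [facetNormal, vertex_add_length, show k + L.length + 1 = k + 1 + L.length by omega,
    vertex_add_length, facetNormal]

/-- The hull list gives the weak inequality. It is strict because three consecutive vertices are
different extreme points, which are not collinear. -/
theorem cross_facetNormal (h : IsHullList p C L) (hL : 3 ≤ L.length) (k : ℕ) :
    cross (facetNormal p L k) (facetNormal p L (k + 1)) < 0 := by
  have e : cross (facetNormal p L k) (facetNormal p L (k + 1)) =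
      cross (vertex p L (k + 1) - vertex p L k) (vertex p L (k + 2) - vertex p L k) := by
    simp only [facetNormal, edgeNormal, cross, Prod.fst_sub, Prod.snd_sub]; ring
  obtain ⟨t, ht, ht'⟩ := h.exists_vertex_eq (by omega) (k + 2)
  have h1 := h.clockwise' (by omega) k ht
  rw [← ht'] at h1
  rw [e]
  refine lt_of_le_of_ne h1 (cross_ne_zero_of_extremePoints (h.vertex_extreme (by omega) k)
    (h.vertex_extreme (by omega) _) (h.vertex_extreme (by omega) _)
    (h.vertex_ne_succ (by omega) k) ?_ (h.vertex_ne_succ (by omega) (k + 1)))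
  intro e
  have e' : k ≡ k + 2 [MOD L.length] := h.vertex_inj_mod (by omega) e
  have := (Nat.modEq_iff_dvd' (by omega)).1 e'
  have := Nat.le_of_dvd (by omega) this
  omega

theorem dot_facetNormal (h : IsHullList p C L) (hL : 0 < L.length) (k : ℕ) {t : Fin n}
    (ht : t ∈ C) : dot (facetNormal p L k) (p t - vertex p L k) ≤ 0 := by
  rw [facetNormal, dot_edgeNormal]
  exact h.clockwise' hL k ht

theorem dot_facetNormal_succ (h : IsHullList p C L) (hL : 0 < L.length) (k : ℕ) {t : Fin n}
    (ht : t ∈ C) : dot (facetNormal p L k) (p t - vertex p L (k + 1)) ≤ 0 := by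
  have h1 := h.dot_facetNormal hL k ht
  have h2 : dot (facetNormal p L k) (p t - vertex p L (k + 1)) =
      dot (facetNormal p L k) (p t - vertex p L k) := by
    simp only [facetNormal, edgeNormal, dot, Prod.fst_sub, Prod.snd_sub]; ring
  linarith

/-- The facets of the lower hull come before those of the upper hull. -/
theorem inLower_of_succ (h : IsHullList p C L) {k : ℕ} (hk : k + 1 < L.length)
    (hl : InLower (facetNormal p L (k + 1))) : InLower (facetNormal p L k) := by
  by_contra hu
  have hL : 0 < L.length := by omega
  have hne : L ≠ [] := List.ne_nil_of_length_pos hL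
  obtain ⟨t₁, ht₁, e₁⟩ := h.exists_vertex_eq hL (k + 1)
  have hmax := h.start hne t₁ ht₁
  rw [← e₁] at hmax
  have h01 : vertex p L (k + 1) ≠ vertex p L 0 := fun e => by
    have := h.vertex_inj hk hL e
    omega
  by_cases h2 : L.length = 2
  · have hk0 : k = 0 := by omega
    subst hk0
    rw [facetNormal, inLower_edgeNormal, not_lt] at hu
    exact h01 (toLex.injective (le_antisymm hmax hu))
  · obtain ⟨t, ht, e⟩ := h.exists_vertex_eq hL 0
    have hc := h.cross_facetNormal (by omega) k
    have ha := h.dot_facetNormal_succ hL k ht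
    have hb := h.dot_facetNormal hL (k + 1) ht
    have hN0 := h.facetNormal_ne_zero (by omega) k
    rw [← e] at ha hb
    have hlt : toLex (vertex p L (k + 1)) < toLex (vertex p L 0) :=
      lt_of_le_of_ne hmax fun e => h01 (toLex.injective e)
    rw [Prod.Lex.toLex_lt_toLex] at hlt
    generalize facetNormal p L k = N at *
    generalize facetNormal p L (k + 1) = N' at *
    generalize vertex p L (k + 1) = b at *
    generalize vertex p L 0 = x at *
    simp only [InLower, cross, dot, Prod.fst_sub, Prod.snd_sub, not_or, not_lt, not_and] at *
    have n2 : N'.2 ≤ 0 := by rcases hl with hl | hl <;> linarith [hl]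
    -- If an upper facet were followed by a lower one at `b`, both would bound the first vertex `x`.
    -- Eliminating the second coordinate shows that `x` is not to the right of `b`; the case of
    -- equal first coordinates is excluded as well, against `x` being lexicographically greater.
    have h1 : (N.1 * N'.2 - N.2 * N'.1) * (x.1 - b.1) =
        N'.2 * (N.1 * (x.1 - b.1) + N.2 * (x.2 - b.2)) -
          N.2 * (N'.1 * (x.1 - b.1) + N'.2 * (x.2 - b.2)) := by ring
    have h2 := mul_nonneg_of_nonpos_of_nonpos n2 ha
    have h3 := mul_nonpos_of_nonneg_of_nonpos hu.1 hb
    rcases hlt with hlt | ⟨hlt, hlt'⟩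
    · have := mul_neg_of_neg_of_pos hc (sub_pos.2 hlt)
      linarith
    · have hd : 0 < x.2 - b.2 := by linarith
      rw [hlt, sub_self, mul_zero, zero_add] at ha
      have h20 : N.2 = 0 := by
        refine le_antisymm ?_ hu.1
        by_contra! h'
        have := mul_pos h' hd
        linarith
      have h10 := hu.2 h20
      rw [h20] at hc
      have := mul_nonneg_of_nonpos_of_nonpos h10 n2
      linarith

/-- Because the list begins at the lexicographically greatest vertex, it runs through the lower hull
first, and the only jump between the half circles goes in the right direction. Inside a half circle
consecutive normals turn clockwise; with two vertices the normals are opposite and cannot share a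
half circle. -/
theorem key_facetNormal_lt_succ (h : IsHullList p C L) {k : ℕ} (hk : k + 1 < L.length) :
    key (facetNormal p L k) < key (facetNormal p L (k + 1)) := by
  have h0 := h.facetNormal_ne_zero (by omega) k
  have h1 := h.facetNormal_ne_zero (by omega) (k + 1)
  by_cases hl : InLower (facetNormal p L k) <;> by_cases hl' : InLower (facetNormal p L (k + 1))
  · have h3 : 3 ≤ L.length := by
      by_contra h3
      have hk0 : k = 0 := by omega
      subst hk0
      have hv : vertex p L (0 + 1 + 1) = vertex p L 0 := by
        have h2 : L.length = 2 := by omega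
        have := vertex_add_length (p := p) (L := L) 0
        rw [h2] at this
        exact this
      rw [facetNormal, inLower_edgeNormal] at hl hl'
      rw [hv] at hl'
      exact lt_asymm hl hl'
    rw [key_lt_iff_cross h0 h1 (iff_of_true hl hl')]
    exact h.cross_facetNormal h3 k
  · exact key_lt_of_inLower h0 h1 hl hl'
  · exact absurd (h.inLower_of_succ hk hl') hl
  · have h3 : 3 ≤ L.length := by
      by_contra h3
      have hk0 : k = 0 := by omega
      subst hk0
      have hv : vertex p L (0 + 1 + 1) = vertex p L 0 := by
        have h2 : L.length = 2 := by omega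
        have := vertex_add_length (p := p) (L := L) 0
        rw [h2] at this
        exact this
      have hne := h.vertex_ne_succ (by omega) 0
      rw [facetNormal, inLower_edgeNormal] at hl hl'
      rw [hv] at hl'
      exact hne (toLex.injective (le_antisymm (not_lt.1 hl) (not_lt.1 hl')))
    rw [key_lt_iff_cross h0 h1 (iff_of_false hl hl')]
    exact h.cross_facetNormal h3 k

/-- The facets of a hull list come in clockwise order. -/
theorem key_facetNormal_lt (h : IsHullList p C L) {k l : ℕ} (hkl : k < l) (hl : l < L.length) :
    key (facetNormal p L k) < key (facetNormal p L l) := by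
  induction l, hkl using Nat.le_induction with
  | base => exact h.key_facetNormal_lt_succ hl
  | succ l hkl ih => exact (ih (by omega)).trans (h.key_facetNormal_lt_succ hl)

/-- The two facets that meet at a vertex bound all points there, hence so does every direction in
the cone of their normals. The second alternative for the keys is the vertex at which the cyclic
order passes `(1, 0)`. -/
theorem vertex_dominates_of_cone (h : IsHullList p C L) (hL : 2 ≤ L.length) {u : Pt} (hu : u ≠ 0)
    (k : ℕ)
    (hk : key (facetNormal p L k) ≤ key u ∧ key u < key (facetNormal p L (k + 1)) ∨
      key (facetNormal p L (k + 1)) < key (facetNormal p L k) ∧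
        (key (facetNormal p L k) ≤ key u ∨ key u < key (facetNormal p L (k + 1))))
    {t : Fin n} (ht : t ∈ C) : Dominates u (p t - vertex p L (k + 1)) := by
  have h0 := h.facetNormal_ne_zero hL k
  have h1 := h.facetNormal_ne_zero hL (k + 1)
  by_cases h3 : 3 ≤ L.length
  · have hc := h.cross_facetNormal h3 k
    have hb := cross_of_key_between h0 h1 hu hc hk
    exact dominates_of_cone hu hc hb.1 hb.2 (h.dot_facetNormal_succ (by omega) k ht)
      (h.dot_facetNormal (by omega) (k + 1) ht)
  -- The hull is a segment, and every point of `C` is its vertex `k + 1` plus a non-negative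
  -- multiple of the edge back to the vertex `k`.
  · have h2 : L.length = 2 := by omega
    have hv : vertex p L (k + 1 + 1) = vertex p L k := by
      have := vertex_add_length (p := p) (L := L) k
      rwa [h2] at this
    have hset : (convexHull ℝ (p '' (C : Set (Fin n)))).extremePoints ℝ =
        {vertex p L k, vertex p L (k + 1)} := by
      rw [← h.vertices]
      obtain ⟨a, b, rfl⟩ := List.length_eq_two.1 h2
      have v0 : ∀ k, k % 2 = 0 → vertex p [a, b] k = p a := fun k hk => by simp [vertex, hk]
      have v1 : ∀ k, k % 2 = 1 → vertex p [a, b] k = p b := fun k hk => by simp [vertex, hk]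
      rcases Nat.mod_two_eq_zero_or_one k with e | e
      · rw [v0 k e, v1 (k + 1) (by omega)]; ext x; simp
      · rw [v1 k e, v0 (k + 1) (by omega)]; ext x; simp [or_comm]
    have hhull := convexHull_extremePoints (C.finite_toSet.image p)
    rw [hset, convexHull_pair] at hhull
    have hmem : p t ∈ convexHull ℝ (p '' (C : Set (Fin n))) :=
      subset_convexHull ℝ _ ⟨t, ht, rfl⟩
    rw [← hhull] at hmem
    obtain ⟨x, y, hx, hy, hxy, e⟩ := hmem
    have hopp : facetNormal p L (k + 1) = -facetNormal p L k := by
      rw [facetNormal, facetNormal, hv]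
      simp only [edgeNormal, Prod.neg_mk, neg_sub]
    have hb := cross_of_key_between_opposite h0 h1 hu
      (by rw [hopp]; simp only [cross, Prod.fst_neg, Prod.snd_neg]; ring)
      (by
        have := dot_self_pos h0
        rw [hopp]
        simp only [dot, Prod.fst_neg, Prod.snd_neg] at this ⊢
        linarith) hk
    have hd : p t - vertex p L (k + 1) = x • (vertex p L k - vertex p L (k + 1)) := by
      rw [← e, show y = 1 - x by linarith]
      ext <;> simp only [Prod.fst_add, Prod.snd_add, Prod.smul_fst, Prod.smul_snd, Prod.fst_sub,
        Prod.snd_sub, smul_eq_mul] <;> ring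
    have e1 : dot u (p t - vertex p L (k + 1)) = x * cross (facetNormal p L k) u := by
      rw [hd]
      simp only [dot, cross, facetNormal, edgeNormal, Prod.fst_sub, Prod.snd_sub, Prod.smul_fst,
        Prod.smul_snd, smul_eq_mul]
      ring
    have e2 : cross u (p t - vertex p L (k + 1)) = x * dot (facetNormal p L k) u := by
      rw [hd]
      simp only [dot, cross, facetNormal, edgeNormal, Prod.fst_sub, Prod.snd_sub, Prod.smul_fst,
        Prod.smul_snd, smul_eq_mul]
      ring
    rw [Dominates, e1, e2]
    rcases hx.eq_or_lt with h5 | h5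
    · rw [← h5]; simp
    · rcases hb with hb | ⟨hb, hb'⟩
      · exact Or.inl (mul_neg_of_pos_of_neg h5 hb)
      · exact Or.inr ⟨by rw [hb, mul_zero], (mul_pos h5 hb').le⟩

/-- The vertex after the facets that come, in clockwise order, not after `u` is extreme in the
direction `u`. -/
theorem vertex_dominates (h : IsHullList p C L) (hL : 2 ≤ L.length) {u : Pt} (hu : u ≠ 0) {c : ℕ}
    (hc : c ≤ L.length) (hc' : ∀ k < L.length, k < c ↔ key (facetNormal p L k) ≤ key u)
    {t : Fin n} (ht : t ∈ C) : Dominates u (p t - vertex p L c) := by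
  have hlast : vertex p L (L.length - 1 + 1) = vertex p L 0 := by
    have := vertex_add_length (p := p) (L := L) 0
    rwa [zero_add, show L.length = L.length - 1 + 1 by omega] at this
  have hlast' : facetNormal p L (L.length - 1 + 1) = facetNormal p L 0 := by
    have := facetNormal_add_length (p := p) (L := L) 0
    rw [zero_add] at this
    rwa [show L.length - 1 + 1 = L.length by omega]
  have hlt := h.key_facetNormal_lt (k := 0) (l := L.length - 1) (by omega) (by omega)
  -- With `c = 0` the direction precedes all facets, so cyclically it follows the last one; the
  -- vertex `0` is then read as the end of the last facet. The same facet serves for `c = L.length`.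
  rcases Nat.eq_zero_or_pos c with h0 | h0
  · subst h0
    rw [← hlast]
    refine h.vertex_dominates_of_cone hL hu _ (Or.inr ⟨by rwa [hlast'], Or.inr ?_⟩) ht
    rw [hlast']
    by_contra! h1
    exact absurd ((hc' 0 (by omega)).2 h1) (by omega)
  · rcases hc.eq_or_lt with h1 | h1
    · have : vertex p L c = vertex p L (L.length - 1 + 1) := by rw [h1]; congr 1; omega
      rw [this]
      exact h.vertex_dominates_of_cone hL hu _
        (Or.inr ⟨by rwa [hlast'], Or.inl ((hc' _ (by omega)).1 (by omega))⟩) ht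
    · obtain ⟨k, rfl⟩ : ∃ k, c = k + 1 := ⟨c - 1, by omega⟩
      refine h.vertex_dominates_of_cone hL hu k (Or.inl ⟨(hc' _ (by omega)).1 (by omega), ?_⟩) ht
      by_contra! h2
      exact absurd ((hc' _ h1).2 h2) (by omega)

theorem eq_vertex_of_length_one (h : IsHullList p C L) (hL : L.length = 1) {t : Fin n}
    (ht : t ∈ C) : p t = vertex p L 0 := by
  have hset : (convexHull ℝ (p '' (C : Set (Fin n)))).extremePoints ℝ = {vertex p L 0} := by
    rw [← h.vertices]
    obtain ⟨a, rfl⟩ := List.length_eq_one_iff.1 hL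
    ext x; simp [vertex]
  have hhull := convexHull_extremePoints (C.finite_toSet.image p)
  rw [hset, convexHull_singleton] at hhull
  have hmem : p t ∈ convexHull ℝ (p '' (C : Set (Fin n))) := subset_convexHull ℝ _ ⟨t, ht, rfl⟩
  rwa [← hhull] at hmem

end IsHullList

end WindowedHull

namespace WindowedHull

/-! ## The stabbed facet -/

theorem le_of_mem_convexHull {S : Set Pt} {α β γ : ℝ} (h : ∀ x ∈ S, α * x.1 + β * x.2 ≤ γ)
    {x : Pt} (hx : x ∈ convexHull ℝ S) : α * x.1 + β * x.2 ≤ γ := by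
  have hc : Convex ℝ {x : Pt | α * x.1 + β * x.2 ≤ γ} := by
    intro x hx y hy a b ha hb hab
    simp only [Set.mem_ofPred_eq, Prod.fst_add, Prod.snd_add, Prod.smul_fst, Prod.smul_snd,
      smul_eq_mul] at hx hy ⊢
    calc α * (a * x.1 + b * y.1) + β * (a * x.2 + b * y.2)
        = a * (α * x.1 + β * x.2) + b * (α * y.1 + β * y.2) := by ring
      _ ≤ a * γ + b * γ :=
        add_le_add (mul_le_mul_of_nonneg_left hx ha) (mul_le_mul_of_nonneg_left hy hb)
      _ = γ := by rw [← add_mul, hab, one_mul]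
  exact convexHull_min h hc hx

/-- How far a point lies to the left of the directed line `(o, q)`. -/
def side (o q x : Pt) : ℝ := cross q (x - o)

theorem side_le_of_mem_convexHull {S : Set Pt} {o q : Pt} {γ : ℝ} (h : ∀ x ∈ S, side o q x ≤ γ)
    {x : Pt} (hx : x ∈ convexHull ℝ S) : side o q x ≤ γ := by
  have := le_of_mem_convexHull (α := -q.2) (β := q.1) (γ := γ + (q.1 * o.2 - q.2 * o.1))
    (fun y hy => by
      have := h y hy
      simp only [side, cross, Prod.fst_sub, Prod.snd_sub] at this
      linarith) hx
  simp only [side, cross, Prod.fst_sub, Prod.snd_sub]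
  linarith

theorem le_side_of_mem_convexHull {S : Set Pt} {o q : Pt} {γ : ℝ} (h : ∀ x ∈ S, γ ≤ side o q x)
    {x : Pt} (hx : x ∈ convexHull ℝ S) : γ ≤ side o q x := by
  have := le_of_mem_convexHull (α := q.2) (β := -q.1) (γ := -γ - (q.1 * o.2 - q.2 * o.1))
    (fun y hy => by
      have := h y hy
      simp only [side, cross, Prod.fst_sub, Prod.snd_sub] at this
      linarith) hx
  simp only [side, cross, Prod.fst_sub, Prod.snd_sub]
  linarith

theorem dot_le_of_mem_convexHull {S : Set Pt} {q : Pt} {γ : ℝ} (h : ∀ x ∈ S, dot q x ≤ γ)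
    {x : Pt} (hx : x ∈ convexHull ℝ S) : dot q x ≤ γ := le_of_mem_convexHull h hx

theorem side_add_smul (o q : Pt) (t : ℝ) : side o q (o + t • q) = 0 := by
  simp only [side, cross, Prod.fst_sub, Prod.snd_sub, Prod.fst_add, Prod.snd_add, Prod.smul_fst,
    Prod.smul_snd, smul_eq_mul]
  ring

theorem exists_eq_add_smul_of_side_eq_zero {o q x : Pt} (hq : q ≠ 0) (h : side o q x = 0) :
    ∃ t : ℝ, o + t • q = x := by
  have hqq := (dot_self_pos hq).ne'
  refine ⟨dot q (x - o) / dot q q, ?_⟩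
  simp only [side, cross, dot, Prod.fst_sub, Prod.snd_sub] at h hqq ⊢
  ext
  · simp only [Prod.fst_add, Prod.smul_fst, smul_eq_mul]
    rw [div_mul_eq_mul_div, ← eq_sub_iff_add_eq', div_eq_iff hqq]
    linear_combination q.2 * h
  · simp only [Prod.snd_add, Prod.smul_snd, smul_eq_mul]
    rw [div_mul_eq_mul_div, ← eq_sub_iff_add_eq', div_eq_iff hqq]
    linear_combination -q.1 * h

/-- The points that count as lying to the left of the line: if no point of `S` lies strictly to
the left, those on the line do, and otherwise they do not. -/
def LeftSide (S : Set Pt) (o q x : Pt) : Prop :=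
  0 < side o q x ∨ side o q x = 0 ∧ ∀ y ∈ S, side o q y ≤ 0

theorem dot_edgeNormal_eq_side_sub (o q a b : Pt) :
    dot (edgeNormal a b) q = side o q a - side o q b := by
  simp only [dot, edgeNormal, side, cross, Prod.fst_sub, Prod.snd_sub]; ring

/-- Among finitely many points on both sides of a line, two on different sides whose segment
crosses the line furthest in its direction span a supporting line. -/
theorem exists_crossing_facet {E : Set Pt} (hE : E.Finite) {o q : Pt} (hq : q ≠ 0) {τ : ℝ}
    (hτ : ∀ x ∈ E, side o q x ≠ τ) (h₁ : ∃ x ∈ E, τ < side o q x) (h₂ : ∃ x ∈ E, side o q x < τ) :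
    ∃ a ∈ E, ∃ b ∈ E, τ < side o q a ∧ side o q b < τ ∧ ∀ x ∈ E, cross (b - a) (x - a) ≤ 0 := by
  obtain ⟨a₀, ha₀, ha₀'⟩ := h₁
  obtain ⟨b₀, hb₀, hb₀'⟩ := h₂
  let F : Pt → ℝ := fun x => side o q x - τ
  -- The coordinate along `q` at which the segment from the left point to the right point meets the
  -- line of side `τ`.
  let H : Pt × Pt → ℝ := fun z =>
    (dot q z.1 * (-F z.2) + dot q z.2 * F z.1) / (F z.1 - F z.2)
  let P : Set (Pt × Pt) := {z | (z.1 ∈ E ∧ z.2 ∈ E) ∧ 0 < F z.1 ∧ F z.2 < 0}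
  have hP : P.Finite := (hE.prod hE).subset fun z hz => hz.1
  obtain ⟨⟨a, b⟩, ⟨⟨ha, hb⟩, hFa, hFb⟩, hmax⟩ := Set.exists_max_image P H hP
    ⟨(a₀, b₀), ⟨ha₀, hb₀⟩, sub_pos.2 ha₀', sub_neg.2 hb₀'⟩
  simp only at ha hb hFa hFb
  refine ⟨a, ha, b, hb, sub_pos.1 hFa, sub_neg.1 hFb, fun x hx => ?_⟩
  by_contra! hpos
  -- Written in the coordinates along and across `q`, this says that `x` lies beyond the line
  -- through `a` and `b`. Exchanging `b` or `a` for `x`, according to the side of `x`, then moves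
  -- the crossing further along `q`, against maximality.
  have hK : 0 < (dot q b - dot q a) * (F x - F a) - (F b - F a) * (dot q x - dot q a) := by
    have := mul_pos (dot_self_pos hq) hpos
    have e : dot q q * cross (b - a) (x - a) =
        (dot q b - dot q a) * (F x - F a) - (F b - F a) * (dot q x - dot q a) := by
      simp only [F, side, dot, cross, Prod.fst_sub, Prod.snd_sub]; ring
    rwa [e] at this
  rcases lt_or_gt_of_ne (sub_ne_zero.2 (hτ x hx)) with h | h
  · have := hmax (a, x) ⟨⟨ha, hx⟩, hFa, h⟩
    simp only [H] at this
    change F x < 0 at h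
    rw [div_le_div_iff₀ (by linarith) (by linarith)] at this
    have := mul_pos hFa hK
    linarith
  · have := hmax (x, b) ⟨⟨hx, hb⟩, h, hFb⟩
    simp only [H] at this
    change 0 < F x at h
    rw [div_le_div_iff₀ (by linarith) (by linarith)] at this
    have := mul_pos (neg_pos.2 hFb) hK
    linarith

theorem exists_gap {S : Set Pt} (hS : S.Finite) (o q : Pt) :
    ∃ ε : ℝ, 0 < ε ∧ ∀ x ∈ S, side o q x ≠ 0 → ε < |side o q x| := by
  have h : ∀ᶠ ε in nhdsWithin (0 : ℝ) (Set.Ioi 0), ∀ x ∈ S, side o q x ≠ 0 → ε < |side o q x| := by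
    refine (Filter.eventually_all_finite hS).2 fun x _ => ?_
    by_cases hx : side o q x = 0
    · exact Filter.Eventually.of_forall fun _ h => absurd hx h
    · filter_upwards [nhdsWithin_le_nhds (Iio_mem_nhds (abs_pos.2 hx))] with ε hε _ using hε
  obtain ⟨ε, h1, h2⟩ := (h.and self_mem_nhdsWithin).exists
  exact ⟨ε, h2, h1⟩

/-- `LeftSide` is the strict left side of a parallel line that misses all points. It is shifted by
less than the gap to the nearest point off the line: to the right if nothing lies strictly to the
left, and to the left otherwise. -/
theorem exists_leftSide_iff {S : Set Pt} (hS : S.Finite) (o q : Pt) :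
    ∃ τ : ℝ, ∀ x ∈ S, (LeftSide S o q x → τ < side o q x) ∧
      (¬ LeftSide S o q x → side o q x < τ) := by
  obtain ⟨ε, hε, h⟩ := exists_gap hS o q
  by_cases hflag : ∀ y ∈ S, side o q y ≤ 0
  · refine ⟨-ε, fun x hx => ⟨?_, fun hl => ?_⟩⟩
    · rintro (h1 | h1) <;> linarith [h1]
    · have h2 : side o q x ≠ 0 := fun h2 => hl (Or.inr ⟨h2, hflag⟩)
      have h3 := h x hx h2
      rw [abs_of_nonpos (hflag x hx)] at h3
      linarith
  · refine ⟨ε, fun x hx => ⟨?_, fun hl => ?_⟩⟩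
    · rintro (h1 | h1)
      · have h3 := h x hx h1.ne'
        rwa [abs_of_pos h1] at h3
      · exact absurd h1.2 hflag
    · by_contra! h1
      exact hl (Or.inl (by linarith))

/-- The furthest point is where the segment meets the line: the supporting line of the facet bounds
the hull, and its outward normal has a positive inner product with `q`. Points on the unshifted line
are allowed as ends, so facets found for the shifted line qualify. -/
theorem isStabbedFacet_of_cross {S : Set Pt} {o q a b : Pt} (hq : q ≠ 0) (h : IsFacet S a b)
    (ha : 0 ≤ side o q a) (hb : side o q b ≤ 0) (hab : side o q b < side o q a) :
    IsStabbedFacet S o q a b := by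
  have hN := dot_edgeNormal_eq_side_sub o q a b
  have hd : 0 < side o q a - side o q b := sub_pos.2 hab
  refine ⟨h, ?_, by linarith⟩
  set s := side o q a / (side o q a - side o q b) with hs
  have hs0 : 0 ≤ s := div_nonneg ha hd.le
  have hs1 : s ≤ 1 := (div_le_one hd).2 (by linarith)
  have hz : side o q ((1 - s) • a + s • b) = 0 := by
    have e : side o q ((1 - s) • a + s • b) =
        side o q a - s * (side o q a - side o q b) := by
      simp only [side, cross, Prod.fst_sub, Prod.snd_sub, Prod.fst_add, Prod.snd_add,
        Prod.smul_fst, Prod.smul_snd, smul_eq_mul]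
      ring
    rw [e, hs, div_mul_cancel₀ _ hd.ne', sub_self]
  obtain ⟨t, ht⟩ := exists_eq_add_smul_of_side_eq_zero hq hz
  refine ⟨t, ⟨1 - s, s, by linarith, hs0, by ring, ht.symm⟩, fun r hr => ?_⟩
  have h1 : dot (edgeNormal a b) (o + r • q) ≤ dot (edgeNormal a b) a :=
    dot_le_of_mem_convexHull (fun x hx => by
      have := h.2.2.2 x hx
      rw [← dot_edgeNormal] at this
      simp only [dot, Prod.fst_sub, Prod.snd_sub] at this ⊢
      linarith) hr
  have h2 : dot (edgeNormal a b) (o + t • q) = dot (edgeNormal a b) a := by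
    rw [ht]
    simp only [dot, edgeNormal, Prod.fst_add, Prod.snd_add, Prod.smul_fst, Prod.smul_snd,
      smul_eq_mul]
    ring
  have h3 : ∀ r : ℝ, dot (edgeNormal a b) (o + r • q) =
      dot (edgeNormal a b) o + r * dot (edgeNormal a b) q := fun r => by
    simp only [dot, Prod.fst_add, Prod.snd_add, Prod.smul_fst, Prod.smul_snd, smul_eq_mul]
    ring
  rw [h3] at h1 h2
  have h4 : r * dot (edgeNormal a b) q ≤ t * dot (edgeNormal a b) q := by linarith
  exact le_of_mul_le_mul_right h4 (by linarith)

/-- Compare `e` with the ends of the facet. For an end `x`, the facet bounds `e` and `e` is extreme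
in the direction `u`, so the identity `key` makes `cross u N` and `side x - side e` agree in sign.
Thus `e` is at least as far left as `a` if `u` comes before the normal, and at least as far right as
`b` otherwise. -/
theorem leftSide_iff_of_crossing {S : Set Pt} {o q a b u e : Pt} (hf : IsFacet S a b)
    (haS : a ∈ S) (hbS : b ∈ S)
    (ha : LeftSide S o q a) (hb : ¬ LeftSide S o q b) (hab : side o q b < side o q a)
    (hu : 0 < dot u q) (he : e ∈ S) (hdom : ∀ x ∈ S, Dominates u (x - e)) :
    LeftSide S o q e ↔ cross u (edgeNormal a b) < 0 := by
  have hmono : ∀ x y : Pt, side o q x ≤ side o q y → LeftSide S o q x → LeftSide S o q y := by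
    rintro x y hxy (h | ⟨h, h'⟩)
    · exact Or.inl (by linarith)
    · rcases (h.symm.le.trans hxy).eq_or_lt with h2 | h2
      · exact Or.inr ⟨h2.symm, h'⟩
      · exact Or.inl h2
  have hN := dot_edgeNormal_eq_side_sub o q a b
  have hfe := hf.2.2.2 e he
  rw [← dot_edgeNormal] at hfe
  have key : ∀ d : Pt, cross u (edgeNormal a b) * cross q d =
      dot u q * dot (edgeNormal a b) d - dot (edgeNormal a b) q * dot u d := fun d => by
    simp only [dot, cross]; ring
  have hd : ∀ x ∈ S, dot u (x - e) ≤ 0 := fun x hx => by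
    rcases hdom x hx with h | h <;> linarith [h]
  have hside : ∀ x : Pt, cross q (x - e) = side o q x - side o q e := fun x => by
    simp only [side, cross, Prod.fst_sub, Prod.snd_sub]; ring
  have hNe : ∀ x : Pt, x = a ∨ x = b → 0 ≤ dot (edgeNormal a b) (x - e) := by
    rintro x (rfl | rfl)
    · simp only [dot, edgeNormal, Prod.fst_sub, Prod.snd_sub] at hfe ⊢; linarith
    · simp only [dot, edgeNormal, Prod.fst_sub, Prod.snd_sub] at hfe ⊢; linarith
  have hprod : ∀ x ∈ S, x = a ∨ x = b →
      0 ≤ cross u (edgeNormal a b) * (side o q x - side o q e) := fun x hx hx' => by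
    rw [← hside, key]
    have h1 := mul_nonneg hu.le (hNe x hx')
    have h2 := mul_nonpos_of_nonneg_of_nonpos (a := dot (edgeNormal a b) q) (by linarith) (hd x hx)
    linarith
  constructor
  · intro hl
    by_contra! hc
    refine hb (hmono e b ?_ hl)
    -- If `u` has the direction of the normal, `b` is extreme for `u` too; then the clockwise
    -- tie-break in `Dominates` puts `e` not to the left of `b`.
    rcases hc.eq_or_lt with h0 | h0
    · have h1 := key (b - e)
      rw [← h0, zero_mul] at h1
      have h2 := mul_nonneg hu.le (hNe b (Or.inr rfl))
      have hNq : 0 < dot (edgeNormal a b) q := by linarith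
      have h3 : dot u (b - e) = 0 := by
        refine le_antisymm (hd b hbS) ?_
        by_contra! h3
        have := mul_neg_of_pos_of_neg hNq h3
        linarith
      have h4 : 0 ≤ cross u (b - e) := by
        rcases hdom b hbS with h | h
        · linarith
        · exact h.2
      have h5 : dot u u * cross q (b - e) = dot u q * cross u (b - e) - cross u q * dot u (b - e) := by
        simp only [dot, cross]; ring
      rw [h3, mul_zero, sub_zero, hside] at h5
      have h6 := mul_nonneg hu.le h4
      have hu0 : u ≠ 0 := by rintro rfl; simp [dot] at hu
      have h7 := dot_self_pos hu0
      by_contra! h8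
      have := mul_neg_of_pos_of_neg h7 (sub_neg.2 h8)
      linarith
    · have h1 := hprod b hbS (Or.inr rfl)
      by_contra! h2
      have := mul_neg_of_pos_of_neg h0 (sub_neg.2 h2)
      linarith
  · intro hc
    refine hmono a e ?_ ha
    have h1 := hprod a haS (Or.inl rfl)
    by_contra! h2
    have := mul_neg_of_neg_of_pos hc (sub_pos.2 h2)
    linarith

/-- The hull is a segment along the line, and both of its facets contain the point `t` at which the
line leaves. The facet from `t` back to `s` has `q` turned clockwise as its normal, so it comes
after all directions that face `q`. This fits the convention that all points count as left. -/
theorem exists_isStabbedFacet_of_collinear {S : Set Pt} (hS : S.Finite) {o q : Pt} (hq : q ≠ 0)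
    (hne : ∃ x ∈ S, ∃ y ∈ S, x ≠ y) (h0 : ∀ x ∈ S, side o q x = 0) :
    ∃ a b, IsStabbedFacet S o q a b ∧ dot (edgeNormal a b) q = 0 ∧
      cross q (edgeNormal a b) < 0 ∧ ∀ u, 0 < dot u q → cross u (edgeNormal a b) < 0 := by
  have hsub : (convexHull ℝ S).extremePoints ℝ ⊆ S := extremePoints_convexHull_subset
  have hEh := convexHull_extremePoints hS
  set E := (convexHull ℝ S).extremePoints ℝ with hEdef
  have hE : E.Finite := hS.subset hsub
  have hSE : S ⊆ convexHull ℝ E := fun x hx => hEh ▸ subset_convexHull ℝ S hx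
  obtain ⟨x, hx, y, hy, hxy⟩ := hne
  have hEne : E.Nonempty := by
    by_contra h
    have := hSE hx
    rw [Set.not_nonempty_iff_eq_empty.1 h, convexHull_empty] at this
    exact this
  obtain ⟨t, ht, htmax⟩ := Set.exists_max_image E (dot q) hE hEne
  obtain ⟨s, hs, hsmin⟩ := Set.exists_min_image E (dot q) hE hEne
  have heq : ∀ v w : Pt, dot q v = dot q w → side o q v = 0 → side o q w = 0 → v = w := by
    intro v w h1 h2 h3
    have hqq := dot_self_pos hq
    obtain ⟨r, rfl⟩ := exists_eq_add_smul_of_side_eq_zero hq h2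
    obtain ⟨r', rfl⟩ := exists_eq_add_smul_of_side_eq_zero hq h3
    have e : ∀ r : ℝ, dot q (o + r • q) = dot q o + r * dot q q := fun r => by
      simp only [dot, Prod.fst_add, Prod.snd_add, Prod.smul_fst, Prod.smul_snd, smul_eq_mul]
      ring
    rw [e, e] at h1
    rw [mul_right_cancel₀ hqq.ne' (by linarith : r * dot q q = r' * dot q q)]
  have hlt : dot q s < dot q t := by
    refine lt_of_le_of_ne (hsmin t ht) fun h => ?_
    have hall : E ⊆ {t} := fun v hv =>
      heq v t (le_antisymm (htmax v hv) (h ▸ hsmin v hv)) (h0 v (hsub hv)) (h0 t (hsub ht))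
    have hall' : S ⊆ {t} := by
      have := hSE.trans (convexHull_mono hall)
      rwa [convexHull_singleton] at this
    exact hxy ((hall' hx).trans (hall' hy).symm)
  have hst : t ≠ s := fun e => by rw [e] at hlt; exact lt_irrefl _ hlt
  have hNq : dot (edgeNormal t s) q = 0 := by
    rw [dot_edgeNormal_eq_side_sub o, h0 t (hsub ht), h0 s (hsub hs), sub_self]
  have hcq : ∀ u, dot q q * cross u (edgeNormal t s) = dot u q * (dot q s - dot q t) := fun u => by
    have e : dot q q * cross u (edgeNormal t s) =
        dot u q * (dot q s - dot q t) - cross q u * dot (edgeNormal t s) q := by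
      simp only [dot, cross, edgeNormal]; ring
    rw [e, hNq, mul_zero, sub_zero]
  have hqq := dot_self_pos hq
  have hcross : ∀ u, 0 < dot u q → cross u (edgeNormal t s) < 0 := fun u hu => by
    by_contra! h
    have h1 := mul_nonneg hqq.le h
    rw [hcq] at h1
    have := mul_neg_of_pos_of_neg hu (sub_neg.2 hlt)
    linarith
  refine ⟨t, s, ⟨⟨ht, hs, hst, fun x hx => ?_⟩, ?_, hNq.ge⟩, hNq, hcross q hqq, hcross⟩
  · refine le_of_eq ?_
    have h1 : dot q q * cross (s - t) (x - t) =
        dot q (s - t) * (side o q x - side o q t) -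
          (side o q s - side o q t) * dot q (x - t) := by
      simp only [dot, cross, side, Prod.fst_sub, Prod.snd_sub]; ring
    rw [h0 x hx, h0 t (hsub ht), h0 s (hsub hs)] at h1
    simp only [sub_self, mul_zero, zero_mul] at h1
    exact (mul_eq_zero.1 h1).resolve_left hqq.ne'
  · obtain ⟨r, hr⟩ := exists_eq_add_smul_of_side_eq_zero hq (h0 t (hsub ht))
    refine ⟨r, hr ▸ left_mem_segment ℝ t s, fun r' hr' => ?_⟩
    rw [← hEh] at hr'
    have h1 := dot_le_of_mem_convexHull htmax hr'
    have e : ∀ r : ℝ, dot q (o + r • q) = dot q o + r * dot q q := fun r => by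
      simp only [dot, Prod.fst_add, Prod.snd_add, Prod.smul_fst, Prod.smul_snd, smul_eq_mul]
      ring
    rw [← hr, e, e] at h1
    exact le_of_mul_le_mul_right (by linarith) hqq

/-- A stabbed facet, and a test for being before its normal in clockwise order. -/
theorem exists_isStabbedFacet {S : Set Pt} (hS : S.Finite) {o q : Pt} (hq : q ≠ 0)
    (hne : ∃ x ∈ S, ∃ y ∈ S, x ≠ y) (hline : (line o q ∩ convexHull ℝ S).Nonempty) :
    ∃ a b, IsStabbedFacet S o q a b ∧
      (0 < dot (edgeNormal a b) q ∨
        dot (edgeNormal a b) q = 0 ∧ cross q (edgeNormal a b) < 0) ∧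
      ∀ u, 0 < dot u q → ∀ e ∈ S, (∀ x ∈ S, Dominates u (x - e)) →
        (LeftSide S o q e ↔ cross u (edgeNormal a b) < 0) := by
  obtain ⟨z, ⟨t, rfl⟩, hz⟩ := hline
  have hz0 := side_add_smul o q t
  obtain ⟨τ, hτ⟩ := exists_leftSide_iff hS o q
  by_cases hall : ∀ x ∈ S, LeftSide S o q x
  -- If all points count as left, none is strictly left, since otherwise all would be and the hull
  -- would miss the line; so all of them lie on the line.
  · have hflag : ∀ y ∈ S, side o q y ≤ 0 := by
      by_contra hflag
      have hpos : ∀ x ∈ S, 0 < side o q x := fun x hx =>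
        (hall x hx).resolve_right fun h => hflag h.2
      obtain ⟨ε, hε, hgap⟩ := exists_gap hS o q
      have := le_side_of_mem_convexHull (γ := ε) (fun x hx => by
        have := hgap x hx (hpos x hx).ne'
        rw [abs_of_pos (hpos x hx)] at this
        exact this.le) hz
      linarith
    have h0 : ∀ x ∈ S, side o q x = 0 := fun x hx => by
      rcases hall x hx with h | h
      · linarith [hflag x hx]
      · exact h.1
    obtain ⟨a, b, h1, h2, h3, h4⟩ := exists_isStabbedFacet_of_collinear hS hq hne h0
    exact ⟨a, b, h1, Or.inr ⟨h2, h3⟩, fun u hu e he _ => iff_of_true (hall e he) (h4 u hu)⟩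
  · push Not at hall
    obtain ⟨y, hy, hy'⟩ := hall
    -- The line meets the hull, so the points cannot all lie strictly to its right.
    have hleft : ∃ x ∈ S, LeftSide S o q x := by
      by_cases hflag : ∀ y ∈ S, side o q y ≤ 0
      · by_contra! hno
        obtain ⟨ε, hε, hgap⟩ := exists_gap hS o q
        have := side_le_of_mem_convexHull (γ := -ε) (fun x hx => by
          have h1 : side o q x ≠ 0 := fun h => hno x hx (Or.inr ⟨h, hflag⟩)
          have := hgap x hx h1
          rw [abs_of_nonpos (hflag x hx)] at this
          linarith) hz
        linarith
      · push Not at hflag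
        obtain ⟨x, hx, hx'⟩ := hflag
        exact ⟨x, hx, Or.inl hx'⟩
    obtain ⟨x, hx, hx'⟩ := hleft
    have hsub : (convexHull ℝ S).extremePoints ℝ ⊆ S := extremePoints_convexHull_subset
    have hEh := convexHull_extremePoints hS
    set E := (convexHull ℝ S).extremePoints ℝ with hEdef
    have hE : E.Finite := hS.subset hsub
    have hSE : S ⊆ convexHull ℝ E := fun x hx => hEh ▸ subset_convexHull ℝ S hx
    have hτne : ∀ x ∈ S, side o q x ≠ τ := fun x hx => by
      by_cases h : LeftSide S o q x
      · exact ((hτ x hx).1 h).ne'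
      · exact ((hτ x hx).2 h).ne
    have h₁ : ∃ x ∈ E, τ < side o q x := by
      by_contra! h
      linarith [side_le_of_mem_convexHull h (hSE hx), (hτ x hx).1 hx']
    have h₂ : ∃ x ∈ E, side o q x < τ := by
      by_contra! h
      linarith [le_side_of_mem_convexHull h (hSE hy), (hτ y hy).2 hy']
    obtain ⟨a, ha, b, hb, haτ, hbτ, hsupp⟩ :=
      exists_crossing_facet hE hq (fun x hx => hτne x (hsub hx)) h₁ h₂
    have hab : side o q b < side o q a := hbτ.trans haτ
    have hla : LeftSide S o q a := by
      by_contra h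
      linarith [(hτ a (hsub ha)).2 h]
    have hlb : ¬ LeftSide S o q b := fun h => by linarith [(hτ b (hsub hb)).1 h]
    have hfacet : IsFacet S a b := by
      refine ⟨ha, hb, fun e => by rw [e] at hab; exact lt_irrefl _ hab, fun x hx => ?_⟩
      have := dot_le_of_mem_convexHull (q := edgeNormal a b) (γ := dot (edgeNormal a b) a)
        (fun x hx => by
          have := hsupp x hx
          rw [← dot_edgeNormal] at this
          simp only [dot, Prod.fst_sub, Prod.snd_sub] at this ⊢
          linarith) (hSE hx)
      rw [← dot_edgeNormal]
      simp only [dot, Prod.fst_sub, Prod.snd_sub] at this ⊢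
      linarith
    have ha0 : 0 ≤ side o q a := by rcases hla with h | h <;> linarith [h]
    have hb0 : side o q b ≤ 0 := not_lt.1 fun h => hlb (Or.inl h)
    refine ⟨a, b, isStabbedFacet_of_cross hq hfacet ha0 hb0 hab, Or.inl ?_,
      fun u hu e he hdom =>
        leftSide_iff_of_crossing hfacet (hsub ha) (hsub hb) hla hlb hab hu he hdom⟩
    rw [dot_edgeNormal_eq_side_sub o]
    exact sub_pos.2 hab

end WindowedHull

namespace WindowedHull

/-! ## Ranks in sorted lists and cascading -/

section Rank

variable {α : Type*} (κ : α → ℝ)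

open Classical in
/-- The number of elements of `l` whose key satisfies `pr`. -/
noncomputable def rank (pr : ℝ → Prop) (l : List α) : ℕ := l.countP fun a => pr (κ a)

/-- The elements at the positions `1, 3, 5, …`. -/
def oddPositions : List α → List α
  | [] => []
  | [_] => []
  | _ :: b :: l => b :: oddPositions l

theorem length_oddPositions : ∀ l : List α, (oddPositions l).length = l.length / 2
  | [] => by simp [oddPositions]
  | [_] => by simp [oddPositions]
  | _ :: b :: l => by
    rw [oddPositions, List.length_cons, length_oddPositions l, List.length_cons, List.length_cons]
    omega

theorem getElem_mem_oddPositions : ∀ (l : List α) (i : ℕ) (hi : i < l.length), i % 2 = 1 →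
    l[i] ∈ oddPositions l
  | [], i, hi, _ => absurd hi (by simp)
  | [_], i, hi, h => by
    simp only [List.length_cons, List.length_nil] at hi
    omega
  | a :: b :: l, i, hi, h => by
    rw [oddPositions]
    obtain rfl | ⟨j, rfl⟩ : i = 1 ∨ ∃ j, i = j + 2 := by
      rcases i with _ | _ | j
      · omega
      · exact Or.inl rfl
      · exact Or.inr ⟨j, rfl⟩
    · simp
    · simp only [List.getElem_cons_succ]
      exact List.mem_cons_of_mem _ (getElem_mem_oddPositions l j _ (by omega))

/-- A property of keys that holds up to some point. -/
def DownClosed (pr : ℝ → Prop) : Prop := ∀ s t, s ≤ t → pr t → pr s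

variable {κ}

theorem rank_le_length (pr : ℝ → Prop) (l : List α) : rank κ pr l ≤ l.length :=
  List.countP_le_length

theorem lt_rank_iff {pr : ℝ → Prop} (hpr : DownClosed pr) {l : List α}
    (hl : l.Pairwise fun a b => κ a ≤ κ b) {i : ℕ} (hi : i < l.length) :
    i < rank κ pr l ↔ pr (κ l[i]) := by
  classical
  induction l generalizing i with
  | nil => exact absurd hi (by simp)
  | cons a l ih =>
    rw [List.pairwise_cons] at hl
    rw [rank, List.countP_cons]
    by_cases ha : pr (κ a)
    · simp only [ha, decide_true, if_true]
      rcases i with _ | i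
      · simpa using ha
      · have := ih hl.2 (i := i) (by simpa using hi)
        rw [rank] at this
        simp only [List.getElem_cons_succ]
        rw [← this]
        simp
    · have h0 : l.countP (fun b => decide (pr (κ b))) = 0 := by
        rw [List.countP_eq_zero]
        intro b hb
        simpa using fun h => ha (hpr _ _ (hl.1 b hb) h)
      simp only [h0, ha, decide_false]
      refine iff_of_false (by simp) fun h => ha ?_
      rcases i with _ | i
      · simpa using h
      · refine hpr _ _ (hl.1 (l[i]'(by simpa using hi)) (List.getElem_mem _)) ?_
        simpa using h

variable (κ)

/-- The elements of `l` with keys up to the one of the `c`-th element of `l'`. -/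
noncomputable def link (l' l : List α) (c : ℕ) : ℕ :=
  rank κ (fun t => ∃ e ∈ l'.take c, t ≤ κ e) l

variable {κ}

theorem mem_take_rank {pr : ℝ → Prop} (hpr : DownClosed pr) {l : List α}
    (hl : l.Pairwise fun a b => κ a ≤ κ b) {a : α} :
    a ∈ l.take (rank κ pr l) ↔ a ∈ l ∧ pr (κ a) := by
  rw [List.mem_take_iff_getElem]
  constructor
  · rintro ⟨i, hi, rfl⟩
    exact ⟨List.getElem_mem _, (lt_rank_iff hpr hl _).1 (by omega)⟩
  · rintro ⟨h, h'⟩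
    obtain ⟨i, hi, rfl⟩ := List.getElem_of_mem h
    have := (lt_rank_iff hpr hl hi).2 h'
    exact ⟨i, by omega, rfl⟩

/-- A link depends only on a position, not on the property searched for, so it can be stored in
advance. The first `rank` elements of `l'` are those with the property, and each such element of `l`
is among them. -/
theorem link_eq_rank {pr : ℝ → Prop} (hpr : DownClosed pr) {l' l : List α}
    (hl' : l'.Pairwise fun a b => κ a ≤ κ b) (h : ∀ a ∈ l, a ∈ l') :
    link κ l' l (rank κ pr l') = rank κ pr l := by
  classical
  refine List.countP_congr fun a ha => ?_
  simp only [mem_take_rank hpr hl', decide_eq_true_eq]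
  exact ⟨fun ⟨e, he, he'⟩ => hpr _ _ he' he.2, fun h' => ⟨a, ⟨h a ha, h'⟩, le_rfl⟩⟩

theorem link_le_rank {pr : ℝ → Prop} (hpr : DownClosed pr) {l' l : List α}
    (hl' : l'.Pairwise fun a b => κ a ≤ κ b) :
    link κ l' l (rank κ pr l') ≤ rank κ pr l := by
  classical
  refine List.countP_mono_left fun a _ h => ?_
  simp only [mem_take_rank hpr hl', decide_eq_true_eq] at h ⊢
  obtain ⟨e, he, he'⟩ := h
  exact hpr _ _ he' he.2

/-- Of two consecutive positions of `l` one is odd, so its element also occurs in `l'`. If the link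
missed two elements with the property, it would miss one that `l'` knows. -/
theorem rank_le_link_add_one {pr : ℝ → Prop} (hpr : DownClosed pr) {l' l : List α}
    (hl' : l'.Pairwise fun a b => κ a ≤ κ b) (hl : l.Pairwise fun a b => κ a ≤ κ b)
    (h : ∀ a ∈ oddPositions l, a ∈ l') :
    rank κ pr l ≤ link κ l' l (rank κ pr l') + 1 := by
  by_contra! hlt
  set r := link κ l' l (rank κ pr l') with hr
  have hlen := rank_le_length (κ := κ) pr l
  have key : ∀ i, r ≤ i → i < r + 2 → i % 2 = 1 → False := by
    intro i h1 h2 h3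
    have hi : i < l.length := by omega
    have h4 := (lt_rank_iff hpr hl hi).1 (by omega)
    have h5 := h _ (getElem_mem_oddPositions l i hi h3)
    have hd : DownClosed fun t => ∃ e ∈ l'.take (rank κ pr l'), t ≤ κ e :=
      fun s t hst ⟨e, he, he'⟩ => ⟨e, he, hst.trans he'⟩
    have h6 := (lt_rank_iff hd hl hi).2 ⟨l[i], (mem_take_rank hpr hl').2 ⟨h5, h4⟩, le_rfl⟩
    change i < r at h6
    omega
  rcases Nat.mod_two_eq_zero_or_one r with h1 | h1
  · exact key (r + 1) (by omega) (by omega) (by omega)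
  · exact key r le_rfl (by omega) h1

end Rank

/-! ## The words stored at the nodes -/

section Tables

variable {n : ℕ} (p : Fin n → Pt)

/-- The outward normal of a facet that is given by the events at its ends. -/
noncomputable def pairNormal (e : Fin n × Fin n) : Pt := edgeNormal (p e.1) (p e.2)

noncomputable def pairKey (e : Fin n × Fin n) : ℝ := key (pairNormal p e)

/-- The facets of a hull list. -/
def facetPairs (L : List (Fin n)) : List (Fin n × Fin n) :=
  if 2 ≤ L.length then L.zip (L.rotate 1) else []

theorem length_facetPairs {L : List (Fin n)} (h : 2 ≤ L.length) :
    (facetPairs L).length = L.length := by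
  rw [facetPairs, if_pos h]; simp

theorem length_facetPairs_le (L : List (Fin n)) : (facetPairs L).length ≤ L.length := by
  by_cases h : 2 ≤ L.length
  · exact (length_facetPairs h).le
  · rw [facetPairs, if_neg h]; simp

theorem two_le_length_of_facetPairs {L : List (Fin n)} (h : 0 < (facetPairs L).length) :
    2 ≤ L.length := by
  by_contra h'
  rw [facetPairs, if_neg h'] at h
  simp at h

theorem pairNormal_facetPairs {L : List (Fin n)} {k : ℕ} (hk : k < (facetPairs L).length) :
    pairNormal p (facetPairs L)[k] = facetNormal p L k := by
  have h := two_le_length_of_facetPairs (Nat.lt_of_le_of_lt (Nat.zero_le k) hk)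
  have hk' : k < L.length := (length_facetPairs h) ▸ hk
  have h1 : (k + 1) % L.length < L.length := Nat.mod_lt _ (by omega)
  simp only [facetPairs, if_pos h, List.getElem_zip, List.getElem_rotate, pairNormal, facetNormal]
  rw [IsHullList.vertex_eq hk', ← IsHullList.vertex_mod (k + 1), IsHullList.vertex_eq h1]

variable {p}

theorem _root_.WindowedHull.IsHullList.pairwise_facetPairs {C : Finset (Fin n)}
    {L : List (Fin n)} (h : IsHullList p C L) :
    (facetPairs L).Pairwise fun a b => pairKey p a ≤ pairKey p b := by
  rw [List.pairwise_iff_getElem]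
  intro k l hk hl hkl
  rw [pairKey, pairKey, pairNormal_facetPairs, pairNormal_facetPairs]
  have := length_facetPairs_le L
  exact (h.key_facetNormal_lt hkl (by omega)).le

theorem _root_.WindowedHull.IsHullList.length_le_card {C : Finset (Fin n)} {L : List (Fin n)}
    (h : IsHullList p C L) : L.length ≤ C.card := by
  rw [← List.toFinset_card_of_nodup h.nodup.of_map]
  exact Finset.card_le_card fun t ht => h.mem t (List.mem_toFinset.1 ht)

variable (p)

open Classical in
noncomputable def sortByKey (l : List (Fin n × Fin n)) : List (Fin n × Fin n) :=
  l.insertionSort fun a b => pairKey p a ≤ pairKey p b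

theorem pairwise_sortByKey (l : List (Fin n × Fin n)) :
    (sortByKey p l).Pairwise fun a b => pairKey p a ≤ pairKey p b := by
  have : Std.Total fun a b : Fin n × Fin n => pairKey p a ≤ pairKey p b :=
    ⟨fun a b => le_total _ _⟩
  have : IsTrans (Fin n × Fin n) fun a b => pairKey p a ≤ pairKey p b :=
    ⟨fun a b c => le_trans⟩
  exact List.pairwise_insertionSort _ _

theorem perm_sortByKey (l : List (Fin n × Fin n)) : (sortByKey p l).Perm l :=
  List.perm_insertionSort _ _

variable {p} (T : DecompTree p)

/-- The sorted list of facets that is kept at a node: those of its own hull and every second one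
of those kept at its children. -/
noncomputable def table : ℕ → ℕ → List (Fin n × Fin n)
  | 0, b => sortByKey p (facetPairs (T.hull 0 b))
  | ℓ + 1, b => sortByKey p (facetPairs (T.hull (ℓ + 1) b) ++
      (oddPositions (table ℓ (2 * b)) ++ oddPositions (table ℓ (2 * b + 1))))

theorem pairwise_table (ℓ b : ℕ) :
    (table T ℓ b).Pairwise fun a b => pairKey p a ≤ pairKey p b := by
  cases ℓ <;> rw [table] <;> exact pairwise_sortByKey p _

theorem facetPairs_subset_table {ℓ b : ℕ} {e : Fin n × Fin n} (h : e ∈ facetPairs (T.hull ℓ b)) :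
    e ∈ table T ℓ b := by
  cases ℓ <;> rw [table, (perm_sortByKey p _).mem_iff]
  · exact h
  · exact List.mem_append_left _ h

theorem oddPositions_subset_table {ℓ Q b : ℕ} (hb : b / 2 = Q) {e : Fin n × Fin n}
    (h : e ∈ oddPositions (table T ℓ b)) : e ∈ table T (ℓ + 1) Q := by
  rw [table, (perm_sortByKey p _).mem_iff]
  refine List.mem_append_right _ ?_
  rcases (by omega : b = 2 * Q ∨ b = 2 * Q + 1) with rfl | rfl
  · exact List.mem_append_left _ h
  · exact List.mem_append_right _ h

theorem card_canonicalSubset_succ (n ℓ b : ℕ) :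
    (canonicalSubset n (ℓ + 1) b).card =
      (canonicalSubset n ℓ (2 * b)).card + (canonicalSubset n ℓ (2 * b + 1)).card := by
  rw [← Finset.card_union_of_disjoint]
  · congr 1
    ext t
    simp only [canonicalSubset, Finset.mem_union, Finset.mem_filter, Finset.mem_univ, true_and,
      pow_succ, ← Nat.div_div_eq_div_mul]
    omega
  · rw [Finset.disjoint_left]
    intro t
    simp only [canonicalSubset, Finset.mem_filter, Finset.mem_univ, true_and]
    omega

/-- The own facets contribute at most the size of the canonical subset. By induction, the halves of
the two tables below contribute at most the sizes of the children, which add up to the same number.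
-/
theorem length_table_le {ℓ b : ℕ} (hℓ : ℓ ≤ Nat.clog 2 n) :
    (table T ℓ b).length ≤ 2 * (canonicalSubset n ℓ b).card := by
  induction ℓ generalizing b with
  | zero =>
    rw [table, (perm_sortByKey p _).length_eq]
    have := length_facetPairs_le (T.hull 0 b)
    have := (T.hull_spec 0 b hℓ).length_le_card
    omega
  | succ ℓ ih =>
    rw [table, (perm_sortByKey p _).length_eq, List.length_append, List.length_append,
      length_oddPositions, length_oddPositions]
    have := length_facetPairs_le (T.hull (ℓ + 1) b)
    have := (T.hull_spec (ℓ + 1) b hℓ).length_le_card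
    have := card_canonicalSubset_succ n ℓ b
    have := ih (b := 2 * b) (by omega)
    have := ih (b := 2 * b + 1) (by omega)
    omega

/-- The words kept with the `e`-th entry of the table of a node. -/
noncomputable def tableField : ℕ → ℕ → ℕ → ℕ → ℤ
  | ℓ, b, e, 0 => (((table T ℓ b)[e]?.map fun x => x.1.val).getD 0 : ℕ)
  | ℓ, b, e, 1 => (((table T ℓ b)[e]?.map fun x => x.2.val).getD 0 : ℕ)
  | ℓ, b, e, 2 => link (pairKey p) (table T ℓ b) (facetPairs (T.hull ℓ b)) e
  | ℓ + 1, b, e, 3 => link (pairKey p) (table T (ℓ + 1) b) (table T ℓ (2 * b)) e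
  | ℓ + 1, b, e, 4 => link (pairKey p) (table T (ℓ + 1) b) (table T ℓ (2 * b + 1)) e
  | ℓ, b, _, 5 => (table T ℓ b).length
  | _, _, _, _ => 0

/-- The words that are added to the tree. -/
noncomputable def tableWord (ℓ b k : ℕ) : ℤ :=
  if ℓ ≤ Nat.clog 2 n ∧ k < 24 * (canonicalSubset n ℓ b).card then
    tableField T ℓ b (k / 8) (k % 8)
  else 0

theorem tableField_bounds {ℓ b : ℕ} (hℓ : ℓ ≤ Nat.clog 2 n) (e fld : ℕ) :
    0 ≤ tableField T ℓ b e fld ∧ tableField T ℓ b e fld ≤ 2 * n ∧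
      ((canonicalSubset n ℓ b).card = 0 → tableField T ℓ b e fld = 0) := by
  have hcard : ∀ ℓ b, (canonicalSubset n ℓ b).card ≤ n := fun ℓ b => by
    simpa using Finset.card_le_univ (canonicalSubset n ℓ b)
  have h0 := length_table_le T (b := b) hℓ
  have h0' := hcard ℓ b
  have hev : ∀ f : Fin n × Fin n → Fin n,
      (((table T ℓ b)[e]?.map fun x => (f x).val).getD 0) ≤ 2 * n ∧
      ((canonicalSubset n ℓ b).card = 0 →
        (((table T ℓ b)[e]?.map fun x => (f x).val).getD 0) = 0) := fun f => by
    rcases h : (table T ℓ b)[e]? with _ | x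
    · simp
    · refine ⟨by simpa using by omega, fun hC => ?_⟩
      have := (List.getElem?_eq_some_iff.1 h).1
      omega
  have hlink : ∀ l' l : List (Fin n × Fin n), l.length ≤ 2 * n →
      ((canonicalSubset n ℓ b).card = 0 → l.length = 0) →
      (0 : ℤ) ≤ link (pairKey p) l' l e ∧ (link (pairKey p) l' l e : ℤ) ≤ 2 * n ∧
        ((canonicalSubset n ℓ b).card = 0 → (link (pairKey p) l' l e : ℤ) = 0) := by
    intro l' l h1 h2
    have h3 : link (pairKey p) l' l e ≤ l.length := rank_le_length _ _
    omega
  rcases fld with _ | _ | _ | _ | _ | _ | fld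
  · have := hev Prod.fst
    exact ⟨by rw [tableField]; positivity, by rw [tableField]; exact_mod_cast this.1,
      fun h => by rw [tableField]; exact_mod_cast this.2 h⟩
  · have := hev Prod.snd
    exact ⟨by rw [tableField]; positivity, by rw [tableField]; exact_mod_cast this.1,
      fun h => by rw [tableField]; exact_mod_cast this.2 h⟩
  · rw [tableField]
    have := length_facetPairs_le (T.hull ℓ b)
    have := (T.hull_spec ℓ b hℓ).length_le_card
    exact hlink _ _ (by omega) (by omega)
  · cases ℓ with
    | zero => simp [tableField]
    | succ ℓ =>
      rw [tableField]
      have := length_table_le T (b := 2 * b) (show ℓ ≤ _ by omega)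
      have := hcard ℓ (2 * b)
      have := card_canonicalSubset_succ n ℓ b
      exact hlink _ _ (by omega) (by omega)
  · cases ℓ with
    | zero => simp [tableField]
    | succ ℓ =>
      rw [tableField]
      have := length_table_le T (b := 2 * b + 1) (show ℓ ≤ _ by omega)
      have := hcard ℓ (2 * b + 1)
      have := card_canonicalSubset_succ n ℓ b
      exact hlink _ _ (by omega) (by omega)
  · rw [tableField]
    omega
  · have : tableField T ℓ b e (fld + 6) = 0 := by cases ℓ <;> rfl
    rw [this]
    simp

theorem smallExtra_tableWord : SmallExtra 24 n (tableWord T) := by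
  intro ℓ b k
  unfold tableWord
  split_ifs with h
  · have := tableField_bounds T (b := b) h.1 (k / 8) (k % 8)
    refine ⟨?_, fun _ => h⟩
    rw [abs_of_nonneg this.1]
    push_cast
    linarith [this.2.1, (Nat.cast_nonneg n : (0 : ℤ) ≤ n)]
  · simp

/-- A rank may equal the length of the table, so there are up to `2 * card + 1` records of eight
words, and `16 * card + 8 ≤ 24 * card` unless the node is empty. For an empty node all fields are
`0`, the value outside the stored range. -/
theorem tableWord_eq {ℓ b e fld : ℕ} (hℓ : ℓ ≤ Nat.clog 2 n) (he : e ≤ (table T ℓ b).length)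
    (hf : fld < 8) : tableWord T ℓ b (8 * e + fld) = tableField T ℓ b e fld := by
  have h1 : (8 * e + fld) / 8 = e := by omega
  have h2 : (8 * e + fld) % 8 = fld := by omega
  rw [tableWord, h1, h2]
  split_ifs with h
  · rfl
  · have h3 := length_table_le T (b := b) hℓ
    exact ((tableField_bounds T (b := b) hℓ e fld).2.2 (by
      by_contra h4
      exact h ⟨hℓ, by omega⟩)).symm

theorem tableWord_child {ℓ Q b e : ℕ} (hℓ : ℓ + 1 ≤ Nat.clog 2 n)
    (he : e ≤ (table T (ℓ + 1) Q).length) (hb : b / 2 = Q) :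
    tableWord T (ℓ + 1) Q (8 * e + (3 + b % 2)) =
      link (pairKey p) (table T (ℓ + 1) Q) (table T ℓ b) e := by
  rw [tableWord_eq T hℓ he (by omega)]
  rcases (by omega : b = 2 * Q ∨ b = 2 * Q + 1) with rfl | rfl
  · rw [show 3 + 2 * Q % 2 = 3 by omega]; rfl
  · rw [show 3 + (2 * Q + 1) % 2 = 4 by omega]; rfl

end Tables

/-! ## The canonical cover -/

/-- The last block of level `ℓ` that begins before the window. -/
def blockBefore (i ℓ : ℕ) : ℤ := ((i : ℤ) - 1) / 2 ^ ℓ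

/-- The first block of level `ℓ` that ends after the window. -/
def blockAfter (j ℓ : ℕ) : ℤ := ((j : ℤ) + 1) / 2 ^ ℓ

theorem inWindow_iff {i j ℓ b : ℕ} :
    InWindow i j ℓ b ↔ blockBefore i ℓ < b ∧ b < blockAfter j ℓ := by
  have hp : 0 < 2 ^ ℓ := by positivity
  have hp' : (0 : ℤ) < 2 ^ ℓ := by positivity
  have e1 : blockBefore i ℓ < b ↔ i ≤ b * 2 ^ ℓ := by
    rw [blockBefore, Int.ediv_lt_iff_lt_mul hp']
    constructor
    · intro h
      have : (i : ℤ) ≤ b * 2 ^ ℓ := by linarith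
      exact_mod_cast this
    · intro h
      have : (i : ℤ) ≤ b * 2 ^ ℓ := by exact_mod_cast h
      linarith
  have e2 : (b : ℤ) < blockAfter j ℓ ↔ (b + 1) * 2 ^ ℓ ≤ j + 1 := by
    rw [blockAfter, ← Int.add_one_le_iff, Int.le_ediv_iff_mul_le hp']
    norm_cast
  rw [e1, e2]
  constructor
  · intro h
    refine ⟨(h (b * 2 ^ ℓ) (Nat.mul_div_cancel _ hp)).1, ?_⟩
    have h1 : ((b + 1) * 2 ^ ℓ - 1) / 2 ^ ℓ = b := by
      rw [Nat.div_eq_iff hp, add_one_mul]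
      omega
    have := (h _ h1).2
    omega
  · rintro ⟨h1, h2⟩ t rfl
    have h3 := Nat.div_mul_le_self t (2 ^ ℓ)
    have h4 := Nat.lt_mul_div_succ t hp
    rw [mul_comm] at h4
    omega

theorem blockBefore_succ (i ℓ : ℕ) : blockBefore i (ℓ + 1) = blockBefore i ℓ / 2 := by
  rw [blockBefore, blockBefore, pow_succ, Int.ediv_ediv_of_nonneg (by positivity)]

theorem blockAfter_succ (j ℓ : ℕ) : blockAfter j (ℓ + 1) = blockAfter j ℓ / 2 := by
  rw [blockAfter, blockAfter, pow_succ, Int.ediv_ediv_of_nonneg (by positivity)]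

/-- The other child of the parent. -/
def sibling (b : ℤ) : ℤ := 4 * (b / 2) + 1 - b

/-- The nodes of the canonical cover are siblings of nodes on the paths to the times just before
and just after the window. -/
theorem inCover_iff {i j ℓ b : ℕ} :
    InCover i j ℓ b ↔ (blockBefore i ℓ < b ∧ b < blockAfter j ℓ) ∧
      ((b : ℤ) = sibling (blockBefore i ℓ) ∨ (b : ℤ) = sibling (blockAfter j ℓ)) := by
  rw [InCover, inWindow_iff, inWindow_iff, blockBefore_succ, blockAfter_succ, sibling, sibling]
  push_cast
  omega

/-- A block of height `ℓ` has `2 ^ ℓ` times. This is what makes the running time depend on the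
window and not on `n`: walks can start at height `log₂ w` instead of at the root. -/
theorem level_le_of_inWindow {i j ℓ b : ℕ} (h : InWindow i j ℓ b) :
    ℓ ≤ Nat.log 2 (j - i + 1) := by
  have hp : 0 < 2 ^ ℓ := by positivity
  have h1 := (h (b * 2 ^ ℓ) (Nat.mul_div_cancel _ hp)).1
  have h2 : ((b + 1) * 2 ^ ℓ - 1) / 2 ^ ℓ = b := by
    rw [Nat.div_eq_iff hp, add_one_mul]
    omega
  have h3 := (h _ h2).2
  rw [add_one_mul] at h3
  exact Nat.le_log_of_pow_le (by norm_num) (by omega)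

theorem log_window_le_clog {i j n : ℕ} (hij : i ≤ j) (hj : j < n) :
    Nat.log 2 (j - i + 1) ≤ Nat.clog 2 n := by
  refine (Nat.pow_le_pow_iff_right (a := 2) (by norm_num)).1 ?_
  calc 2 ^ Nat.log 2 (j - i + 1) ≤ j - i + 1 := Nat.pow_log_le_self 2 (by omega)
    _ ≤ n := by omega
    _ ≤ 2 ^ Nat.clog 2 n := Nat.le_pow_clog (by norm_num) n

/-- Every time of the window belongs to a node of the canonical cover. -/
theorem exists_inCover {i j t : ℕ} (h1 : i ≤ t) (h2 : t ≤ j) :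
    ∃ ℓ, InCover i j ℓ (t / 2 ^ ℓ) := by
  by_contra! h
  have hall : ∀ ℓ, InWindow i j ℓ (t / 2 ^ ℓ) := by
    intro ℓ
    induction ℓ with
    | zero => intro s hs; simp at hs; omega
    | succ ℓ ih =>
      have := h ℓ
      rw [InCover, not_and, not_not, Nat.div_div_eq_div_mul, ← pow_succ] at this
      exact this ih
  have := level_le_of_inWindow (hall (Nat.log 2 (j - i + 1) + 1))
  omega

end WindowedHull

namespace WindowedHull

/-! ## Reasoning about programs -/

/-- Started in `s`, the program halts after at most `t` steps in a state that satisfies `Q`. -/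
def Runs (x : Input) (P : Prog) (s : State) (t : ℕ) (Q : State → Prop) : Prop :=
  ∃ m s', Exec x P s m s' ∧ m ≤ t ∧ Q s'

/-- The states agree at all addresses outside `A`. -/
def AgreeOff (A : ℤ → Prop) (s s' : State) : Prop :=
  ∀ a, ¬ A a → s'.ints a = s.ints a ∧ s'.reals a = s.reals a

theorem AgreeOff.trans {A : ℤ → Prop} {s₁ s₂ s₃ : State} (h : AgreeOff A s₁ s₂)
    (h' : AgreeOff A s₂ s₃) : AgreeOff A s₁ s₃ := fun a ha =>
  ⟨(h' a ha).1.trans (h a ha).1, (h' a ha).2.trans (h a ha).2⟩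

theorem AgreeOff.mono {A B : ℤ → Prop} {s s' : State} (h : AgreeOff A s s')
    (hAB : ∀ a, A a → B a) : AgreeOff B s s' := fun a ha => h a fun h' => ha (hAB a h')

theorem AgreeOff.refl (A : ℤ → Prop) (s : State) : AgreeOff A s s := fun _ _ => ⟨rfl, rfl⟩

/-- All addresses to which the program writes are literals in `A`. -/
def Prog.Within (A : ℤ → Prop) : Prog → Prop
  | .skip => True
  | .setInt (.lit a) _ => A a
  | .setInt _ _ => False
  | .setReal (.lit a) _ => A a
  | .setReal _ _ => False
  | .seq P R => P.Within A ∧ R.Within A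
  | .cond _ P R => P.Within A ∧ R.Within A
  | .loop _ P => P.Within A

/-- The frame rule: what a subprogram leaves untouched is read off from the literal addresses in its
text. -/
theorem Exec.agreeOff {x : Input} {A : ℤ → Prop} {P : Prog} {s s' : State} {m : ℕ}
    (h : Exec x P s m s') : P.Within A → AgreeOff A s s' := by
  induction h with
  | skip s => exact fun _ => AgreeOff.refl A s
  | setInt a v s =>
    intro hA b hb
    cases a <;> simp only [Prog.Within] at hA
    have : b ≠ _ := fun e => hb (e ▸ hA)
    simp [Function.update_of_ne, IntExpr.eval, this]
  | setReal a v s =>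
    intro hA b hb
    cases a <;> simp only [Prog.Within] at hA
    have : b ≠ _ := fun e => hb (e ▸ hA)
    simp [Function.update_of_ne, IntExpr.eval, this]
  | seq _ _ ih₁ ih₂ => exact fun hA => (ih₁ hA.1).trans (ih₂ hA.2)
  | condTrue _ _ ih => exact fun hA => ih hA.1
  | condFalse _ _ ih => exact fun hA => ih hA.2
  | loopStep _ _ _ ih₁ ih₂ => exact fun hA => (ih₁ hA).trans (ih₂ hA)
  | loopEnd _ => exact fun _ => AgreeOff.refl A _

namespace Runs

variable {x : Input} {P R : Prog} {s : State} {t t₁ t₂ : ℕ} {Q Q' : State → Prop}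

theorem mono (h : Runs x P s t Q) (ht : t ≤ t₁) (hQ : ∀ s', Q s' → Q' s') : Runs x P s t₁ Q' := by
  obtain ⟨m, s', h1, h2, h3⟩ := h
  exact ⟨m, s', h1, h2.trans ht, hQ s' h3⟩

theorem agree {A : ℤ → Prop} (h : Runs x P s t Q) (hA : P.Within A) :
    Runs x P s t fun s' => Q s' ∧ AgreeOff A s s' := by
  obtain ⟨m, s', h1, h2, h3⟩ := h
  exact ⟨m, s', h1, h2, h3, h1.agreeOff hA⟩

theorem seq (h : Runs x P s t₁ Q') (h' : ∀ s', Q' s' → Runs x R s' t₂ Q) :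
    Runs x (.seq P R) s (t₁ + t₂) Q := by
  obtain ⟨m, s₁, h1, h2, h3⟩ := h
  obtain ⟨m', s₂, h4, h5, h6⟩ := h' s₁ h3
  exact ⟨_, s₂, .seq h1 h4, by omega, h6⟩

theorem cond {c : Test} (h : c.Holds x s → Runs x P s t Q) (h' : ¬ c.Holds x s → Runs x R s t Q) :
    Runs x (.cond c P R) s (c.cost + t) Q := by
  by_cases hc : c.Holds x s
  · obtain ⟨m, s₁, h1, h2, h3⟩ := h hc
    exact ⟨_, s₁, .condTrue hc h1, by omega, h3⟩
  · obtain ⟨m, s₁, h1, h2, h3⟩ := h' hc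
    exact ⟨_, s₁, .condFalse hc h1, by omega, h3⟩

theorem skip (h : Q s) : Runs x .skip s 1 Q := ⟨_, _, .skip s, le_rfl, h⟩

/-- A loop with a bound on the number of its rounds; the cost of a round may depend on the number
of rounds to come. -/
theorem loop {c : Test} {Inv : ℕ → State → Prop} {f : ℕ → ℕ}
    (body : ∀ k s, Inv k s → c.Holds x s → ∃ k', k = k' + 1 ∧ Runs x P s (f k') (Inv k'))
    (exit : ∀ k s, Inv k s → ¬ c.Holds x s → Q s) (k : ℕ) (hs : Inv k s) :
    Runs x (.loop c P) s (∑ i ∈ Finset.range k, (f i + c.cost) + c.cost) Q := by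
  induction k generalizing s with
  | zero =>
    by_cases hc : c.Holds x s
    · obtain ⟨k', h, -⟩ := body 0 s hs hc
      omega
    · exact ⟨_, s, .loopEnd hc, by simp, exit _ _ hs hc⟩
  | succ k ih =>
    by_cases hc : c.Holds x s
    · obtain ⟨k', h, m, s₁, h1, h2, h3⟩ := body _ s hs hc
      obtain rfl : k = k' := by omega
      obtain ⟨m', s₂, h4, h5, h6⟩ := ih h3
      refine ⟨_, s₂, .loopStep hc h1 h4, ?_, h6⟩
      rw [Finset.sum_range_succ]
      omega
    · exact ⟨_, s, .loopEnd hc, by omega, exit _ _ hs hc⟩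

end Runs

/-- A program without loops. -/
def Prog.LoopFree : Prog → Prop
  | .seq P R => P.LoopFree ∧ R.LoopFree
  | .cond _ P R => P.LoopFree ∧ R.LoopFree
  | .loop _ _ => False
  | _ => True

/-- A bound on the cost of a program without loops. -/
def Prog.cost : Prog → ℕ
  | .skip => 1
  | .setInt a v => a.cost + v.cost + 1
  | .setReal a v => a.cost + v.cost + 1
  | .seq P R => P.cost + R.cost
  | .cond c P R => c.cost + (P.cost + R.cost)
  | .loop _ _ => 0

open Classical in
/-- The state in which a program without loops halts. -/
noncomputable def Prog.run (x : Input) : Prog → State → State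
  | .skip, s => s
  | .setInt a v, s => ⟨Function.update s.ints (a.eval x s) (v.eval x s), s.reals⟩
  | .setReal a v, s => ⟨s.ints, Function.update s.reals (a.eval x s) (v.eval x s)⟩
  | .seq P R, s => R.run x (P.run x s)
  | .cond c P R, s => if c.Holds x s then P.run x s else R.run x s
  | .loop _ _, s => s

theorem Prog.exec_run (x : Input) (P : Prog) (hP : P.LoopFree) (s : State) :
    ∃ m ≤ P.cost, Exec x P s m (P.run x s) := by
  induction P generalizing s with
  | skip => exact ⟨_, le_rfl, .skip s⟩
  | setInt a v => exact ⟨_, le_rfl, .setInt a v s⟩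
  | setReal a v => exact ⟨_, le_rfl, .setReal a v s⟩
  | seq P R ih₁ ih₂ =>
    obtain ⟨m, h, h'⟩ := ih₁ hP.1 s
    obtain ⟨m', h₁, h₁'⟩ := ih₂ hP.2 (P.run x s)
    exact ⟨_, Nat.add_le_add h h₁, .seq h' h₁'⟩
  | cond c P R ih₁ ih₂ =>
    rw [Prog.run, Prog.cost]
    split_ifs with hc
    · obtain ⟨m, h, h'⟩ := ih₁ hP.1 s
      exact ⟨_, by omega, .condTrue hc h'⟩
    · obtain ⟨m, h, h'⟩ := ih₂ hP.2 s
      exact ⟨_, by omega, .condFalse hc h'⟩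
  | loop c P => exact hP.elim

theorem Runs.of_run {x : Input} {P : Prog} {s : State} {Q : State → Prop} (hP : P.LoopFree)
    (h : Q (P.run x s)) : Runs x P s P.cost Q := by
  obtain ⟨m, h1, h2⟩ := P.exec_run x hP s
  exact ⟨m, _, h2, h1, h⟩

/-! ## The program: shorthands -/

namespace Code

/-- The contents of the integer cell with the address `a`. -/
def ic (a : ℤ) : IntExpr := .cell (.lit a)

/-- The contents of the real cell with the address `a`. -/
def rc (a : ℤ) : RealExpr := .cell (.lit a)

def dbl (e : IntExpr) : IntExpr := .add e e

def oct (e : IntExpr) : IntExpr := dbl (dbl (dbl e))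

def crossE (a b c d : RealExpr) : RealExpr := .sub (.mul a d) (.mul b c)

def dotE (a b c d : RealExpr) : RealExpr := .add (.mul a c) (.mul b d)

/-- Set the integer cell `h` to the class of the half circle of the vector `(X, Y)`. -/
def halfP (X Y : RealExpr) (h : ℤ) : Prog :=
  .cond (.realLe (.lit 0) Y)
    (.cond (.realLe Y (.lit 0))
      (.cond (.realLe X (.lit 0)) (.setInt (.lit h) (.lit 1)) (.setInt (.lit h) (.lit 0)))
      (.setInt (.lit h) (.lit 1)))
    (.setInt (.lit h) (.lit 0))

/-- Set the integer cell `out` to `1` if the key of the first vector is at most that of the second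
one, and to `0` otherwise. -/
def keyLeP (X Y X' Y' : RealExpr) (out : ℤ) : Prog :=
  .seq (halfP X Y 36) (.seq (halfP X' Y' 37)
    (.cond (.intLe (ic 36) (ic 37))
      (.cond (.intLe (ic 37) (ic 36))
        (.cond (.realLe (crossE X Y X' Y') (.lit 0))
          (.setInt (.lit out) (.lit 1)) (.setInt (.lit out) (.lit 0)))
        (.setInt (.lit out) (.lit 1)))
      (.setInt (.lit out) (.lit 0))))

theorem eval_ic (x : Input) (s : State) (a : ℤ) : (ic a).eval x s = s.ints a := rfl

theorem eval_rc (x : Input) (s : State) (a : ℤ) : (rc a).eval x s = s.reals a := rfl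

theorem eval_dbl (x : Input) (s : State) (e : IntExpr) :
    (dbl e).eval x s = 2 * e.eval x s := by
  rw [dbl, IntExpr.eval]; ring

theorem eval_oct (x : Input) (s : State) (e : IntExpr) :
    (oct e).eval x s = 8 * e.eval x s := by
  rw [oct, eval_dbl, eval_dbl, eval_dbl]; ring

theorem eval_crossE (x : Input) (s : State) (a b c d : RealExpr) :
    (crossE a b c d).eval x s = cross (a.eval x s, b.eval x s) (c.eval x s, d.eval x s) := rfl

theorem eval_dotE (x : Input) (s : State) (a b c d : RealExpr) :
    (dotE a b c d).eval x s = dot (a.eval x s, b.eval x s) (c.eval x s, d.eval x s) := rfl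

open Classical in
theorem halfClass_eq (a b : ℝ) :
    halfClass (a, b) = if 0 ≤ b then if b ≤ 0 then if a ≤ 0 then 1 else 0 else 1 else 0 := by
  have hl : InLower (a, b) ↔ b < 0 ∨ b = 0 ∧ 0 < a := Iff.rfl
  rw [halfClass, hl]
  by_cases h1 : 0 ≤ b
  · by_cases h2 : b ≤ 0
    · have h3 : b = 0 := le_antisymm h2 h1
      by_cases h4 : a ≤ 0
      · simp [h3, h4]
      · simp [h3, h4, not_le.1 h4]
    · simp [h1, h2, (not_le.1 h2).ne']
  · simp [h1, not_le.1 h1]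

theorem runs_halfP {x : Input} {s : State} {X Y : RealExpr} {h : ℤ} {u : Pt}
    (hX : X.eval x s = u.1) (hY : Y.eval x s = u.2) :
    Runs x (halfP X Y h) s (halfP X Y h).cost fun s' =>
      s'.ints h = halfClass u ∧ s'.reals = s.reals ∧ ∀ a, a ≠ h → s'.ints a = s.ints a := by
  refine Runs.of_run (by simp [halfP, Prog.LoopFree]) ?_
  have e : (halfP X Y h).run x s = ⟨Function.update s.ints h (halfClass u), s.reals⟩ := by
    rw [show u = (u.1, u.2) from rfl, halfClass_eq]
    simp only [halfP, Prog.run, Test.Holds, RealExpr.eval, IntExpr.eval, hX, hY, Int.cast_zero]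
    split_ifs <;> rfl
  rw [e]
  exact ⟨Function.update_self .., rfl, fun a ha => Function.update_of_ne ha ..⟩

/-- `z` is the truth value of `p`. -/
def IsBit (z : ℤ) (p : Prop) : Prop := z = 1 ∧ p ∨ z = 0 ∧ ¬ p

/-- The vectors must keep their values in every state with the same real cells, because the
half-circle classes are written to the integer cells `36` and `37` before the cross product is
evaluated. -/
theorem runs_keyLeP {x : Input} {s : State} {X Y X' Y' : RealExpr} {out : ℤ} {u v : Pt}
    (hu : u ≠ 0) (hv : v ≠ 0)
    (h : ∀ s' : State, s'.reals = s.reals → X.eval x s' = u.1 ∧ Y.eval x s' = u.2 ∧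
      X'.eval x s' = v.1 ∧ Y'.eval x s' = v.2) :
    Runs x (keyLeP X Y X' Y' out) s (keyLeP X Y X' Y' out).cost fun s' =>
      IsBit (s'.ints out) (key u ≤ key v) ∧ s'.reals = s.reals ∧
        ∀ a, a ≠ out → a ≠ 36 → a ≠ 37 → s'.ints a = s.ints a := by
  refine Runs.seq (runs_halfP (h s rfl).1 (h s rfl).2.1) fun s₁ ⟨h1, h2, h3⟩ => ?_
  refine Runs.seq (runs_halfP (h s₁ h2).2.2.1 (h s₁ h2).2.2.2) fun s₂ ⟨h4, h5, h6⟩ => ?_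
  refine Runs.of_run (by simp [Prog.LoopFree]) ?_
  have h7 := h s₂ (h5.trans h2)
  have h8 := h6 36 (by norm_num)
  rw [h1] at h8
  rw [key_le_iff hu hv]
  simp only [Prog.run, Test.Holds, eval_ic, eval_crossE, h7, h8, h4, IntExpr.eval,
    RealExpr.eval, Int.cast_zero, Prod.mk.eta]
  have fin : ∀ (w : ℤ) (pr : Prop), IsBit w pr →
      IsBit ((Function.update s₂.ints out w) out) pr ∧ s₂.reals = s.reals ∧
      ∀ a, a ≠ out → a ≠ 36 → a ≠ 37 → (Function.update s₂.ints out w) a = s.ints a := fun w pr hw =>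
    ⟨by rwa [Function.update_self], h5.trans h2, fun a ha h36 h37 => by
      rw [Function.update_of_ne ha, h6 a h37, h3 a h36]⟩
  by_cases c1 : halfClass u ≤ halfClass v
  · by_cases c2 : halfClass v ≤ halfClass u
    · have c3 : halfClass u = halfClass v := le_antisymm c1 c2
      by_cases c4 : cross u v ≤ 0
      · rw [if_pos c1, if_pos c2, if_pos c4]
        exact fin 1 _ (Or.inl ⟨rfl, Or.inr ⟨c3, c4⟩⟩)
      · rw [if_pos c1, if_pos c2, if_neg c4]
        exact fin 0 _ (Or.inr ⟨rfl, fun h => h.elim (fun h => by omega) fun h => c4 h.2⟩)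
    · rw [if_pos c1, if_neg c2]
      exact fin 1 _ (Or.inl ⟨rfl, Or.inl (by omega)⟩)
  · rw [if_neg c1]
    exact fin 0 _ (Or.inr ⟨rfl, fun h => h.elim (fun h => by omega) fun h => by omega⟩)

end Code

end WindowedHull

/-! ### Further facts on tables and canonical subsets. -/

namespace WindowedHull

section Tables

variable {n : ℕ} {p : Fin n → Pt} (T : DecompTree p)

theorem mem_of_mem_oddPositions {α : Type*} {a : α} :
    ∀ l : List α, a ∈ oddPositions l → a ∈ l
  | [], h => by simp [oddPositions] at h
  | [_], h => by simp [oddPositions] at h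
  | _ :: b :: l, h => by
    rw [oddPositions, List.mem_cons] at h
    rcases h with h | h
    · simp [h]
    · exact List.mem_cons_of_mem _ (List.mem_cons_of_mem _ (mem_of_mem_oddPositions l h))

theorem pairNormal_ne_zero {ℓ b : ℕ} (hℓ : ℓ ≤ Nat.clog 2 n) {e : Fin n × Fin n}
    (he : e ∈ table T ℓ b) : pairNormal p e ≠ 0 := by
  have hf : ∀ ℓ b, ℓ ≤ Nat.clog 2 n → e ∈ facetPairs (T.hull ℓ b) → pairNormal p e ≠ 0 := by
    intro ℓ b hℓ he
    obtain ⟨k, hk, rfl⟩ := List.getElem_of_mem he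
    rw [pairNormal_facetPairs]
    exact (T.hull_spec ℓ b hℓ).facetNormal_ne_zero
      (two_le_length_of_facetPairs (Nat.lt_of_le_of_lt (Nat.zero_le k) hk)) k
  induction ℓ generalizing b with
  | zero =>
    rw [table, (perm_sortByKey p _).mem_iff] at he
    exact hf _ _ hℓ he
  | succ ℓ ih =>
    rw [table, (perm_sortByKey p _).mem_iff, List.mem_append, List.mem_append] at he
    rcases he with he | he | he
    · exact hf _ _ hℓ he
    · exact ih (by omega) (mem_of_mem_oddPositions _ he)
    · exact ih (by omega) (mem_of_mem_oddPositions _ he)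

theorem card_canonicalSubset_le (n ℓ b : ℕ) : (canonicalSubset n ℓ b).card ≤ 2 ^ ℓ := by
  induction ℓ generalizing b with
  | zero =>
    rw [pow_zero, Finset.card_le_one]
    intro s hs t ht
    simp only [canonicalSubset, pow_zero, Nat.div_one, Finset.mem_filter, Finset.mem_univ,
      true_and] at hs ht
    exact Fin.ext (hs.trans ht.symm)
  | succ ℓ ih =>
    rw [card_canonicalSubset_succ, pow_succ]
    have := ih (2 * b)
    have := ih (2 * b + 1)
    omega

end Tables

/-! ## Walking down a path of the tree -/

namespace Code

/-- The normal of the table entry at hand goes to the real cells `o` and `o + 1`. -/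
def entryP (o : ℤ) : Prog :=
  .seq
    (.setReal (.lit o)
      (.sub (.pointY (.extra (ic o) (ic (o + 1)) (oct (ic (o + 4)))))
        (.pointY (.extra (ic o) (ic (o + 1)) (.add (oct (ic (o + 4))) (.lit 1))))))
    (.setReal (.lit (o + 1))
      (.sub (.pointX (.extra (ic o) (ic (o + 1)) (.add (oct (ic (o + 4))) (.lit 1))))
        (.pointX (.extra (ic o) (ic (o + 1)) (oct (ic (o + 4)))))))

/-- One round of a binary search in the table of the node at hand. -/
def probeP (o : ℤ) (tst : Prog) : Prog :=
  .seq (.setInt (.lit (o + 4)) (.half (.add (ic (o + 2)) (ic (o + 3)))))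
    (.seq (entryP o)
      (.seq tst
        (.cond (.intLe (.lit 1) (ic (o + 5)))
          (.setInt (.lit (o + 2)) (.add (ic (o + 4)) (.lit 1)))
          (.setInt (.lit (o + 3)) (ic (o + 4))))))

def searchP (o : ℤ) (tst : Prog) : Prog :=
  .loop (.neg (.intLe (ic (o + 3)) (ic (o + 2)))) (probeP o tst)

/-- The range of the binary search: the whole table at the top level, and below that at most two
positions, which are known from the rank at the parent. -/
def rangeP (o : ℤ) : Prog :=
  .seq (.setInt (.lit (o + 2)) (.lit 0))
    (.seq (.setInt (.lit (o + 3)) (.extra (ic o) (ic (o + 1)) (.lit 5)))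
      (.cond (.intLe (.add (ic o) (.lit 1)) (ic 6))
        (.seq
          (.setInt (.lit (o + 2))
            (.extra (.add (ic o) (.lit 1)) (.half (ic (o + 1)))
              (.add (oct (ic (o + 6)))
                (.add (.lit 3) (.sub (ic (o + 1)) (dbl (.half (ic (o + 1)))))))))
          (.cond (.intLe (.add (ic (o + 2)) (.lit 1)) (ic (o + 3)))
            (.setInt (.lit (o + 3)) (.add (ic (o + 2)) (.lit 1)))
            .skip))
        .skip))

def locateP (o : ℤ) (tst : Prog) : Prog := .seq (rangeP o) (searchP o tst)

def beforeE (l : IntExpr) : IntExpr := .cell (.add (.lit 100) l)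

def afterE (l : IntExpr) : IntExpr := .cell (.sub (.lit (-100)) l)

def siblingE (e : IntExpr) : IntExpr := .sub (.add (dbl (dbl (.half e))) (.lit 1)) e

/-- Treat the node at hand if it lies in the window. -/
def visitP (o : ℤ) (act : Prog) : Prog :=
  .cond (.intLe (.add (beforeE (ic o)) (.lit 1)) (ic (o + 1)))
    (.cond (.intLe (.add (ic (o + 1)) (.lit 1)) (afterE (ic o)))
      (.seq
        (.setInt (.lit (o + 7)) (.extra (ic o) (ic (o + 1)) (.add (oct (ic (o + 2))) (.lit 2))))
        act)
      .skip)
    .skip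

/-- Treat the sibling of the path node of the level at hand. -/
def siblingP (o : ℤ) (arr : IntExpr → IntExpr) (tst act : Prog) : Prog :=
  .seq (.setInt (.lit (o + 1)) (siblingE (arr (ic o)))) (.seq (locateP o tst) (visitP o act))

/-- Treat the path node of the level at hand, and go down one level. -/
def descendP (o : ℤ) (arr : IntExpr → IntExpr) (tst : Prog) : Prog :=
  .seq (.setInt (.lit (o + 1)) (arr (ic o)))
    (.seq (locateP o tst)
      (.seq (.setInt (.lit (o + 6)) (ic (o + 2)))
        (.setInt (.lit o) (.sub (ic o) (.lit 1)))))

def walkP (o : ℤ) (arr : IntExpr → IntExpr) (tst act : Prog) : Prog :=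
  .seq (.setInt (.lit o) (ic 6))
    (.loop (.intLe (.lit 0) (ic o)) (.seq (siblingP o arr tst act) (descendP o arr tst)))

end Code

open Code

/-- The working cells of a walk. -/
def WalkCell (o a : ℤ) : Prop := o ≤ a ∧ a < o + 8

/-- The arrays with the blocks before and after the window. -/
def Arrays (i j L : ℕ) (s : State) : Prop :=
  s.ints 6 = L ∧ ∀ ℓ ≤ L, s.ints (100 + ℓ) = blockBefore i ℓ ∧ s.ints (-100 - ℓ) = blockAfter j ℓ

/-- The input with the tables added to the tree. -/
noncomputable def tableInput {n : ℕ} {p : Fin n → Pt} (T : DecompTree p) (i j : ℕ) (o q : Pt) :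
    Input := ⟨n, p, T, tableWord T, i, j, o, q⟩

/-- What a walk requires: `tst` decides a property of directions, `act` treats a node of the
canonical cover, and `J V` says that the nodes in `V` have been treated. -/
structure Walkable {n : ℕ} {p : Fin n → Pt} (T : DecompTree p) (i j : ℕ) (x : Input) (o : ℤ)
    (tst act : Prog) (τ τ' : ℕ) (pr : ℝ → Prop) (L : ℕ) (J : Set (ℕ × ℕ) → State → Prop) :
    Prop where
  down : DownClosed pr
  stable : ∀ V s s', J V s → AgreeOff (WalkCell o) s s' → J V s'
  arrays : ∀ V s, J V s → Arrays i j L s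
  probe : ∀ V s u, J V s → u ≠ 0 → s.reals o = u.1 → s.reals (o + 1) = u.2 →
    Runs x tst s τ fun s' => J V s' ∧ IsBit (s'.ints (o + 5)) (pr (key u)) ∧
      ∀ a, WalkCell o a → a ≠ o + 5 → s'.ints a = s.ints a
  visit : ∀ V s ℓ b, J V s → InCover i j ℓ b → s.ints o = (ℓ : ℕ) → s.ints (o + 1) = (b : ℕ) →
    s.ints (o + 7) = (rank (pairKey p) pr (facetPairs (T.hull ℓ b)) : ℕ) →
    Runs x act s τ' fun s' => J (insert (ℓ, b) V) s' ∧ ∀ a, WalkCell o a → s'.ints a = s.ints a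

section Walk

variable {n : ℕ} {p : Fin n → Pt} {T : DecompTree p} {i j : ℕ} {o₀ q₀ : Pt}

theorem eval_extra {s : State} {a b k : IntExpr} {ℓ c d : ℕ}
    (ha : a.eval (tableInput T i j o₀ q₀) s = ℓ) (hb : b.eval (tableInput T i j o₀ q₀) s = c)
    (hk : k.eval (tableInput T i j o₀ q₀) s = d) :
    (IntExpr.extra a b k).eval (tableInput T i j o₀ q₀) s = tableWord T ℓ c d := by
  rw [IntExpr.eval, ha, hb, hk]
  rfl

theorem pointAt_val (t : Fin n) : (tableInput T i j o₀ q₀).pointAt (t.val : ℤ) = p t := by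
  rw [Input.pointAt]
  have : ((t.val : ℤ)).toNat < (tableInput T i j o₀ q₀).numEvents := by
    rw [Int.toNat_natCast]; exact t.isLt
  rw [dif_pos this]
  rfl

theorem runs_entryP {s : State} {o : ℤ} {ℓ b r : ℕ} (hℓ : ℓ ≤ Nat.clog 2 n)
    (h0 : s.ints o = ℓ) (h1 : s.ints (o + 1) = b) (h4 : s.ints (o + 4) = r)
    (hr : r < (table T ℓ b).length) :
    Runs (tableInput T i j o₀ q₀) (entryP o) s (entryP o).cost fun s' =>
      s'.reals o = (pairNormal p (table T ℓ b)[r]).1 ∧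
        s'.reals (o + 1) = (pairNormal p (table T ℓ b)[r]).2 ∧ s'.ints = s.ints := by
  refine Runs.of_run (by simp [entryP, Prog.LoopFree]) ?_
  have e : ∀ s' : State, s'.ints = s.ints →
      (IntExpr.extra (ic o) (ic (o + 1)) (oct (ic (o + 4)))).eval (tableInput T i j o₀ q₀) s' =
          (((table T ℓ b)[r].1.val : ℕ) : ℤ) ∧
      (IntExpr.extra (ic o) (ic (o + 1)) (.add (oct (ic (o + 4))) (.lit 1))).eval
          (tableInput T i j o₀ q₀) s' = (((table T ℓ b)[r].2.val : ℕ) : ℤ) := by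
    intro s' hs'
    rw [eval_extra (ℓ := ℓ) (c := b) (d := 8 * r + 0), eval_extra (ℓ := ℓ) (c := b) (d := 8 * r + 1),
      tableWord_eq T hℓ hr.le (by norm_num), tableWord_eq T hℓ hr.le (by norm_num)]
    · simp [tableField, hr]
    all_goals simp [eval_ic, eval_oct, IntExpr.eval, hs', h0, h1, h4]
  simp only [entryP, Prog.run, RealExpr.eval, IntExpr.eval]
  have e1 := e s rfl
  have e2 := e ⟨s.ints, Function.update s.reals o
      (((tableInput T i j o₀ q₀).pointAt ((table T ℓ b)[r].1.val : ℕ)).2 -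
        ((tableInput T i j o₀ q₀).pointAt ((table T ℓ b)[r].2.val : ℕ)).2)⟩ rfl
  simp only [IntExpr.eval] at e1 e2
  simp only [e1]
  simp only [e2]
  simp [pointAt_val, pairNormal, edgeNormal]

variable {o : ℤ} {tst act : Prog} {τ τ' : ℕ} {pr : ℝ → Prop} {L : ℕ}
  {J : Set (ℕ × ℕ) → State → Prop}

/-- The rank stays between the two bounds, and the range is at least halved. The cost with `.skip`
in place of the test counts everything but the test, which is charged separately as `τ`. -/
theorem runs_probeP (hW : Walkable T i j (tableInput T i j o₀ q₀) o tst act τ τ' pr L J)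
    {V : Set (ℕ × ℕ)} {s : State} {ℓ b lo hi : ℕ} (hℓ : ℓ ≤ Nat.clog 2 n)
    (hJ : J V s) (h0 : s.ints o = ℓ) (h1 : s.ints (o + 1) = b) (h2 : s.ints (o + 2) = lo)
    (h3 : s.ints (o + 3) = hi) (hlt : lo < hi) (hhi : hi ≤ (table T ℓ b).length)
    (hlr : lo ≤ rank (pairKey p) pr (table T ℓ b)) (hrh : rank (pairKey p) pr (table T ℓ b) ≤ hi) :
    Runs (tableInput T i j o₀ q₀) (probeP o tst) s ((probeP o .skip).cost + τ) fun s' =>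
      J V s' ∧ s'.ints o = ℓ ∧ s'.ints (o + 1) = b ∧ s'.ints (o + 6) = s.ints (o + 6) ∧
        ∃ lo' hi' : ℕ, s'.ints (o + 2) = lo' ∧ s'.ints (o + 3) = hi' ∧
          lo' ≤ rank (pairKey p) pr (table T ℓ b) ∧ rank (pairKey p) pr (table T ℓ b) ≤ hi' ∧
          hi' ≤ (table T ℓ b).length ∧ 2 * (hi' - lo') ≤ hi - lo := by
  have hmid : (lo + hi) / 2 < (table T ℓ b).length := by omega
  have step1 : Runs (tableInput T i j o₀ q₀)
      (.setInt (.lit (o + 4)) (.half (.add (ic (o + 2)) (ic (o + 3))))) s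
      (Prog.setInt (.lit (o + 4)) (.half (.add (ic (o + 2)) (ic (o + 3))))).cost
      fun s' => s'.ints (o + 4) = ((lo + hi) / 2 : ℕ) ∧ ∀ a, a ≠ o + 4 → s'.ints a = s.ints a := by
    refine Runs.of_run trivial ?_
    simp only [Prog.run, IntExpr.eval, eval_ic, h2, h3]
    exact ⟨by simp, fun a ha => Function.update_of_ne ha ..⟩
  have step1' := step1.agree (A := WalkCell o) (by simp [Prog.Within, WalkCell])
  refine (Runs.seq step1' fun s₁ ⟨⟨a1, a2⟩, a3⟩ => Runs.seq
    ((runs_entryP hℓ (by rw [a2 _ (by omega), h0]) (by rw [a2 _ (by omega), h1]) a1 hmid).agree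
      (A := WalkCell o) (by simp [entryP, Prog.Within, WalkCell])) fun s₂ ⟨⟨b1, b2, b3⟩, b4⟩ =>
    Runs.seq (hW.probe V s₂ _ (hW.stable V s s₂ hJ (a3.trans b4))
      (pairNormal_ne_zero T hℓ (List.getElem_mem hmid)) b1 b2) fun s₃ ⟨c1, c2, c3⟩ =>
    Runs.mono (Runs.agree (A := WalkCell o) (Runs.of_run (P := .cond _ (.setInt _ _) (.setInt _ _))
      (Q := fun s' => s' = Prog.run (tableInput T i j o₀ q₀) _ s₃) ⟨trivial, trivial⟩ rfl)
      (by simp [Prog.Within, WalkCell])) le_rfl ?_).mono ?_ fun s' h => h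
  · rintro s₄ ⟨rfl, d⟩
    have hd := hW.stable V _ _ c1 d
    have old : ∀ a, WalkCell o a → a ≠ o + 4 → a ≠ o + 5 → s₃.ints a = s.ints a :=
      fun a ha ha4 ha5 => by rw [c3 a ha ha5, b3, a2 a ha4]
    have m4 : s₃.ints (o + 4) = ((lo + hi) / 2 : ℕ) := by
      rw [c3 _ (by unfold WalkCell; omega) (by omega), b3, a1]
    have m0 := old o (by unfold WalkCell; omega) (by omega) (by omega)
    have m1 := old (o + 1) (by unfold WalkCell; omega) (by omega) (by omega)
    have m2 := old (o + 2) (by unfold WalkCell; omega) (by omega) (by omega)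
    have m3 := old (o + 3) (by unfold WalkCell; omega) (by omega) (by omega)
    have m6 := old (o + 6) (by unfold WalkCell; omega) (by omega) (by omega)
    have hrk := lt_rank_iff hW.down (pairwise_table T ℓ b) hmid
    refine ⟨hd, ?_⟩
    rcases c2 with ⟨e5, hp⟩ | ⟨e5, hp⟩
    · have := hrk.2 hp
      simp only [Prog.run, Test.Holds, IntExpr.eval, eval_ic, e5, le_refl, if_true]
      refine ⟨by simp [m0, h0], by simp [m1, h1], by simp [m6], (lo + hi) / 2 + 1, hi,
        by simp [m4], by simp [m3, h3], by omega, hrh, hhi, by omega⟩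
    · have : ¬ (lo + hi) / 2 < rank (pairKey p) pr (table T ℓ b) := fun h => hp (hrk.1 h)
      simp only [Prog.run, Test.Holds, IntExpr.eval, eval_ic, e5,
        show ¬ ((1 : ℤ) ≤ 0) by norm_num, if_false]
      refine ⟨by simp [m0, h0], by simp [m1, h1], by simp [m6], lo, (lo + hi) / 2,
        by simp [m2, h2], by simp [m4], hlr, by omega, by omega, by omega⟩
  · simp only [probeP, Prog.cost]
    omega

theorem runs_searchP (hW : Walkable T i j (tableInput T i j o₀ q₀) o tst act τ τ' pr L J)
    {V : Set (ℕ × ℕ)} {s : State} {ℓ b lo hi : ℕ} (k : ℕ) (hℓ : ℓ ≤ Nat.clog 2 n)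
    (hJ : J V s) (h0 : s.ints o = ℓ) (h1 : s.ints (o + 1) = b) (h2 : s.ints (o + 2) = lo)
    (h3 : s.ints (o + 3) = hi) (hhi : hi ≤ (table T ℓ b).length)
    (hlr : lo ≤ rank (pairKey p) pr (table T ℓ b)) (hrh : rank (pairKey p) pr (table T ℓ b) ≤ hi)
    (hk : hi - lo < 2 ^ k) :
    Runs (tableInput T i j o₀ q₀) (searchP o tst) s
      ((k + 1) * ((probeP o .skip).cost + τ + 8)) fun s' =>
      J V s' ∧ s'.ints o = ℓ ∧ s'.ints (o + 1) = b ∧ s'.ints (o + 6) = s.ints (o + 6) ∧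
        s'.ints (o + 2) = rank (pairKey p) pr (table T ℓ b) := by
  have key := Runs.loop (x := tableInput T i j o₀ q₀) (P := probeP o tst)
    (c := .neg (.intLe (ic (o + 3)) (ic (o + 2)))) (s := s)
    (Q := fun s' => J V s' ∧ s'.ints o = ℓ ∧ s'.ints (o + 1) = b ∧
      s'.ints (o + 6) = s.ints (o + 6) ∧ s'.ints (o + 2) = rank (pairKey p) pr (table T ℓ b))
    (f := fun _ => (probeP o .skip).cost + τ)
    (Inv := fun k s' => J V s' ∧ s'.ints o = ℓ ∧ s'.ints (o + 1) = b ∧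
      s'.ints (o + 6) = s.ints (o + 6) ∧ ∃ lo' hi' : ℕ, s'.ints (o + 2) = lo' ∧
        s'.ints (o + 3) = hi' ∧ lo' ≤ rank (pairKey p) pr (table T ℓ b) ∧
        rank (pairKey p) pr (table T ℓ b) ≤ hi' ∧ hi' ≤ (table T ℓ b).length ∧
        hi' - lo' < 2 ^ k) ?_ ?_ k
    ⟨hJ, h0, h1, rfl, lo, hi, h2, h3, hlr, hrh, hhi, hk⟩
  · refine key.mono ?_ fun s' h => h
    rw [Finset.sum_const, Finset.card_range, smul_eq_mul]
    simp only [Test.cost, ic, IntExpr.cost]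
    ring_nf
    omega
  · rintro k s₁ ⟨g, g0, g1, g6, lo', hi', g2, g3, g4, g5, g7, g8⟩ hc
    simp only [Test.Holds, eval_ic, g2, g3] at hc
    have hlt : lo' < hi' := by omega
    rcases k with _ | k
    · rw [pow_zero] at g8; omega
    · refine ⟨k, rfl, (runs_probeP hW hℓ g g0 g1 g2 g3 hlt g7 g4 g5).mono le_rfl ?_⟩
      rintro s₂ ⟨f, f0, f1, f6, lo'', hi'', f2, f3, f4, f5, f7, f8⟩
      rw [pow_succ] at g8
      exact ⟨f, f0, f1, f6.trans g6, lo'', hi'', f2, f3, f4, f5, f7, by omega⟩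
  · rintro k s₁ ⟨g, g0, g1, g6, lo', hi', g2, g3, g4, g5, g7, g8⟩ hc
    simp only [Test.Holds, eval_ic, g2, g3, not_not] at hc
    exact ⟨g, g0, g1, g6, by rw [g2]; omega⟩

/-- Below the top level the cell `o + 6` holds the rank at the parent; its link is the rank here or
one less, so the upper bound exceeds the lower by at most one. At the top level nothing is known and
the whole table is the range. -/
theorem runs_rangeP (hW : Walkable T i j (tableInput T i j o₀ q₀) o tst act τ τ' pr L J)
    {V : Set (ℕ × ℕ)} {s : State} {ℓ b : ℕ} (hL : L ≤ Nat.clog 2 n) (hℓL : ℓ ≤ L)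
    (ho : 6 < o)
    (hJ : J V s) (h0 : s.ints o = ℓ) (h1 : s.ints (o + 1) = b)
    (h6 : ℓ < L → s.ints (o + 6) = rank (pairKey p) pr (table T (ℓ + 1) (b / 2))) :
    Runs (tableInput T i j o₀ q₀) (rangeP o) s (rangeP o).cost fun s' =>
      J V s' ∧ s'.ints o = ℓ ∧ s'.ints (o + 1) = b ∧ s'.ints (o + 6) = s.ints (o + 6) ∧
        ∃ lo hi : ℕ, s'.ints (o + 2) = lo ∧ s'.ints (o + 3) = hi ∧
          lo ≤ rank (pairKey p) pr (table T ℓ b) ∧ rank (pairKey p) pr (table T ℓ b) ≤ hi ∧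
          hi ≤ (table T ℓ b).length ∧ (ℓ < L → hi - lo < 2) := by
  have hlen := rank_le_length (κ := pairKey p) pr (table T ℓ b)
  have hA := (hW.arrays V s hJ).1
  have hfree : (rangeP o).LoopFree := by simp [rangeP, Prog.LoopFree]
  have hwith : (rangeP o).Within (WalkCell o) := by simp [rangeP, Prog.Within, WalkCell]
  refine ((Runs.of_run (Q := fun s' => s' = (rangeP o).run (tableInput T i j o₀ q₀) s) hfree
    rfl).agree hwith).mono le_rfl ?_
  rintro s' ⟨hs', hag⟩
  refine ⟨hW.stable V s s' hJ hag, ?_⟩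
  -- The record with number `0` exists even for an empty table, so the length can always be read
  -- there.
  have w5 : tableWord T ℓ b 5 = (table T ℓ b).length := by
    rw [show 5 = 8 * 0 + 5 by norm_num, tableWord_eq T (by omega) (Nat.zero_le _) (by norm_num)]
    cases ℓ <;> rfl
  have n6o : (6 : ℤ) ≠ o + 2 := by omega
  have n6o' : (6 : ℤ) ≠ o + 3 := by omega
  by_cases hlt : ℓ < L
  · have g6 := h6 hlt
    set c := rank (pairKey p) pr (table T (ℓ + 1) (b / 2)) with hc
    have wl : tableWord T (ℓ + 1) (b / 2) (8 * c + (3 + b % 2)) =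
        link (pairKey p) (table T (ℓ + 1) (b / 2)) (table T ℓ b) c :=
      tableWord_child T (by omega) (rank_le_length _ _) rfl
    have l1 := link_le_rank (κ := pairKey p) hW.down (pairwise_table T (ℓ + 1) (b / 2))
      (l := table T ℓ b)
    have l2 := rank_le_link_add_one (κ := pairKey p) hW.down (pairwise_table T (ℓ + 1) (b / 2))
      (pairwise_table T ℓ b) fun a ha => oddPositions_subset_table T rfl ha
    rw [← hc] at l1 l2
    set r := link (pairKey p) (table T (ℓ + 1) (b / 2)) (table T ℓ b) c with hr
    have t1 : ((ℓ : ℤ) + 1).toNat = ℓ + 1 := by omega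
    have t2 : ((b : ℤ) / 2).toNat = b / 2 := by omega
    have t3 : (8 * (c : ℤ) + (3 + ((b : ℤ) - 2 * (b / 2)))).toNat = 8 * c + (3 + b % 2) := by omega
    have t4 : (ℓ : ℤ) + 1 ≤ L := by omega
    have x1 : (tableInput T i j o₀ q₀).extra = tableWord T := rfl
    have t5 : (5 : ℤ).toNat = 5 := rfl
    simp only [rangeP, Prog.run, Test.Holds, IntExpr.eval, eval_ic, eval_oct, eval_dbl, x1,
      Function.update_of_ne, Function.update_self, ne_eq, n6o, n6o', not_false_eq_true, hA, h0, h1,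
      g6, t1, t2, t3, t4, t5, wl, w5, Int.toNat_natCast, if_true, add_right_inj, left_eq_add,
      show ¬ ((1 : ℤ) = 2) by norm_num, show ¬ ((1 : ℤ) = 3) by norm_num,
      show ¬ ((6 : ℤ) = 2) by norm_num, show ¬ ((6 : ℤ) = 3) by norm_num,
      show ¬ ((3 : ℤ) = 2) by norm_num, show ¬ ((2 : ℤ) = 0) by norm_num,
      show ¬ ((3 : ℤ) = 0) by norm_num] at hs'
    split_ifs at hs' with h5
    · subst hs'
      refine ⟨by simp [h0], by simp [h1], by simp, r, r + 1, by simp, by simp, l1, l2, by omega,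
        by omega⟩
    · subst hs'
      refine ⟨by simp [h0], by simp [h1], by simp, r, (table T ℓ b).length, by simp, by simp, l1,
        by omega, le_rfl, by omega⟩
  · have t4 : ¬ (ℓ : ℤ) + 1 ≤ L := by omega
    have x1 : (tableInput T i j o₀ q₀).extra = tableWord T := rfl
    have t5 : (5 : ℤ).toNat = 5 := rfl
    simp only [rangeP, Prog.run, Test.Holds, IntExpr.eval, eval_ic, x1,
      Function.update_of_ne, ne_eq, n6o, n6o', not_false_eq_true, hA, h0, h1,
      t4, t5, w5, Int.toNat_natCast, if_false, add_right_inj,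
      left_eq_add, show ¬ ((1 : ℤ) = 2) by norm_num, show ¬ ((1 : ℤ) = 3) by norm_num,
      show ¬ ((2 : ℤ) = 0) by norm_num,
      show ¬ ((3 : ℤ) = 0) by norm_num] at hs'
    subst hs'
    refine ⟨by simp [h0], by simp [h1], by simp, 0, (table T ℓ b).length, by simp, by simp,
      Nat.zero_le _, hlen, le_rfl, fun h => absurd h hlt⟩

end Walk

end WindowedHull

/-! ### Locating ranks at single nodes, and the complete walk. -/

namespace WindowedHull

open Code

section Walk

variable {n : ℕ} {p : Fin n → Pt} {T : DecompTree p} {i j : ℕ} {o₀ q₀ : Pt}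
  {o : ℤ} {tst act : Prog} {τ τ' : ℕ} {pr : ℝ → Prop} {L : ℕ}
  {J : Set (ℕ × ℕ) → State → Prop}

/-- A bound on the number of rounds of the binary search at the level `ℓ`. -/
def searchRounds (L ℓ : ℕ) : ℕ := if ℓ < L then 1 else L + 2

theorem runs_locateP (hW : Walkable T i j (tableInput T i j o₀ q₀) o tst act τ τ' pr L J)
    {V : Set (ℕ × ℕ)} {s : State} {ℓ b : ℕ} (hL : L ≤ Nat.clog 2 n) (hℓL : ℓ ≤ L)
    (ho : 6 < o) (hJ : J V s) (h0 : s.ints o = ℓ) (h1 : s.ints (o + 1) = b)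
    (h6 : ℓ < L → s.ints (o + 6) = rank (pairKey p) pr (table T (ℓ + 1) (b / 2))) :
    Runs (tableInput T i j o₀ q₀) (locateP o tst) s
      ((searchRounds L ℓ + 1) * ((rangeP o).cost + (probeP o .skip).cost + τ + 8)) fun s' =>
      J V s' ∧ s'.ints o = ℓ ∧ s'.ints (o + 1) = b ∧ s'.ints (o + 6) = s.ints (o + 6) ∧
        s'.ints (o + 2) = rank (pairKey p) pr (table T ℓ b) := by
  refine (Runs.seq (runs_rangeP hW hL hℓL ho hJ h0 h1 h6)
    fun s₁ ⟨a, a0, a1, a6, lo, hi, a2, a3, a4, a5, a7, a8⟩ =>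
    (runs_searchP hW (searchRounds L ℓ) (hℓL.trans hL) a a0 a1 a2 a3 a7 a4 a5 ?_).mono le_rfl
      fun s₂ ⟨b, b0, b1, b6, b2⟩ => ⟨b, b0, b1, b6.trans a6, b2⟩).mono ?_ fun s' h => h
  · rw [searchRounds]
    split_ifs with h
    · exact a8 h
    -- The table at the top has at most `2 * 2 ^ L` entries, fewer than `2 ^ (L + 2)`, whence the `L
    -- + 2` rounds.
    · have e : ℓ = L := by omega
      have h1 := length_table_le T (b := b) (hℓL.trans hL)
      have h2 := card_canonicalSubset_le n ℓ b
      rw [pow_succ, pow_succ, ← e]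
      have : 0 < 2 ^ ℓ := by positivity
      omega
  · have := Nat.le_mul_of_pos_left (rangeP o).cost (Nat.succ_pos (searchRounds L ℓ))
    rw [Nat.succ_eq_add_one] at this
    nlinarith

theorem exists_eq_sibling (P : ℕ) : ∃ b : ℕ, (b : ℤ) = sibling P ∧ b / 2 = P / 2 := by
  rcases Nat.mod_two_eq_zero_or_one P with h | h
  · exact ⟨P + 1, by rw [sibling]; omega, by omega⟩
  · exact ⟨P - 1, by rw [sibling]; omega, by omega⟩

theorem runs_setInt {x : Input} {s : State} (a : ℤ) (v : IntExpr) :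
    Runs x (.setInt (.lit a) v) s (v.cost + 2) fun s' =>
      s'.ints a = v.eval x s ∧ (∀ c, c ≠ a → s'.ints c = s.ints c) ∧
        AgreeOff (fun c => c = a) s s' := by
  refine ((Runs.of_run (P := .setInt (.lit a) v) (x := x) (s := s)
    (Q := fun s' => s'.ints a = v.eval x s ∧ (∀ c, c ≠ a → s'.ints c = s.ints c)) trivial
    ⟨Function.update_self .., fun c hc => Function.update_of_ne hc ..⟩).agree
      (A := fun c => c = a) rfl).mono ?_ fun s' h => ⟨h.1.1, h.1.2, h.2⟩
  simp only [Prog.cost, IntExpr.cost]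
  omega

/-- A sibling of a path node belongs to the cover exactly when it lies strictly between the two
boundary blocks, which two comparisons decide. The set of treated nodes grows only in that case. -/
theorem runs_visitP (hW : Walkable T i j (tableInput T i j o₀ q₀) o tst act τ τ' pr L J)
    {V : Set (ℕ × ℕ)} {s : State} {ℓ b : ℕ} (hL : L ≤ Nat.clog 2 n) (hℓL : ℓ ≤ L)
    (hb : (b : ℤ) = sibling (blockBefore i ℓ) ∨ (b : ℤ) = sibling (blockAfter j ℓ))
    (hJ : J V s) (h0 : s.ints o = ℓ) (h1 : s.ints (o + 1) = b)
    (h2 : s.ints (o + 2) = rank (pairKey p) pr (table T ℓ b)) :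
    Runs (tableInput T i j o₀ q₀) (visitP o act) s ((visitP o .skip).cost + τ') fun s' =>
      s'.ints o = ℓ ∧ s'.ints (o + 6) = s.ints (o + 6) ∧ ∃ V', V ⊆ V' ∧
        (blockBefore i ℓ < b → b < blockAfter j ℓ → (ℓ, b) ∈ V') ∧ J V' s' := by
  have hlev := hℓL.trans hL
  have hA := hW.arrays V s hJ
  have stay : ¬ (blockBefore i ℓ < b ∧ (b : ℤ) < blockAfter j ℓ) →
      s.ints o = ℓ ∧ s.ints (o + 6) = s.ints (o + 6) ∧ ∃ V', V ⊆ V' ∧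
        (blockBefore i ℓ < b → b < blockAfter j ℓ → (ℓ, b) ∈ V') ∧ J V' s := fun hno =>
    ⟨h0, rfl, V, subset_rfl, fun h1 h2 => absurd ⟨h1, h2⟩ hno, hJ⟩
  have ebef : (beforeE (ic o)).eval (tableInput T i j o₀ q₀) s = blockBefore i ℓ := by
    simp only [beforeE, IntExpr.eval, eval_ic, h0]
    exact (hA.2 ℓ hℓL).1
  have eaft : (afterE (ic o)).eval (tableInput T i j o₀ q₀) s = blockAfter j ℓ := by
    simp only [afterE, IntExpr.eval, eval_ic, h0]
    exact (hA.2 ℓ hℓL).2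
  refine Runs.mono (t := (Test.intLe (.add (beforeE (ic o)) (.lit 1)) (ic (o + 1))).cost +
    ((Test.intLe (.add (ic (o + 1)) (.lit 1)) (afterE (ic o))).cost +
      ((IntExpr.extra (ic o) (ic (o + 1)) (.add (oct (ic (o + 2))) (.lit 2))).cost + 2 + τ')))
    (Runs.cond (fun hc1 => Runs.cond (fun hc2 => ?_) fun hc2 => ?_) fun hc1 => ?_) ?_
    fun s' h => h
  · simp only [Test.Holds, IntExpr.eval, eval_ic, ebef, eaft, h1] at hc1 hc2
    have hcov : InCover i j ℓ b := inCover_iff.2 ⟨⟨by omega, by omega⟩, hb⟩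
    have wf : tableWord T ℓ b (8 * rank (pairKey p) pr (table T ℓ b) + 2) =
        rank (pairKey p) pr (facetPairs (T.hull ℓ b)) := by
      rw [tableWord_eq T hlev (rank_le_length _ _) (by norm_num), tableField,
        link_eq_rank hW.down (pairwise_table T ℓ b) fun a ha => facetPairs_subset_table T ha]
    refine Runs.seq (Q' := fun s₃ => s₃.ints (o + 7) =
      rank (pairKey p) pr (facetPairs (T.hull ℓ b)) ∧ (∀ c, c ≠ o + 7 → s₃.ints c = s.ints c) ∧
        AgreeOff (fun c => c = o + 7) s s₃) ?_ fun s₃ ⟨d1, d2, d3⟩ =>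
      (hW.visit V s₃ ℓ b (hW.stable V s s₃ hJ (d3.mono fun c hc => by unfold WalkCell; omega))
        hcov (by rw [d2 _ (by omega), h0]) (by rw [d2 _ (by omega), h1]) d1).mono le_rfl
        fun s₄ ⟨e1, e2⟩ => ?_
    · refine (runs_setInt (o + 7) _).mono le_rfl fun s₃ ⟨d1, d2, d3⟩ => ⟨?_, d2, d3⟩
      rw [d1, eval_extra (ℓ := ℓ) (c := b) (d := 8 * rank (pairKey p) pr (table T ℓ b) + 2), wf]
      · rw [eval_ic, h0]
      · rw [eval_ic, h1]
      · simp [IntExpr.eval, eval_oct, eval_ic, h2]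
    · refine ⟨?_, ?_, insert (ℓ, b) V, Set.subset_insert _ _, fun _ _ => Set.mem_insert _ _, e1⟩
      · rw [e2 _ (by unfold WalkCell; omega), d2 _ (by omega), h0]
      · rw [e2 _ (by unfold WalkCell; omega), d2 _ (by omega)]
  · refine (Runs.skip (stay ?_)).mono (by omega) fun s' h => h
    simp only [Test.Holds, IntExpr.eval, eval_ic, ebef, eaft, h1] at hc1 hc2
    omega
  · refine (Runs.skip (stay ?_)).mono (by omega) fun s' h => h
    simp only [Test.Holds, IntExpr.eval, eval_ic, ebef, h1] at hc1
    omega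
  · simp only [visitP, Prog.cost, Test.cost, IntExpr.cost]
    omega

/-- The sibling has the same parent as the path node, so the rank kept for the parent serves for
both. -/
theorem runs_siblingP (hW : Walkable T i j (tableInput T i j o₀ q₀) o tst act τ τ' pr L J)
    {arr : IntExpr → IntExpr} {X : ℕ}
    (harr : ∀ s, Arrays i j L s → ∀ ℓ ≤ L, s.ints o = ℓ →
      (arr (ic o)).eval (tableInput T i j o₀ q₀) s = (X / 2 ^ ℓ : ℕ))
    (hside : ∀ ℓ ≤ L, ((X / 2 ^ ℓ : ℕ) : ℤ) = blockBefore i ℓ ∨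
      ((X / 2 ^ ℓ : ℕ) : ℤ) = blockAfter j ℓ)
    {V : Set (ℕ × ℕ)} {s : State} {ℓ : ℕ} (hL : L ≤ Nat.clog 2 n) (hℓL : ℓ ≤ L)
    (ho : 6 < o) (hJ : J V s) (h0 : s.ints o = ℓ)
    (h6 : ℓ < L → s.ints (o + 6) = rank (pairKey p) pr (table T (ℓ + 1) (X / 2 ^ (ℓ + 1)))) :
    Runs (tableInput T i j o₀ q₀) (siblingP o arr tst act) s
      ((siblingE (arr (ic o))).cost + 2 +
        ((searchRounds L ℓ + 1) * ((rangeP o).cost + (probeP o .skip).cost + τ + 8) +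
          ((visitP o .skip).cost + τ'))) fun s' =>
      s'.ints o = ℓ ∧ s'.ints (o + 6) = s.ints (o + 6) ∧ ∃ V', V ⊆ V' ∧
        (∀ b : ℕ, (b : ℤ) = sibling (X / 2 ^ ℓ : ℕ) → blockBefore i ℓ < b → b < blockAfter j ℓ →
          (ℓ, b) ∈ V') ∧ J V' s' := by
  obtain ⟨b, hb, hb'⟩ := exists_eq_sibling (X / 2 ^ ℓ)
  have hb'' : b / 2 = X / 2 ^ (ℓ + 1) := by
    rw [hb', Nat.div_div_eq_div_mul, pow_succ]
  have hA := hW.arrays V s hJ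
  have heval : (siblingE (arr (ic o))).eval (tableInput T i j o₀ q₀) s = b := by
    rw [hb, sibling]
    simp only [siblingE, IntExpr.eval, eval_dbl, harr s hA ℓ hℓL h0]
    ring
  refine Runs.seq (runs_setInt (o + 1) _) fun s₁ ⟨a1, a2, a3⟩ => Runs.seq
    (runs_locateP hW (V := V) (s := s₁) hL hℓL ho (hW.stable V s s₁ hJ
      (a3.mono fun c hc => by unfold WalkCell; omega)) (by rw [a2 _ (by omega), h0])
      (a1.trans heval) (fun h => by rw [a2 _ (by omega), h6 h, hb'']))
    fun s₂ ⟨b0, b1, b2, b3, b4⟩ => (runs_visitP hW hL hℓL ?_ b0 b1 b2 b4).mono le_rfl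
      fun s₃ ⟨c1, c2, V', c3, c4, c5⟩ => ⟨c1, ?_, V', c3, fun c hc => ?_, c5⟩
  · rcases hside ℓ hℓL with h | h
    · exact Or.inl (by rw [← h, hb])
    · exact Or.inr (by rw [← h, hb])
  · rw [c2, b3, a2 _ (by omega)]
  · have : c = b := by exact_mod_cast hc.trans hb.symm
    subst this
    exact c4

theorem runs_descendP (hW : Walkable T i j (tableInput T i j o₀ q₀) o tst act τ τ' pr L J)
    {arr : IntExpr → IntExpr} {X : ℕ}
    (harr : ∀ s, Arrays i j L s → ∀ ℓ ≤ L, s.ints o = ℓ →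
      (arr (ic o)).eval (tableInput T i j o₀ q₀) s = (X / 2 ^ ℓ : ℕ))
    {V : Set (ℕ × ℕ)} {s : State} {ℓ : ℕ} (hL : L ≤ Nat.clog 2 n) (hℓL : ℓ ≤ L)
    (ho : 6 < o) (hJ : J V s) (h0 : s.ints o = ℓ)
    (h6 : ℓ < L → s.ints (o + 6) = rank (pairKey p) pr (table T (ℓ + 1) (X / 2 ^ (ℓ + 1)))) :
    Runs (tableInput T i j o₀ q₀) (descendP o arr tst) s
      ((arr (ic o)).cost + 2 +
        ((searchRounds L ℓ + 1) * ((rangeP o).cost + (probeP o .skip).cost + τ + 8) + 11)) fun s' =>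
      s'.ints o = (ℓ : ℤ) - 1 ∧
        s'.ints (o + 6) = rank (pairKey p) pr (table T ℓ (X / 2 ^ ℓ)) ∧ J V s' := by
  have hA := hW.arrays V s hJ
  refine Runs.seq (runs_setInt (o + 1) _) fun s₁ ⟨a1, a2, a3⟩ => Runs.seq
    (runs_locateP hW (V := V) (s := s₁) (b := X / 2 ^ ℓ) hL hℓL ho (hW.stable V s s₁ hJ
      (a3.mono fun c hc => by unfold WalkCell; omega)) (by rw [a2 _ (by omega), h0])
      (a1.trans (harr s hA ℓ hℓL h0)) (fun h => by
        rw [a2 _ (by omega), h6 h, Nat.div_div_eq_div_mul, pow_succ]))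
    fun s₂ ⟨b0, b1, b2, b3, b4⟩ => (Runs.seq (runs_setInt (o + 6) _) fun s₃ ⟨c1, c2, c3⟩ =>
      (runs_setInt o _).mono le_rfl fun s₄ ⟨d1, d2, d3⟩ => ?_).mono ?_ fun s' h => h
  · simp only [ic, IntExpr.cost]
    omega
  · refine ⟨?_, ?_, hW.stable V s₂ s₄ b0 ((c3.mono fun c hc => ?_).trans (d3.mono fun c hc => ?_))⟩
    · rw [d1]
      simp only [IntExpr.eval, eval_ic]
      rw [c2 _ (by omega), b1]
    · rw [d2 _ (by omega), c1, eval_ic, b4]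
    · unfold WalkCell; omega
    · unfold WalkCell; omega

/-- The cost of a round of a walk, up to the factor for the binary search. -/
def roundCost (o : ℤ) (arr : IntExpr → IntExpr) : ℕ :=
  2 * ((rangeP o).cost + (probeP o .skip).cost + 8) + (siblingE (arr (ic o))).cost +
    (visitP o .skip).cost + (arr (ic o)).cost + 20

/-- A walk treats all nodes of the canonical cover that are siblings of nodes on its path. -/
theorem runs_walkP (hW : Walkable T i j (tableInput T i j o₀ q₀) o tst act τ τ' pr L J)
    {arr : IntExpr → IntExpr} {X : ℕ}
    (harr : ∀ s, Arrays i j L s → ∀ ℓ ≤ L, s.ints o = ℓ →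
      (arr (ic o)).eval (tableInput T i j o₀ q₀) s = (X / 2 ^ ℓ : ℕ))
    (hside : ∀ ℓ ≤ L, ((X / 2 ^ ℓ : ℕ) : ℤ) = blockBefore i ℓ ∨
      ((X / 2 ^ ℓ : ℕ) : ℤ) = blockAfter j ℓ)
    {V : Set (ℕ × ℕ)} {s : State} (hL : L ≤ Nat.clog 2 n) (ho : 6 < o) (hJ : J V s) :
    Runs (tableInput T i j o₀ q₀) (walkP o arr tst act) s
      ((L + 1) * (3 * (roundCost o arr + 2 * τ + τ') + 12)) fun s' =>
      ∃ V', V ⊆ V' ∧ (∀ ℓ b : ℕ, ℓ ≤ L → (b : ℤ) = sibling (X / 2 ^ ℓ : ℕ) →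
        blockBefore i ℓ < b → b < blockAfter j ℓ → (ℓ, b) ∈ V') ∧ J V' s' := by
  set D := roundCost o arr + 2 * τ + τ' with hD
  -- The number `k` of rounds to come is one more than the level at hand, and all levels from `k`
  -- upwards are done. The cost of a round depends on its level, since only the level `L` needs full
  -- binary searches; this keeps the sum linear in `L`.
  refine (Runs.seq (runs_setInt o (ic 6)) fun s₁ ⟨a1, a2, a3⟩ => Runs.loop
    (Inv := fun k s' => s'.ints o = (k : ℤ) - 1 ∧ k ≤ L + 1 ∧
      (k ≤ L → s'.ints (o + 6) = rank (pairKey p) pr (table T k (X / 2 ^ k))) ∧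
      ∃ V', V ⊆ V' ∧ (∀ ℓ b : ℕ, k ≤ ℓ → ℓ ≤ L → (b : ℤ) = sibling (X / 2 ^ ℓ : ℕ) →
        blockBefore i ℓ < b → b < blockAfter j ℓ → (ℓ, b) ∈ V') ∧ J V' s')
    (f := fun k => (searchRounds L k + 1) * D) ?_ ?_ (L + 1) ?_).mono ?_ fun s' h => h
  · have h1 : ∀ k ∈ Finset.range L, (searchRounds L k + 1) * D +
        (Test.intLe (.lit 0) (ic o)).cost = 2 * D + 4 := fun k hk => by
      rw [searchRounds, if_pos (Finset.mem_range.1 hk)]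
      rfl
    rw [Finset.sum_range_succ, Finset.sum_congr rfl h1, Finset.sum_const, Finset.card_range,
      smul_eq_mul, searchRounds, if_neg (lt_irrefl L)]
    simp only [Test.cost, ic, IntExpr.cost]
    have e1 : (L + 1) * (3 * D + 12) = L * (2 * D) + L * D + 3 * D + L * 12 + 12 := by ring
    have e2 : L * (2 * D + 4) = L * (2 * D) + L * 4 := by ring
    have e3 : (L + 2 + 1) * D = L * D + 3 * D := by ring
    omega
  · rintro k s₂ ⟨b1, b2, b3, V', b4, b5, b6⟩ hc
    simp only [Test.Holds, IntExpr.eval, eval_ic, b1] at hc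
    rcases k with _ | ℓ
    · omega
    refine ⟨ℓ, rfl, ?_⟩
    have hℓL : ℓ ≤ L := by omega
    refine (Runs.seq (runs_siblingP hW harr hside hL hℓL ho b6 (by rw [b1]; push_cast; ring)
      fun h => b3 h) fun s₃ ⟨c1, c2, V'', c3, c4, c5⟩ =>
        (runs_descendP hW harr hL hℓL ho c5 c1 fun h => by rw [c2, b3 h]).mono le_rfl
        fun s₄ ⟨d1, d2, d3⟩ => ⟨d1, by omega, fun _ => d2, V'', b4.trans c3, ?_, d3⟩).mono ?_
        fun s' h => h
    · rw [hD, roundCost]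
      generalize (rangeP o).cost + (probeP o .skip).cost = c₁
      generalize (siblingE (arr (ic o))).cost = c₂
      generalize (visitP o .skip).cost = c₃
      generalize (arr (ic o)).cost = c₄
      generalize searchRounds L ℓ = r
      have h1 : (r + 1) * (2 * (c₁ + 8) + c₂ + c₃ + c₄ + 20 + 2 * τ + τ') =
          2 * ((r + 1) * (c₁ + τ + 8)) + (r + 1) * (c₂ + c₃ + c₄ + 20 + τ') := by ring
      have h2 := Nat.le_mul_of_pos_left (c₂ + c₃ + c₄ + 20 + τ') (Nat.succ_pos r)
      rw [Nat.succ_eq_add_one] at h2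
      omega
    · intro l b h1 h2 h3 h4 h5
      rcases h1.eq_or_lt with h6 | h6
      · subst h6; exact c4 b h3 h4 h5
      · exact c3 (b5 l b h6 h2 h3 h4 h5)
  · rintro k s₂ ⟨b1, b2, b3, V', b4, b5, b6⟩ hc
    simp only [Test.Holds, IntExpr.eval, eval_ic, b1] at hc
    exact ⟨V', b4, fun ℓ b h => b5 ℓ b (by omega) h, b6⟩
  · refine ⟨?_, le_rfl, fun h => absurd h (by omega), V, subset_rfl, fun ℓ b h1 h2 => ?_,
      hW.stable V s s₁ hJ (a3.mono fun c hc => by unfold WalkCell; omega)⟩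
    · rw [a1, eval_ic, (hW.arrays V s hJ).1]; push_cast; ring
    · omega

end Walk

end WindowedHull

/-! ### Preparing the two paths and treating the whole cover. -/

namespace WindowedHull

namespace Code

/-- Tabulate the blocks before and after the window, for all levels that the cover can have. -/
def setupP : Prog :=
  .seq (.setInt (.lit 6) (.lit 0))
    (.seq (.setInt (.lit 7) (.lit 1))
      (.seq (.setInt (.lit 100) (.sub .first (.lit 1)))
        (.seq (.setInt (.lit (-100)) (.add .last (.lit 1)))
          (.loop (.intLe (dbl (ic 7)) (.sub (.add .last (.lit 1)) .first))
            (.seq (.setInt (.lit 7) (dbl (ic 7)))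
              (.seq (.setInt (.add (.lit 101) (ic 6)) (.half (beforeE (ic 6))))
                (.seq (.setInt (.sub (.lit (-101)) (ic 6)) (.half (afterE (ic 6))))
                  (.setInt (.lit 6) (.add (ic 6) (.lit 1))))))))))

/-- Treat all nodes of the canonical cover. -/
def coverP (o : ℤ) (tst act : Prog) : Prog :=
  .seq (.cond (.intLe (.lit 1) .first) (walkP o beforeE tst act) .skip) (walkP o afterE tst act)

end Code

open Code

/-- A power of two is doubled while it stays at most `w`, which finds `log₂ w`; the boundary blocks
of the next level arise by halving. The two arrays grow away from each other, upwards from `100` and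
downwards from `-100`, and never reach each other or the working cells between them. -/
theorem runs_setupP {x : Input} (h : x.first ≤ x.last) (s : State) :
    Runs x setupP s (60 * (Nat.log 2 (x.last - x.first + 1) + 1))
      (Arrays x.first x.last (Nat.log 2 (x.last - x.first + 1))) := by
  set L := Nat.log 2 (x.last - x.first + 1) with hL
  refine Runs.mono (Runs.seq (runs_setInt 6 _) fun s₁ ⟨a1, a2, _⟩ => Runs.seq (runs_setInt 7 _)
    fun s₂ ⟨b1, b2, _⟩ => Runs.seq (runs_setInt 100 _) fun s₃ ⟨c1, c2, _⟩ =>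
    Runs.seq (runs_setInt (-100) _) fun s₄ ⟨d1, d2, _⟩ =>
    Runs.loop (f := fun _ => 40) (Inv := fun k s' => ∃ l, l + k = L ∧ s'.ints 7 = (2 ^ l : ℕ) ∧
      Arrays x.first x.last l s') ?_ ?_ L ?_) ?_ fun s' h => h
  · rintro k s' ⟨l, e1, e2, e3, e4⟩ hc
    simp only [Test.Holds, eval_dbl, eval_ic, IntExpr.eval, e2] at hc
    have hl : l + 1 ≤ L := by
      rw [hL]
      refine (Nat.le_log_iff_pow_le (by norm_num) (by omega)).2 ?_
      rw [pow_succ]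
      omega
    obtain ⟨k, rfl⟩ : ∃ k', k = k' + 1 := ⟨k - 1, by omega⟩
    refine ⟨k, rfl, (Runs.of_run (P := .seq _ (.seq _ (.seq _ _))) (by simp [Prog.LoopFree])
      (Q := fun s' => ∃ l, l + k = L ∧ s'.ints 7 = (2 ^ l : ℕ) ∧
        Arrays x.first x.last l s') ⟨l + 1, by omega, ?_, ?_, fun ℓ hℓ => ?_⟩).mono
      (by simp [Prog.cost, IntExpr.cost, ic, dbl, beforeE, afterE]) fun s' h => h⟩
    · have n1 : (7 : ℤ) ≠ 101 + l := by omega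
      have n2 : (7 : ℤ) ≠ -101 - l := by omega
      have n3 : (6 : ℤ) ≠ 101 + l := by omega
      simp only [Prog.run, IntExpr.eval, eval_dbl, eval_ic, e2, e3, Function.update_of_ne, ne_eq,
        n1, n2, n3, not_false_eq_true, Function.update_self, show ¬ ((6 : ℤ) = 7) by norm_num,
        show ¬ ((7 : ℤ) = 6) by norm_num]
      push_cast
      ring
    · have n1 : (6 : ℤ) ≠ 101 + l := by omega
      have n2 : (6 : ℤ) ≠ -101 - l := by omega
      simp [Prog.run, IntExpr.eval, eval_dbl, eval_ic, e3, n1, n2]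
    · have n1 : (6 : ℤ) ≠ 101 + l := by omega
      have n2 : (6 : ℤ) ≠ -101 - l := by omega
      have n3 : (7 : ℤ) ≠ 100 + l := by omega
      have n4 : (7 : ℤ) ≠ -100 - l := by omega
      have n5 : (100 + ℓ : ℤ) ≠ 6 := by omega
      have n6 : (100 + ℓ : ℤ) ≠ 7 := by omega
      have n7 : (-100 - ℓ : ℤ) ≠ 6 := by omega
      have n8 : (-100 - ℓ : ℤ) ≠ 7 := by omega
      have n9 : (100 + ℓ : ℤ) ≠ -101 - l := by omega
      have n10 : (-100 - ℓ : ℤ) ≠ 101 + l := by omega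
      have n11 : (-100 - l : ℤ) ≠ 101 + l := by omega
      simp only [Prog.run, IntExpr.eval, eval_dbl, eval_ic, beforeE, afterE, e3,
        Function.update_of_ne, ne_eq, n1, n2, n3.symm, n4.symm, n5, n7, n9, n11,
        not_false_eq_true, show ¬ ((6 : ℤ) = 7) by norm_num]
      rcases hℓ.eq_or_lt with rfl | h'
      · have m1 : (100 + (l + 1 : ℕ) : ℤ) = 101 + l := by push_cast; ring
        have m2 : (-100 - (l + 1 : ℕ) : ℤ) = -101 - l := by push_cast; ring
        rw [m1, m2, Function.update_self, Function.update_self, (e4 l le_rfl).1, (e4 l le_rfl).2,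
          blockBefore_succ, blockAfter_succ]
        exact ⟨rfl, rfl⟩
      · have m1 : (100 + ℓ : ℤ) ≠ 101 + l := by omega
        have m2 : (-100 - ℓ : ℤ) ≠ -101 - l := by omega
        rw [Function.update_of_ne m1, Function.update_of_ne n6, Function.update_of_ne m2,
          Function.update_of_ne n10, Function.update_of_ne n8]
        exact e4 ℓ (by omega)
  · rintro k s' ⟨l, e1, e2, e3⟩ hc
    simp only [Test.Holds, eval_dbl, eval_ic, IntExpr.eval, e2] at hc
    have : L < l + 1 := by
      rw [hL]
      refine Nat.log_lt_of_lt_pow (by omega) ?_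
      rw [pow_succ]
      omega
    obtain rfl : l = L := by omega
    exact e3
  · refine ⟨0, by omega, ?_, ?_, fun ℓ hℓ => ?_⟩
    · rw [d2 _ (by norm_num), c2 _ (by norm_num), b1]; rfl
    · rw [d2 _ (by norm_num), c2 _ (by norm_num), b2 _ (by norm_num), a1]; rfl
    · obtain rfl : ℓ = 0 := by omega
      have m1 : (100 + (0 : ℕ) : ℤ) = 100 := rfl
      have m2 : (-100 - (0 : ℕ) : ℤ) = -100 := rfl
      rw [m1, m2, d1, d2 _ (by norm_num), c1]
      simp [blockBefore, blockAfter, IntExpr.eval]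
  · simp only [Finset.sum_const, Finset.card_range, smul_eq_mul, Test.cost, IntExpr.cost, ic, dbl]
    omega

theorem runs_coverP {n : ℕ} {p : Fin n → Pt} {T : DecompTree p} {i j : ℕ} {o₀ q₀ : Pt}
    {o : ℤ} {tst act : Prog} {τ τ' : ℕ} {pr : ℝ → Prop} {L : ℕ} {J : Set (ℕ × ℕ) → State → Prop}
    (hW : Walkable T i j (tableInput T i j o₀ q₀) o tst act τ τ' pr L J)
    (hL : L = Nat.log 2 (j - i + 1)) (hij : i ≤ j) (hj : j < n)
    {V : Set (ℕ × ℕ)} {s : State} (ho : 6 < o) (hJ : J V s) :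
    Runs (tableInput T i j o₀ q₀) (coverP o tst act) s
      ((L + 1) * (3 * (roundCost o beforeE + roundCost o afterE) + 6 * (2 * τ + τ') + 29)) fun s' =>
      ∃ V', (∀ ℓ b, InCover i j ℓ b → (ℓ, b) ∈ V') ∧ J V' s' := by
  have hLn : L ≤ Nat.clog 2 n := hL ▸ log_window_le_clog hij hj
  have cast : ∀ X ℓ : ℕ, ((X / 2 ^ ℓ : ℕ) : ℤ) = (X : ℤ) / 2 ^ ℓ := fun X ℓ => by push_cast; rfl
  have hbef : 1 ≤ i → ∀ ℓ, (((i - 1) / 2 ^ ℓ : ℕ) : ℤ) = blockBefore i ℓ := fun hi ℓ => by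
    rw [cast, blockBefore]; congr 1; omega
  have haft : ∀ ℓ, (((j + 1) / 2 ^ ℓ : ℕ) : ℤ) = blockAfter j ℓ := fun ℓ => by
    rw [cast, blockAfter]; congr 1
  refine Runs.mono (Runs.seq (Q' := fun s' => ∃ V', (1 ≤ i → ∀ ℓ b : ℕ, ℓ ≤ L →
      (b : ℤ) = sibling (blockBefore i ℓ) → blockBefore i ℓ < b → b < blockAfter j ℓ →
        (ℓ, b) ∈ V') ∧ J V' s')
    (Runs.cond (t := (L + 1) * (3 * (roundCost o beforeE + 2 * τ + τ') + 12)) (fun hc => ?_)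
      fun hc => ?_) fun s₁ ⟨V', h1, h2⟩ => (runs_walkP hW (arr := afterE) (X := j + 1) ?_ ?_ hLn ho
      h2).mono le_rfl fun s₂ ⟨V'', h3, h4, h5⟩ => ⟨V'', ?_, h5⟩) ?_ fun s' h => h
  · have hi : 1 ≤ i := by
      have : (1 : ℤ) ≤ (i : ℤ) := hc
      exact_mod_cast this
    refine (runs_walkP hW (arr := beforeE) (X := i - 1) ?_ ?_ hLn ho hJ).mono le_rfl
      fun s₁ ⟨V', h1, h2, h3⟩ => ⟨V', fun hi ℓ b hℓ hb => h2 ℓ b hℓ ?_, h3⟩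
    · intro s hA ℓ hℓ h0
      rw [hbef hi, ← (hA.2 ℓ hℓ).1]
      simp only [beforeE, IntExpr.eval, eval_ic, h0]
    · exact fun ℓ _ => Or.inl (hbef hi ℓ)
    · rw [hbef hi, hb]
  · have hi : ¬ 1 ≤ i := fun h => hc (by show (1 : ℤ) ≤ (i : ℤ); exact_mod_cast h)
    exact (Runs.skip ⟨V, fun h => absurd h hi, hJ⟩).mono (by nlinarith) fun s' h => h
  · intro s hA ℓ hℓ h0
    rw [haft, ← (hA.2 ℓ hℓ).2]
    simp only [afterE, IntExpr.eval, eval_ic, h0]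
  · exact fun ℓ _ => Or.inr (haft ℓ)
  · simp only [Test.cost, IntExpr.cost]
    ring_nf
    omega
  · intro ℓ b hcov
    have hℓ : ℓ ≤ L := hL ▸ level_le_of_inWindow hcov.1
    obtain ⟨⟨g1, g2⟩, g3⟩ := inCover_iff.1 hcov
    rcases g3 with g3 | g3
    · refine h3 (h1 ?_ ℓ b hℓ g3 g1 g2)
      by_contra hi
      obtain rfl : i = 0 := by omega
      -- If the window begins at time `0` there is no path before it. Division rounds down, the
      -- block is `-1` on every level, and its sibling `-2` is not a node; so skipping this walk
      -- loses nothing.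
      have : blockBefore 0 ℓ = -1 := by
        rw [blockBefore]
        have : (0 : ℤ) < 2 ^ ℓ := by positivity
        rw [Int.ediv_eq_iff_of_pos this]; constructor <;> push_cast <;> linarith
      rw [this, sibling] at g3
      omega
    · exact h4 ℓ b hℓ (by rw [haft, g3]) g1 g2

end WindowedHull

/-! ### The point of the window that is extreme in a given direction. -/

namespace WindowedHull

open Code

/-- Transitivity of the comparison of points, in terms of displacements. -/
theorem Dominates.add {u d d' : Pt} (h : Dominates u d) (h' : Dominates u d') :
    Dominates u (d + d') := by
  have e1 : dot u (d + d') = dot u d + dot u d' := by simp only [dot, Prod.fst_add, Prod.snd_add]; ring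
  have e2 : cross u (d + d') = cross u d + cross u d' := by
    simp only [cross, Prod.fst_add, Prod.snd_add]; ring
  rw [Dominates, e1, e2]
  rcases h with h | ⟨h, k⟩ <;> rcases h' with h' | ⟨h', k'⟩
  · left; linarith
  · left; linarith
  · left; linarith
  · right; constructor <;> linarith

theorem dominates_neg {u d : Pt} (h : ¬ Dominates u d) : Dominates u (-d) := by
  have e1 : dot u (-d) = - dot u d := by simp only [dot, Prod.fst_neg, Prod.snd_neg]; ring
  have e2 : cross u (-d) = - cross u d := by simp only [cross, Prod.fst_neg, Prod.snd_neg]; ring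
  rw [Dominates, e1, e2]
  rw [Dominates, not_or, not_and, not_lt, not_le] at h
  rcases h.1.lt_or_eq with h1 | h1
  · left; linarith
  · right; exact ⟨by linarith, by linarith [h.2 h1.symm]⟩

section Vertex

variable {n : ℕ} {p : Fin n → Pt} (T : DecompTree p) {i j ℓ b : ℕ}

theorem canonicalSubset_nonempty (h : InWindow i j ℓ b) (hj : j < n) :
    (canonicalSubset n ℓ b).Nonempty := by
  have hp : 0 < 2 ^ ℓ := by positivity
  have h1 : b * 2 ^ ℓ / 2 ^ ℓ = b := Nat.mul_div_cancel _ hp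
  exact ⟨⟨b * 2 ^ ℓ, (h _ h1).2.trans_lt hj⟩, by simp [canonicalSubset, h1]⟩

theorem level_le_clog (h : InWindow i j ℓ b) (hj : j < n) : ℓ ≤ Nat.clog 2 n :=
  (level_le_of_inWindow h).trans (log_window_le_clog
    ((h (b * 2 ^ ℓ) (Nat.mul_div_cancel _ (by positivity))).1.trans
      (h (b * 2 ^ ℓ) (Nat.mul_div_cancel _ (by positivity))).2) hj)

/-- The link between search and geometry: the number of facets with keys up to that of `u` is the
position of the extreme vertex. A hull with one vertex has no facets and rank `0`, which is the
right position too. -/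
theorem IsHullList.dominates_of_rank {C : Finset (Fin n)} {L : List (Fin n)}
    (h : IsHullList p C L) {u : Pt} (hu : u ≠ 0) {t : Fin n} (ht : t ∈ C) :
    Dominates u (p t -
      vertex p L (rank (pairKey p) (fun t => t ≤ key u) (facetPairs L))) := by
  by_cases h2 : 2 ≤ L.length
  · refine h.vertex_dominates h2 hu ((rank_le_length _ _).trans (length_facetPairs_le L))
      (fun k hk => ?_) ht
    have hk' : k < (facetPairs L).length := (length_facetPairs h2).symm ▸ hk
    rw [lt_rank_iff (fun _ _ => le_trans) h.pairwise_facetPairs hk', pairKey,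
      pairNormal_facetPairs]
  · have h1 : L.length = 1 := by have := h.length_pos ⟨t, ht⟩; omega
    have h0 : facetPairs L = [] := if_neg h2
    have hr : rank (pairKey p) (fun t => t ≤ key u) (facetPairs L) = 0 := by
      have := rank_le_length (κ := pairKey p) (fun t => t ≤ key u) (facetPairs L)
      rw [h0] at this ⊢
      exact Nat.le_zero.1 this
    rw [hr, h.eq_vertex_of_length_one h1 ht, sub_self]
    exact dominates_zero u

/-- The vertex of a sub-hull that is extreme in the direction `u`. -/
theorem exists_event_of_rank (hcov : InWindow i j ℓ b) (hj : j < n) {u : Pt} (hu : u ≠ 0) {f : ℕ}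
    (hf : f = rank (pairKey p) (fun t => t ≤ key u) (facetPairs (T.hull ℓ b))) :
    ∃ e : Fin n, eventAt (T.hull ℓ b) (if (T.hull ℓ b).length ≤ f then 0 else f) = (e.val : ℕ) ∧
      p e ∈ windowPoints p i j ∧
      ∀ t ∈ canonicalSubset n ℓ b, Dominates u (p t - p e) := by
  have h := T.hull_spec ℓ b (level_le_clog hcov hj)
  have hpos := h.length_pos (canonicalSubset_nonempty hcov hj)
  have hle := (rank_le_length (κ := pairKey p) (fun t => t ≤ key u)
    (facetPairs (T.hull ℓ b))).trans (length_facetPairs_le _)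
  rw [← hf] at hle
  set L := T.hull ℓ b
  -- The rank equals the length when no facet comes after `u`; the extreme vertex is then the first
  -- one. The machine cannot reduce positions modulo the length, hence the case distinction.
  set k := if L.length ≤ f then 0 else f with hk
  have hkL : k < L.length := by rw [hk]; split_ifs <;> omega
  have hv : vertex p L f = p L[k] := by
    have : f % L.length = k := by
      rw [hk]
      split_ifs with h1
      · rw [hle.antisymm h1, Nat.mod_self]
      · exact Nat.mod_eq_of_lt (by omega)
    rw [vertex, this, List.getD_eq_getElem _ _ (by simpa using hkL), List.getElem_map]
  refine ⟨L[k], ?_, ?_, fun t ht => ?_⟩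
  · rw [eventAt, List.getD_eq_getElem _ _ (by simpa using hkL), List.getElem_map]
  · have := h.mem _ (List.getElem_mem hkL)
    simp only [canonicalSubset, Finset.mem_filter, Finset.mem_univ, true_and] at this
    have := hcov _ this
    exact ⟨_, this.1, this.2, rfl⟩
  · have := h.dominates_of_rank hu ht
    rwa [← hf, hv] at this

end Vertex

namespace Code

/-- Decide whether the key of the table entry at hand is at most that of the direction in the
real cells `44` and `45`. -/
def keyTestP : Prog := keyLeP (rc 20) (rc 21) (rc 44) (rc 45) 25

/-- The difference between the candidate and the best point so far. -/
def candX : RealExpr := .sub (rc 34) (rc 32)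

def candY : RealExpr := .sub (rc 35) (rc 33)

def acceptP : Prog := .seq (.setReal (.lit 32) (rc 34)) (.setReal (.lit 33) (rc 35))

/-- Replace the best point by the candidate if that is further in the direction `(44, 45)`. -/
def improveP : Prog :=
  .cond (.realLe (.lit 0) (dotE (rc 44) (rc 45) candX candY))
    (.cond (.realLe (dotE (rc 44) (rc 45) candX candY) (.lit 0))
      (.cond (.realLe (.lit 0) (crossE (rc 44) (rc 45) candX candY)) .skip acceptP)
      acceptP)
    .skip

/-- Compare the extreme vertex of the sub-hull at hand with the best point so far. -/
def extremeP : Prog :=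
  .seq (.setInt (.lit 28) (ic 27))
    (.seq (.cond (.intLe (.hullSize (ic 20) (ic 21)) (ic 27)) (.setInt (.lit 28) (.lit 0)) .skip)
      (.seq (.setReal (.lit 34) (.pointX (.hullAt (ic 20) (ic 21) (ic 28))))
        (.seq (.setReal (.lit 35) (.pointY (.hullAt (ic 20) (ic 21) (ic 28)))) improveP)))

/-- Find the point of the window that is extreme in the direction `(44, 45)`. -/
def maximizeP : Prog :=
  .seq (.setReal (.lit 32) (.pointX .first))
    (.seq (.setReal (.lit 33) (.pointY .first)) (coverP 20 keyTestP extremeP))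

end Code

/-- The point in the real cells `a` and `a + 1`. -/
def State.ptAt (s : State) (a : ℤ) : Pt := (s.reals a, s.reals (a + 1))

/-- The cells used by the maximization. -/
def MaxCell (a : ℤ) : Prop := 20 ≤ a ∧ a < 40

theorem runs_improveP (x : Input) (s : State) :
    Runs x improveP s improveP.cost fun s' =>
      (s'.ptAt 32 = s.ptAt 32 ∨ s'.ptAt 32 = s.ptAt 34) ∧
      Dominates (s.ptAt 44) (s.ptAt 34 - s'.ptAt 32) ∧
      Dominates (s.ptAt 44) (s.ptAt 32 - s'.ptAt 32) ∧ s'.ints = s.ints := by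
  classical
  refine Runs.of_run (by simp [improveP, acceptP, Prog.LoopFree]) ?_
  have e : improveP.run x s = if Dominates (s.ptAt 44) (s.ptAt 34 - s.ptAt 32) then s else
      ⟨s.ints, Function.update (Function.update s.reals 32 (s.reals 34)) 33 (s.reals 35)⟩ := by
    simp only [improveP, acceptP, Prog.run, Test.Holds, eval_dotE, eval_crossE, eval_rc, candX,
      candY, RealExpr.eval, IntExpr.eval, Int.cast_zero]
    have e1 : (s.reals 34 - s.reals 32, s.reals 35 - s.reals 33) = s.ptAt 34 - s.ptAt 32 := rfl
    have e2 : (s.reals 44, s.reals 45) = s.ptAt 44 := rfl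
    have e3 : (Function.update s.reals 32 (s.reals 34)) 35 = s.reals 35 := by simp
    rw [e1, e2, e3, Dominates]
    by_cases h1 : 0 ≤ dot (s.ptAt 44) (s.ptAt 34 - s.ptAt 32)
    · by_cases h2 : dot (s.ptAt 44) (s.ptAt 34 - s.ptAt 32) ≤ 0
      · have h3 := le_antisymm h2 h1
        simp [h3]
      · simp [h1, h2, (not_le.1 h2).ne']
    · simp [h1, not_le.1 h1]
  rw [e]
  split_ifs with h
  · refine ⟨Or.inl rfl, h, ?_, rfl⟩
    rw [sub_self]
    exact dominates_zero _
  · have e4 : State.ptAt ⟨s.ints, Function.update (Function.update s.reals 32 (s.reals 34)) 33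
        (s.reals 35)⟩ 32 = s.ptAt 34 := by
      simp [State.ptAt]
    rw [e4, sub_self]
    refine ⟨Or.inr rfl, dominates_zero _, ?_, rfl⟩
    have := dominates_neg h
    rwa [neg_sub] at this

theorem runs_assignInt {x : Input} {s : State} (a : ℤ) (v : IntExpr) :
    Runs x (.setInt (.lit a) v) s (v.cost + 2) fun s' =>
      s'.ints a = v.eval x s ∧ (∀ c, c ≠ a → s'.ints c = s.ints c) ∧ s'.reals = s.reals :=
  (Runs.of_run (P := .setInt (.lit a) v) (x := x) (s := s) (Q := fun s' => s'.ints a = v.eval x s ∧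
    (∀ c, c ≠ a → s'.ints c = s.ints c) ∧ s'.reals = s.reals) trivial
    ⟨Function.update_self .., fun c hc => Function.update_of_ne hc .., rfl⟩).mono
    (by simp only [Prog.cost, IntExpr.cost]; omega) fun s' h => h

theorem runs_assignReal {x : Input} {s : State} (a : ℤ) (v : RealExpr) :
    Runs x (.setReal (.lit a) v) s (v.cost + 2) fun s' =>
      s'.reals a = v.eval x s ∧ (∀ c, c ≠ a → s'.reals c = s.reals c) ∧ s'.ints = s.ints :=
  (Runs.of_run (P := .setReal (.lit a) v) (x := x) (s := s) (Q := fun s' =>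
    s'.reals a = v.eval x s ∧ (∀ c, c ≠ a → s'.reals c = s.reals c) ∧ s'.ints = s.ints) trivial
    ⟨Function.update_self .., fun c hc => Function.update_of_ne hc .., rfl⟩).mono
    (by simp only [Prog.cost, IntExpr.cost]; omega) fun s' h => h

section Maximize

variable {n : ℕ} {p : Fin n → Pt} (T : DecompTree p) {i j : ℕ} {o₀ q₀ : Pt}

theorem runs_extremeP (hj : j < n) {s : State} {ℓ b : ℕ} (hcov : InCover i j ℓ b) {u : Pt}
    (hu : u ≠ 0) (hs : s.ptAt 44 = u) (h0 : s.ints 20 = ℓ) (h1 : s.ints 21 = b)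
    (h7 : s.ints 27 =
      (rank (pairKey p) (fun t => t ≤ key u) (facetPairs (T.hull ℓ b)) : ℕ))
    (hbest : s.ptAt 32 ∈ windowPoints p i j) :
    Runs (tableInput T i j o₀ q₀) extremeP s extremeP.cost fun s' =>
      (s'.ptAt 32 ∈ windowPoints p i j ∧ Dominates u (s.ptAt 32 - s'.ptAt 32) ∧
        ∀ t ∈ canonicalSubset n ℓ b, Dominates u (p t - s'.ptAt 32)) ∧
      (∀ a, a ≠ 28 → s'.ints a = s.ints a) ∧ AgreeOff (fun a => MaxCell a ∧ ¬ WalkCell 20 a) s s' := by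
  obtain ⟨e, he, hew, hdom⟩ := exists_event_of_rank T hcov.1 hj hu rfl
  set f := rank (pairKey p) (fun t => t ≤ key u) (facetPairs (T.hull ℓ b))
  have hx : ∀ s' : State, s'.ints 20 = ℓ → s'.ints 21 = b →
      s'.ints 28 = (if (T.hull ℓ b).length ≤ f then 0 else f : ℕ) →
      (IntExpr.hullAt (ic 20) (ic 21) (ic 28)).eval (tableInput T i j o₀ q₀) s' = (e.val : ℕ) := by
    intro s' g0 g1 g8
    rw [IntExpr.eval, eval_ic, eval_ic, eval_ic, g0, g1, g8]
    simp only [Int.toNat_natCast]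
    exact he
  have hsize : ∀ s' : State, s'.ints 20 = ℓ → s'.ints 21 = b →
      (IntExpr.hullSize (ic 20) (ic 21)).eval (tableInput T i j o₀ q₀) s' =
        ((T.hull ℓ b).length : ℕ) := by
    intro s' g0 g1
    rw [IntExpr.eval, eval_ic, eval_ic, g0, g1]
    simp only [Int.toNat_natCast]
    rfl
  have main : Runs (tableInput T i j o₀ q₀) extremeP s extremeP.cost fun s' =>
      (s'.ptAt 32 ∈ windowPoints p i j ∧ Dominates u (s.ptAt 32 - s'.ptAt 32) ∧
        ∀ t ∈ canonicalSubset n ℓ b, Dominates u (p t - s'.ptAt 32)) ∧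
      (∀ a, a ≠ 28 → s'.ints a = s.ints a) := by
    refine Runs.mono (Runs.seq (runs_assignInt 28 _) fun s₁ ⟨a1, a2, a3⟩ => Runs.seq
      (Q' := fun s₂ => s₂.ints 28 = (if (T.hull ℓ b).length ≤ f then 0 else f : ℕ) ∧
        (∀ a, a ≠ 28 → s₂.ints a = s.ints a) ∧ s₂.reals = s.reals)
      (Runs.cond (fun hc => (runs_assignInt 28 _).mono le_rfl fun s₂ ⟨b1, b2, b3⟩ => ?_)
        fun hc => Runs.mono (Runs.skip ?_) (by simp [IntExpr.cost]) fun s' h => h)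
      fun s₂ ⟨b1, b2, b3⟩ => Runs.seq (runs_assignReal 34 _) fun s₃ ⟨c1, c2, c3⟩ =>
      Runs.seq (runs_assignReal 35 _) fun s₄ ⟨d1, d2, d3⟩ =>
      (runs_improveP (tableInput T i j o₀ q₀) s₄).mono le_rfl
        fun s₅ ⟨e1, e2, e3, e4⟩ => ?_) (by
          simp [extremeP, Prog.cost, IntExpr.cost, RealExpr.cost, ic, Test.cost]) fun s' h => h
    · rw [Test.Holds, hsize s₁ (by rw [a2 _ (by norm_num), h0]) (by rw [a2 _ (by norm_num), h1]),
        eval_ic, a2 _ (by norm_num), h7] at hc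
      refine ⟨?_, fun a ha => by rw [b2 a ha, a2 a ha], b3.trans a3⟩
      rw [b1, if_pos (by exact_mod_cast hc)]
      rfl
    · rw [Test.Holds, hsize s₁ (by rw [a2 _ (by norm_num), h0]) (by rw [a2 _ (by norm_num), h1]),
        eval_ic, a2 _ (by norm_num), h7] at hc
      refine ⟨?_, a2, a3⟩
      rw [a1, eval_ic, h7, if_neg (by exact_mod_cast hc)]
    · have k0 : s₂.ints 20 = ℓ := by rw [b2 _ (by norm_num), h0]
      have k1 : s₂.ints 21 = b := by rw [b2 _ (by norm_num), h1]
      have c1' : s₄.reals 34 = (p e).1 := by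
        rw [d2 _ (by norm_num), c1, RealExpr.eval, hx s₂ k0 k1 b1, pointAt_val]
      have d1' : s₄.reals 35 = (p e).2 := by
        rw [d1, RealExpr.eval, hx s₃ (by rw [c3, k0]) (by rw [c3, k1]) (by rw [c3, b1]),
          pointAt_val]
      have m : ∀ a, a ≠ 34 → a ≠ 35 → s₄.reals a = s.reals a := fun a ha ha' => by
        rw [d2 a ha', c2 a ha, b3]
      have p34 : s₄.ptAt 34 = p e := Prod.ext c1' d1'
      have p32 : s₄.ptAt 32 = s.ptAt 32 :=
        Prod.ext (m 32 (by norm_num) (by norm_num)) (m 33 (by norm_num) (by norm_num))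
      have p44 : s₄.ptAt 44 = u :=
        (Prod.ext (m 44 (by norm_num) (by norm_num)) (m 45 (by norm_num) (by norm_num))).trans hs
      rw [p34, p32] at e1
      rw [p44, p34] at e2
      rw [p44, p32] at e3
      refine ⟨⟨?_, e3, fun t ht => ?_⟩, fun a ha => by rw [e4, d3, c3, b2 a ha]⟩
      · rcases e1 with e1 | e1
        · rwa [e1]
        · rwa [e1]
      · have := (hdom t ht).add e2
        rwa [sub_add_sub_cancel] at this
  exact (main.agree (A := fun a => MaxCell a ∧ ¬ WalkCell 20 a) (by
    simp [extremeP, improveP, acceptP, Prog.Within, MaxCell, WalkCell])).mono le_rfl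
      fun s' h => ⟨h.1.1, h.1.2, h.2⟩

-- The invariant of the walk: the best point belongs to the window and is at least as good as all
-- points of the nodes treated so far. A test is a comparison of two known directions, of constant
-- cost, so the whole takes `O(log w)` steps.
variable {T} in
theorem runs_maximizeP (hij : i ≤ j) (hj : j < n) {L : ℕ} (hL : L = Nat.log 2 (j - i + 1))
    {s : State} (hA : Arrays i j L s) {u : Pt} (hu : u ≠ 0) (hs : s.ptAt 44 = u) :
    Runs (tableInput T i j o₀ q₀) maximizeP s ((L + 1) *
      (3 * (roundCost 20 beforeE + roundCost 20 afterE) +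
        6 * (2 * keyTestP.cost + extremeP.cost) + 37)) fun s' =>
      s'.ptAt 32 ∈ windowPoints p i j ∧
        (∀ y ∈ windowPoints p i j, Dominates u (y - s'.ptAt 32)) ∧ AgreeOff MaxCell s s' := by
  have h44 : ∀ s', AgreeOff MaxCell s s' → s'.ptAt 44 = u := fun s' h => by
    rw [← hs]
    exact Prod.ext (h 44 (by unfold MaxCell; omega)).2 (h 45 (by unfold MaxCell; omega)).2
  have hArr : ∀ s', AgreeOff MaxCell s s' → Arrays i j L s' := fun s' h =>
    ⟨(h 6 (by unfold MaxCell; omega)).1.trans hA.1, fun ℓ hℓ =>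
      ⟨(h _ (by unfold MaxCell; omega)).1.trans (hA.2 ℓ hℓ).1,
        (h _ (by unfold MaxCell; omega)).1.trans (hA.2 ℓ hℓ).2⟩⟩
  have hW : Walkable T i j (tableInput T i j o₀ q₀) 20 keyTestP extremeP keyTestP.cost
      extremeP.cost (fun t => t ≤ key u) L fun V s' => AgreeOff MaxCell s s' ∧
        s'.ptAt 32 ∈ windowPoints p i j ∧ ∀ ℓ b : ℕ, (ℓ, b) ∈ V →
          ∀ t ∈ canonicalSubset n ℓ b, Dominates u (p t - s'.ptAt 32) := by
    have stable : ∀ A : ℤ → Prop, (∀ a, A a → MaxCell a) → ¬ A 32 → ¬ A 33 →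
        ∀ (V : Set (ℕ × ℕ)) (s₁ s₂ : State), (AgreeOff MaxCell s s₁ ∧
        s₁.ptAt 32 ∈ windowPoints p i j ∧ ∀ ℓ b : ℕ, (ℓ, b) ∈ V →
          ∀ t ∈ canonicalSubset n ℓ b, Dominates u (p t - s₁.ptAt 32)) → AgreeOff A s₁ s₂ →
        (AgreeOff MaxCell s s₂ ∧ s₂.ptAt 32 ∈ windowPoints p i j ∧ ∀ ℓ b : ℕ, (ℓ, b) ∈ V →
          ∀ t ∈ canonicalSubset n ℓ b, Dominates u (p t - s₂.ptAt 32)) := by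
      intro A hA' h32 h33 V s₁ s₂ ⟨g1, g2, g3⟩ h
      have : s₂.ptAt 32 = s₁.ptAt 32 := Prod.ext (h 32 h32).2 (h 33 h33).2
      rw [this]
      exact ⟨g1.trans (h.mono hA'), g2, g3⟩
    refine ⟨fun _ _ => le_trans, fun V s₁ s₂ => stable (WalkCell 20)
      (fun a ha => by unfold WalkCell at ha; unfold MaxCell; omega) (by unfold WalkCell; omega)
      (by unfold WalkCell; omega) V s₁ s₂, fun V s' h => hArr s' h.1, ?_, ?_⟩
    · intro V s₁ v hJ hv h1 h2
      have g := h44 s₁ hJ.1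
      refine ((runs_keyLeP (x := tableInput T i j o₀ q₀) (X := rc 20) (Y := rc 21) (X' := rc 44)
        (Y' := rc 45) (out := 25) hv hu fun s' hs' => ?_).agree (A := fun a => a = 25 ∨ a = 36 ∨
          a = 37) (by simp [keyLeP, halfP, Prog.Within])).mono le_rfl fun s' ⟨⟨k1, k2, k3⟩, k4⟩ =>
            ⟨stable _ ?_ (by norm_num) (by norm_num) V s₁ s' hJ k4, k1, fun a ha ha' => ?_⟩
      · rw [eval_rc, eval_rc, eval_rc, eval_rc, hs', ← g]
        exact ⟨h1, h2, rfl, rfl⟩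
      · intro a ha; unfold MaxCell; omega
      · unfold WalkCell at ha
        exact k3 a (by omega) (by omega) (by omega)
    · intro V s₁ ℓ b ⟨g1, g2, g3⟩ hcov h0 h1 h7
      refine (runs_extremeP T hj hcov hu (h44 s₁ g1) h0 h1 h7 g2).mono le_rfl
        fun s' ⟨⟨k1, k2, k3⟩, k4, k5⟩ => ⟨⟨g1.trans (k5.mono fun a ha => ha.1), k1, ?_⟩,
          fun a ha => k4 a (by unfold WalkCell at ha; omega)⟩
      intro l c hlc t ht
      rcases hlc with hlc | hlc
      · obtain ⟨rfl, rfl⟩ := Prod.mk.inj hlc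
        exact k3 t ht
      · have := (g3 l c hlc t ht).add k2
        rwa [sub_add_sub_cancel] at this
  have hi : i < n := by omega
  refine Runs.mono (Runs.seq ((runs_assignReal 32 _).agree (A := MaxCell)
    (by simp [Prog.Within, MaxCell])) fun s₁ ⟨⟨a1, a2, a3⟩, a4⟩ => Runs.seq
    ((runs_assignReal 33 _).agree (A := MaxCell) (by simp [Prog.Within, MaxCell]))
    fun s₂ ⟨⟨b1, b2, b3⟩, b4⟩ => (runs_coverP hW hL hij hj (V := ∅) (by norm_num)
      ⟨a4.trans b4, ?_, fun _ _ h => absurd h (Set.notMem_empty _)⟩).mono le_rfl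
      fun s₃ ⟨V, c1, c2, c3, c4⟩ => ⟨c3, ?_, c2⟩) ?_ fun s' h => h
  -- Starting from the first event of the window avoids an undefined best point.
  · have hp : (tableInput T i j o₀ q₀).pointAt (i : ℕ) = p ⟨i, hi⟩ := pointAt_val ⟨i, hi⟩
    have : s₂.ptAt 32 = p ⟨i, hi⟩ := by
      rw [← hp]
      exact Prod.ext ((b2 _ (by norm_num)).trans a1) b1
    exact ⟨⟨i, hi⟩, le_rfl, hij, this.symm⟩
  · simp only [RealExpr.cost, IntExpr.cost]
    ring_nf
    omega
  · rintro y ⟨t, h1, h2, rfl⟩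
    obtain ⟨ℓ, hℓ⟩ := exists_inCover h1 h2
    exact c4 _ _ (c1 _ _ hℓ) t (by simp [canonicalSubset])

end Maximize

end WindowedHull

/-! ### Comparing a direction with the normal of the stabbed facet. -/

namespace WindowedHull

open Code

namespace Code

/-- The side of the query line on which the best point lies. -/
def bestSide : RealExpr := crossE .dirX .dirY (.sub (rc 32) .baseX) (.sub (rc 33) .baseY)

/-- Decide whether all points of the window lie on the right of the query line or on it. -/
def flagP : Prog :=
  .seq (.setReal (.lit 44) (.sub (.lit 0) .dirY))
    (.seq (.setReal (.lit 45) .dirX)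
      (.seq maximizeP
        (.cond (.realLe bestSide (.lit 0))
          (.setInt (.lit 40) (.lit 1)) (.setInt (.lit 40) (.lit 0)))))

/-- Decide whether, turning clockwise from the direction opposite to the query line, the direction
in the real cells `10` and `11` is met before the normal of the stabbed facet. -/
def beforeFacetP : Prog :=
  .cond (.realLe (dotE (rc 10) (rc 11) .dirX .dirY) (.lit 0))
    (.cond (.realLe (crossE .dirX .dirY (rc 10) (rc 11)) (.lit 0))
      (.setInt (.lit 42) (.lit 0)) (.setInt (.lit 42) (.lit 1)))
    (.seq (.setReal (.lit 44) (rc 10))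
      (.seq (.setReal (.lit 45) (rc 11))
        (.seq maximizeP
          (.cond (.realLe bestSide (.lit 0))
            (.cond (.realLe (.lit 0) bestSide)
              (.setInt (.lit 42) (ic 40)) (.setInt (.lit 42) (.lit 0)))
            (.setInt (.lit 42) (.lit 1))))))

/-- Decide whether the key of the direction in the real cells `10` and `11` is less than the key of
the normal of the stabbed facet. -/
def facetTestP : Prog :=
  .seq beforeFacetP
    (.seq (keyLeP (rc 10) (rc 11) (.sub (.lit 0) .dirX) (.sub (.lit 0) .dirY) 43)
      (.cond (.intLe (.lit 1) (ic 41))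
        (.cond (.intLe (.lit 1) (ic 43))
          (.setInt (.lit 15) (ic 42)) (.setInt (.lit 15) (.lit 0)))
        (.cond (.intLe (.lit 1) (ic 43))
          (.setInt (.lit 15) (.lit 1)) (.setInt (.lit 15) (ic 42)))))

end Code

/-- The cells used by the test against the stabbed facet. -/
def TestCell (a : ℤ) : Prop := 20 ≤ a ∧ a < 40 ∨ 42 ≤ a ∧ a < 46

theorem Code.IsBit.congr {z : ℤ} {a b : Prop} (h : IsBit z a) (hab : a ↔ b) : IsBit z b :=
  h.imp (fun h => ⟨h.1, hab.1 h.2⟩) fun h => ⟨h.1, fun hb => h.2 (hab.2 hb)⟩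

theorem isBit_one {a : Prop} (h : a) : IsBit 1 a := Or.inl ⟨rfl, h⟩

theorem isBit_zero {a : Prop} (h : ¬ a) : IsBit 0 a := Or.inr ⟨rfl, h⟩

theorem Code.IsBit.one_le_iff {z : ℤ} {a : Prop} (h : IsBit z a) : 1 ≤ z ↔ a := by
  rcases h with ⟨rfl, h⟩ | ⟨rfl, h⟩
  · simpa using h
  · simpa using h

/-- A full turn would mean that `N` points exactly against `q`. -/
theorem cwAngle_neg_lt_two_pi {q N : Pt} (hq : q ≠ 0) (hN : N ≠ 0)
    (h : 0 < dot N q ∨ dot N q = 0 ∧ cross q N < 0) : cwAngle (-q) N < 2 * Real.pi := by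
  refine (cwAngle_le _ _).lt_of_ne fun h0 => ?_
  obtain ⟨r, hr, h1, h2⟩ := exists_cross_dot_cwAngle (neg_ne_zero.2 hq) hN
  rw [h0, Real.cos_two_pi, mul_one] at h2
  have h3 : dot N q = -r := by
    rw [← h2]; simp only [dot, Prod.fst_neg, Prod.snd_neg]; ring
  rcases h with h | h
  · linarith
  · linarith [h.1]

/-- The cost of the maximization. -/
def maxCost (L : ℕ) : ℕ := (L + 1) *
  (3 * (roundCost 20 beforeE + roundCost 20 afterE) +
    6 * (2 * keyTestP.cost + extremeP.cost) + 37)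

section Query

variable {n : ℕ} {p : Fin n → Pt} {T : DecompTree p} {i j L : ℕ} {o q : Pt}

theorem runs_flagP (hij : i ≤ j) (hj : j < n) (hL : L = Nat.log 2 (j - i + 1)) (hq : q ≠ 0)
    {s : State} (hA : Arrays i j L s) :
    Runs (tableInput T i j o q) flagP s (maxCost L + 50) fun s' => Arrays i j L s' ∧
      IsBit (s'.ints 40) (∀ y ∈ windowPoints p i j, side o q y ≤ 0) := by
  have frame : ∀ {s s' : State}, AgreeOff (fun a => 20 ≤ a ∧ a < 50) s s' → Arrays i j L s →
      Arrays i j L s' := fun h hA => ⟨(h 6 (by omega)).1.trans hA.1, fun ℓ hℓ =>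
      ⟨(h _ (by omega)).1.trans (hA.2 ℓ hℓ).1, (h _ (by omega)).1.trans (hA.2 ℓ hℓ).2⟩⟩
  -- This is `q` turned counterclockwise by a right angle; the extreme point in this direction is
  -- the leftmost one with respect to the line, so its side decides for all points.
  have hrot : ((-q.2, q.1) : Pt) ≠ 0 := by
    intro h
    rw [Prod.mk_eq_zero, neg_eq_zero] at h
    exact hq (Prod.ext h.2 h.1)
  refine Runs.mono (Runs.seq ((runs_assignReal 44 _).agree (A := fun a => 20 ≤ a ∧ a < 50)
    (by simp [Prog.Within])) fun s₁ ⟨⟨a1, a2, a3⟩, a4⟩ => Runs.seq ((runs_assignReal 45 _).agree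
    (A := fun a => 20 ≤ a ∧ a < 50) (by simp [Prog.Within])) fun s₂ ⟨⟨b1, b2, b3⟩, b4⟩ =>
    Runs.seq (runs_maximizeP hij hj hL (frame b4 (frame a4 hA)) hrot ?_) fun s₃ ⟨c1, c2, c3⟩ =>
    (Runs.agree (A := fun a => 20 ≤ a ∧ a < 50) (Runs.cond (t := 3) (fun hc =>
      (runs_assignInt 40 _).mono (by simp [IntExpr.cost]) fun s₄ ⟨d1, d2, d3⟩ => ?_) fun hc =>
      (runs_assignInt 40 _).mono (by simp [IntExpr.cost]) fun s₄ ⟨d1, d2, d3⟩ => ?_)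
      (by simp [Prog.Within])).mono le_rfl fun s₄ ⟨d1, d2⟩ => ⟨frame d2
        (frame (c3.mono fun a ha => by unfold MaxCell at ha; omega) (frame b4 (frame a4 hA))),
        d1⟩) ?_ fun s' h => h
  · have e1 : s₂.reals 44 = -q.2 := by
      rw [b2 _ (by norm_num), a1]
      simp only [RealExpr.eval, Int.cast_zero, zero_sub]
      rfl
    exact Prod.ext e1 b1
  · simp only [maxCost, RealExpr.cost, IntExpr.cost, Test.cost, bestSide, crossE, rc]
    omega
  · rw [d1]
    refine isBit_one fun y hy => ?_
    have h1 : side o q (s₃.ptAt 32) ≤ 0 := by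
      have h1 : side o q (s₃.ptAt 32) ≤ ((0 : ℤ) : ℝ) := hc
      rwa [Int.cast_zero] at h1
    have h2 : dot (-q.2, q.1) (y - s₃.ptAt 32) ≤ 0 := by
      rcases c2 y hy with h | h
      · exact h.le
      · exact h.1.le
    simp only [side, cross, dot, Prod.fst_sub, Prod.snd_sub] at h1 h2 ⊢
    linarith
  · rw [d1]
    refine isBit_zero fun hall => hc ?_
    show side o q (s₃.ptAt 32) ≤ ((0 : ℤ) : ℝ)
    rw [Int.cast_zero]
    exact hall _ c1

/-- What the program needs to know about the normal `N` of a stabbed facet. -/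
structure StabbedNormal (S : Set Pt) (o q N : Pt) : Prop where
  dir_ne_zero : q ≠ 0
  ne_zero : N ≠ 0
  dir : 0 < dot N q ∨ dot N q = 0 ∧ cross q N < 0
  leftSide_iff : ∀ u, 0 < dot u q → ∀ e ∈ S, (∀ x ∈ S, Dominates u (x - e)) →
    (LeftSide S o q e ↔ cross u N < 0)

/-- What stays fixed during the search for the stabbed facet. -/
def Prepared (S : Set Pt) (i j L : ℕ) (o q : Pt) (s : State) : Prop :=
  Arrays i j L s ∧ IsBit (s.ints 40) (∀ y ∈ S, side o q y ≤ 0)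

theorem Prepared.congr {S : Set Pt} {A : ℤ → Prop} {s s' : State} (h : Prepared S i j L o q s)
    (hA : ∀ a, A a → 8 ≤ a ∧ a < 100 ∧ a ≠ 40 ∨ 0 ≤ a ∧ a < 6) (hs : AgreeOff A s s') :
    Prepared S i j L o q s' := by
  have h6 : ∀ a, ¬ (8 ≤ a ∧ a < 100 ∧ a ≠ 40 ∨ 0 ≤ a ∧ a < 6) → s'.ints a = s.ints a :=
    fun a ha => (hs a fun h => ha (hA a h)).1
  refine ⟨⟨(h6 6 (by omega)).trans h.1.1, fun ℓ hℓ => ⟨(h6 _ (by omega)).trans (h.1.2 ℓ hℓ).1,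
    (h6 _ (by omega)).trans (h.1.2 ℓ hℓ).2⟩⟩, ?_⟩
  rw [h6 40 (by omega)]
  exact h.2

/-- For a direction that does not face `q` one cross product suffices. Otherwise the extreme point
is computed and its side is read off; if it lies on the line, the bit in the cell `40`, found once
and for all, decides as in `LeftSide`. -/
theorem runs_beforeFacetP (hij : i ≤ j) (hj : j < n) (hL : L = Nat.log 2 (j - i + 1)) {N : Pt}
    (hN : StabbedNormal (windowPoints p i j) o q N) {s : State}
    (hs : Prepared (windowPoints p i j) i j L o q s) (hu : s.ptAt 10 ≠ 0) :
    Runs (tableInput T i j o q) beforeFacetP s (maxCost L + 100) fun s' =>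
      IsBit (s'.ints 42) (cwAngle (-q) (s.ptAt 10) < cwAngle (-q) N) ∧
        AgreeOff TestCell s s' := by
  have hiff := cwAngle_neg_lt_iff hN.dir_ne_zero hu hN.ne_zero hN.dir
  have hdot : (Test.realLe (dotE (rc 10) (rc 11) .dirX .dirY) (.lit 0)).Holds
      (tableInput T i j o q) s ↔ dot (s.ptAt 10) q ≤ 0 := by
    show dot (s.ptAt 10) q ≤ ((0 : ℤ) : ℝ) ↔ _
    rw [Int.cast_zero]
  have hcr : (Test.realLe (crossE .dirX .dirY (rc 10) (rc 11)) (.lit 0)).Holds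
      (tableInput T i j o q) s ↔ cross q (s.ptAt 10) ≤ 0 := by
    show cross q (s.ptAt 10) ≤ ((0 : ℤ) : ℝ) ↔ _
    rw [Int.cast_zero]
  refine Runs.mono (Runs.cond (t := maxCost L + 60) (fun hc => ?_) fun hc => ?_) ?_ fun s' h => h
  · rw [hdot] at hc
    rw [if_pos hc] at hiff
    refine (Runs.agree (A := TestCell) (Runs.cond (t := 3) (fun hc =>
      (runs_assignInt 42 _).mono (by simp [IntExpr.cost]) fun s₄ ⟨d1, d2, d3⟩ => ?_) fun hc =>
      (runs_assignInt 42 _).mono (by simp [IntExpr.cost]) fun s₄ ⟨d1, d2, d3⟩ => ?_)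
      (by simp [Prog.Within, TestCell])).mono (by
        simp only [RealExpr.cost, IntExpr.cost, Test.cost, crossE, rc]; omega) fun s' h => h
    · rw [hcr] at hc
      rw [d1]
      exact isBit_zero fun h => (not_lt.2 hc) (hiff.1 h)
    · rw [hcr] at hc
      rw [d1]
      exact isBit_one (hiff.2 (not_le.1 hc))
  · rw [hdot] at hc
    rw [if_neg hc] at hiff
    have hfr : ∀ s', AgreeOff TestCell s s' → Prepared (windowPoints p i j) i j L o q s' :=
      fun s' h => hs.congr (fun a ha => by unfold TestCell at ha; omega) h
    refine Runs.mono (Runs.seq ((runs_assignReal 44 _).agree (A := TestCell)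
      (by simp [Prog.Within, TestCell])) fun s₁ ⟨⟨a1, a2, a3⟩, a4⟩ =>
      Runs.seq ((runs_assignReal 45 _).agree (A := TestCell)
      (by simp [Prog.Within, TestCell])) fun s₂ ⟨⟨b1, b2, b3⟩, b4⟩ =>
      Runs.seq (runs_maximizeP hij hj hL (hfr s₂ (a4.trans b4)).1 hu ?_)
      fun s₃ ⟨c1, c2, c3⟩ => (Runs.agree (A := TestCell)
        (Q := fun s' => IsBit (s'.ints 42) (LeftSide (windowPoints p i j) o q (s₃.ptAt 32)))
        (Runs.cond (t := 20) (fun hc1 => Runs.mono (Runs.cond (t := 4) (fun hc2 =>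
          (runs_assignInt 42 _).mono (by simp [IntExpr.cost, ic]) fun s₄ ⟨d1, d2, d3⟩ => ?_)
          fun hc2 => (runs_assignInt 42 _).mono (by simp [IntExpr.cost])
            fun s₄ ⟨d1, d2, d3⟩ => ?_) ?_ fun s' h => h) fun hc1 =>
        (runs_assignInt 42 _).mono (by simp [IntExpr.cost]) fun s₄ ⟨d1, d2, d3⟩ => ?_)
        (by simp [Prog.Within, TestCell])).mono le_rfl fun s₄ ⟨d1, d2⟩ => ⟨?_, ?_⟩)
      ?_ fun s' h => h
    · exact Prod.ext ((b2 44 (by norm_num)).trans a1) (b1.trans (a2 11 (by norm_num)))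
    · simp [RealExpr.cost, IntExpr.cost, Test.cost, bestSide, crossE, rc]
    · rw [Test.Holds, RealExpr.eval, Int.cast_zero] at hc1 hc2
      have h0 : side o q (s₃.ptAt 32) = 0 := le_antisymm hc1 hc2
      rw [d1, eval_ic]
      have hf : Prepared (windowPoints p i j) i j L o q s₃ :=
        hfr s₃ (a4.trans (b4.trans (c3.mono fun a ha => Or.inl ha)))
      refine hf.2.congr ⟨fun h => Or.inr ⟨h0, h⟩, fun h => ?_⟩
      rcases h with h | h
      · exact absurd h0 h.ne'
      · exact h.2
    · rw [Test.Holds, RealExpr.eval, Int.cast_zero] at hc1 hc2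
      have h0 : side o q (s₃.ptAt 32) < 0 := not_le.1 hc2
      rw [d1]
      refine isBit_zero fun h => ?_
      rcases h with h | h
      · linarith
      · linarith [h.1]
    · rw [Test.Holds, RealExpr.eval, Int.cast_zero] at hc1
      rw [d1]
      exact isBit_one (Or.inl (not_le.1 hc1))
    · simp only [RealExpr.cost, IntExpr.cost, Test.cost, bestSide, crossE, rc, maxCost]
      omega
    · exact d1.congr ((hN.leftSide_iff _ (not_le.1 hc) _ c1 c2).trans hiff.symm)
    · exact a4.trans (b4.trans ((c3.mono fun a ha => Or.inl ha).trans d2))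
  · simp only [RealExpr.cost, IntExpr.cost, Test.cost, dotE, rc]
    omega

/-- The property that the outer walk searches for. -/
theorem runs_facetTestP (hij : i ≤ j) (hj : j < n) (hL : L = Nat.log 2 (j - i + 1)) {N : Pt}
    (hN : StabbedNormal (windowPoints p i j) o q N) {y : ℝ}
    (hy : ∀ u : Pt, key u < y ↔
      if cwAngle (-q) (1, 0) < cwAngle (-q) N then
        key u ≤ key (-q) ∧ cwAngle (-q) u < cwAngle (-q) N
      else key u ≤ key (-q) ∨ cwAngle (-q) u < cwAngle (-q) N) {s : State}
    (hs : Prepared (windowPoints p i j) i j L o q s) (hu : s.ptAt 10 ≠ 0)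
    (h41 : IsBit (s.ints 41) (cwAngle (-q) (1, 0) < cwAngle (-q) N)) :
    Runs (tableInput T i j o q) facetTestP s (maxCost L + 300) fun s' =>
      IsBit (s'.ints 15) (key (s.ptAt 10) < y) ∧
        AgreeOff (fun a => TestCell a ∨ a = 15) s s' := by
  have hq : -q ≠ 0 := neg_ne_zero.2 hN.dir_ne_zero
  have hyu := hy (s.ptAt 10)
  refine Runs.mono (Runs.seq (runs_beforeFacetP hij hj hL hN hs hu) fun s₁ ⟨a1, a2⟩ =>
    Runs.seq ((runs_keyLeP hu hq fun s' hs' => ?_).agree (A := TestCell)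
      (by simp [keyLeP, halfP, Prog.Within, TestCell])) fun s₂ ⟨⟨b1, b2, b3⟩, b4⟩ =>
    (Runs.agree (A := fun a => a = 15)
      (Q := fun s' => IsBit (s'.ints 15) (key (s.ptAt 10) < y))
      (Runs.cond (t := 20) (fun hc => (Runs.cond (t := 8)
        (fun hc1 => (runs_assignInt 15 _).mono (by simp [IntExpr.cost, ic])
          fun s₃ ⟨c1, _⟩ => ?_)
        (fun hc1 => (runs_assignInt 15 _).mono (by simp [IntExpr.cost])
          fun s₃ ⟨c1, _⟩ => ?_)).mono (by simp [Test.cost, IntExpr.cost, ic]) fun s' h => h)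
        (fun hc => (Runs.cond (t := 8)
        (fun hc1 => (runs_assignInt 15 _).mono (by simp [IntExpr.cost])
          fun s₃ ⟨c1, _⟩ => ?_)
        (fun hc1 => (runs_assignInt 15 _).mono (by simp [IntExpr.cost, ic])
          fun s₃ ⟨c1, _⟩ => ?_)).mono (by simp [Test.cost, IntExpr.cost, ic]) fun s' h => h))
      (by simp [Prog.Within])).mono le_rfl
      fun s₃ ⟨c1, c2⟩ => ⟨c1, (a2.mono fun a ha => Or.inl ha).trans
        ((b4.mono fun a ha => Or.inl ha).trans (c2.mono fun a ha => Or.inr ha))⟩) ?_ fun s' h => h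
  · have h10 : s₁.ptAt 10 = s.ptAt 10 :=
      Prod.ext (a2 10 (by unfold TestCell; omega)).2 (a2 11 (by unfold TestCell; omega)).2
    rw [← h10, eval_rc, eval_rc, hs']
    refine ⟨rfl, rfl, ?_, ?_⟩
    · simp only [RealExpr.eval, Int.cast_zero, zero_sub]; rfl
    · simp only [RealExpr.eval, Int.cast_zero, zero_sub]; rfl
  · rw [Test.Holds, IntExpr.eval, eval_ic, b3 _ (by norm_num) (by norm_num) (by norm_num),
      (a2 41 (by unfold TestCell; omega)).1, h41.one_le_iff] at hc
    rw [Test.Holds, IntExpr.eval, eval_ic, b1.one_le_iff] at hc1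
    rw [if_pos hc] at hyu
    rw [c1, eval_ic, b3 _ (by norm_num) (by norm_num) (by norm_num)]
    exact a1.congr (by rw [hyu, and_iff_right hc1])
  · rw [Test.Holds, IntExpr.eval, eval_ic, b3 _ (by norm_num) (by norm_num) (by norm_num),
      (a2 41 (by unfold TestCell; omega)).1, h41.one_le_iff] at hc
    rw [Test.Holds, IntExpr.eval, eval_ic, b1.one_le_iff] at hc1
    rw [if_pos hc] at hyu
    rw [c1]
    exact isBit_zero fun h => hc1 (hyu.1 h).1
  · rw [Test.Holds, IntExpr.eval, eval_ic, b3 _ (by norm_num) (by norm_num) (by norm_num),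
      (a2 41 (by unfold TestCell; omega)).1, h41.one_le_iff] at hc
    rw [Test.Holds, IntExpr.eval, eval_ic, b1.one_le_iff] at hc1
    rw [if_neg hc] at hyu
    rw [c1]
    exact isBit_one (hyu.2 (Or.inl hc1))
  · rw [Test.Holds, IntExpr.eval, eval_ic, b3 _ (by norm_num) (by norm_num) (by norm_num),
      (a2 41 (by unfold TestCell; omega)).1, h41.one_le_iff] at hc
    rw [Test.Holds, IntExpr.eval, eval_ic, b1.one_le_iff] at hc1
    rw [if_neg hc] at hyu
    rw [c1, eval_ic, b3 _ (by norm_num) (by norm_num) (by norm_num)]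
    exact a1.congr (by rw [hyu, or_iff_right hc1])
  · simp only [keyLeP, halfP, Prog.cost, RealExpr.cost, IntExpr.cost, Test.cost, crossE, rc, ic]
    omega

end Query

end WindowedHull

/-! ### The first and the last facet in the clockwise order that begins at the stabbed normal. -/

namespace WindowedHull

open Code

open Classical in
/-- The quarter of the shifted clockwise order to which a direction belongs. -/
noncomputable def shiftedClass (y : ℝ) (u : Pt) : ℤ := (if key u < y then 2 else 0) + halfClass u

theorem halfClass_mem (u : Pt) : halfClass u = 0 ∨ halfClass u = 1 := by
  unfold halfClass
  split_ifs
  · exact Or.inl rfl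
  · exact Or.inr rfl

/-- As with `key_le_iff`, sign tests replace angles, provided it is known for each direction whether
its key is below `y`. -/
theorem shiftedKey_le_iff {y : ℝ} {u v : Pt} (hu : u ≠ 0) (hv : v ≠ 0) :
    shiftedKey y u ≤ shiftedKey y v ↔ shiftedClass y u < shiftedClass y v ∨
      shiftedClass y u = shiftedClass y v ∧ cross u v ≤ 0 := by
  have h1 := halfClass_mem u
  have h2 := halfClass_mem v
  have := key_nonneg u
  have := key_nonneg v
  have := key_lt u
  have := key_lt v
  have := Real.pi_pos
  have h := key_le_iff hu hv
  unfold shiftedKey shiftedClass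
  by_cases hy : key u < y <;> by_cases hy' : key v < y
  · rw [if_pos hy, if_pos hy', if_pos hy, if_pos hy', add_le_add_iff_right, h]
    simp
  · rw [if_pos hy, if_neg hy', if_pos hy, if_neg hy']
    exact ⟨fun _ => absurd (by linarith) hy', fun h => by omega⟩
  · rw [if_neg hy, if_pos hy', if_neg hy, if_pos hy']
    exact ⟨fun _ => Or.inl (by omega), fun _ => by linarith⟩
  · rw [if_neg hy, if_neg hy', if_neg hy, if_neg hy', add_zero, add_zero, zero_add, zero_add, h]

/-- The last facet in the shifted order of a sub-hull with at least two vertices. -/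
theorem IsHullList.shiftedKey_le {n : ℕ} {p : Fin n → Pt} {C : Finset (Fin n)} {L : List (Fin n)}
    (h : IsHullList p C L) (hL : 2 ≤ L.length) {y : ℝ} {f : ℕ}
    (hf : f = rank (pairKey p) (fun t => t < y) (facetPairs L)) :
    f ≤ L.length ∧ (∀ k < L.length, key (facetNormal p L k) < y ↔ k < f) ∧
    (∀ k < L.length, shiftedKey y (facetNormal p L k) ≤
      shiftedKey y (facetNormal p L (if 1 ≤ f then f - 1 else L.length - 1))) ∧
    ∀ k < L.length, shiftedKey y (facetNormal p L (if L.length ≤ f then 0 else f)) ≤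
      shiftedKey y (facetNormal p L k) := by
  have hle : f ≤ L.length := by
    rw [hf, ← length_facetPairs hL]; exact rank_le_length _ _
  have hlt : ∀ k < L.length, key (facetNormal p L k) < y ↔ k < f := by
    intro k hk
    have hk' : k < (facetPairs L).length := (length_facetPairs hL).symm ▸ hk
    rw [hf, lt_rank_iff (fun _ _ h h' => h.trans_lt h') h.pairwise_facetPairs hk', pairKey,
      pairNormal_facetPairs]
  have hmono : ∀ k l, k ≤ l → l < L.length →
      key (facetNormal p L k) ≤ key (facetNormal p L l) := by
    intro k l hkl hl
    rcases hkl.eq_or_lt with rfl | hkl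
    · exact le_rfl
    · exact (h.key_facetNormal_lt hkl hl).le
  -- The shifted order runs through the positions `f, …, L.length - 1` and then `0, …, f - 1`.
  have hsh : ∀ k l, k < L.length → l < L.length → (k < f → l < f → k ≤ l) → (f ≤ k → f ≤ l → k ≤ l) →
      (k < f → l < f) → shiftedKey y (facetNormal p L k) ≤ shiftedKey y (facetNormal p L l) := by
    intro k l hk hl h1 h2 h3
    have := key_nonneg (facetNormal p L l)
    have := key_lt (facetNormal p L k)
    unfold shiftedKey
    by_cases hkf : k < f
    · rw [if_pos ((hlt k hk).2 hkf), if_pos ((hlt l hl).2 (h3 hkf)), add_le_add_iff_right]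
      exact hmono k l (h1 hkf (h3 hkf)) hl
    · rw [if_neg (fun h => hkf ((hlt k hk).1 h))]
      by_cases hlf : l < f
      · rw [if_pos ((hlt l hl).2 hlf)]
        linarith
      · rw [if_neg (fun h => hlf ((hlt l hl).1 h)), add_zero, add_zero]
        exact hmono k l (h2 (by omega) (by omega)) hl
  refine ⟨hle, hlt, fun k hk => ?_, fun k hk => ?_⟩
  · split_ifs <;> exact hsh _ _ hk (by omega) (by omega) (by omega) (by omega)
  · split_ifs <;> exact hsh _ _ (by omega) hk (by omega) (by omega) (by omega)

namespace Code

/-- Load the facet with the position in the cell `50` of the sub-hull at hand. -/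
def loadFacetP : Prog :=
  .seq (.setInt (.lit 52) (.add (ic 50) (.lit 1)))
    (.seq (.cond (.intLe (.hullSize (ic 10) (ic 11)) (ic 52)) (.setInt (.lit 52) (.lit 0)) .skip)
      (.seq (.setReal (.lit 50) (.sub (.pointY (.hullAt (ic 10) (ic 11) (ic 50)))
          (.pointY (.hullAt (ic 10) (ic 11) (ic 52)))))
        (.seq (.setReal (.lit 51) (.sub (.pointX (.hullAt (ic 10) (ic 11) (ic 52)))
            (.pointX (.hullAt (ic 10) (ic 11) (ic 50)))))
          (.seq (halfP (rc 50) (rc 51) 53) (.setInt (.lit 51) (.add (ic 51) (ic 53)))))))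

/-- Record the facet that was loaded. -/
def recordP (c f : ℤ) : Prog :=
  .seq (.setInt (.lit c) (ic 51))
    (.seq (.setReal (.lit c) (rc 50))
      (.seq (.setReal (.lit (c + 1)) (rc 51))
        (.seq (.setInt (.lit f) (ic 10))
          (.seq (.setInt (.lit (f + 1)) (ic 11)) (.setInt (.lit (f + 2)) (ic 50))))))

/-- Run `R` if the class `a` is less than the class `b`, or the same and the cross product `e` is
not positive. -/
def guardP (a b : IntExpr) (e : RealExpr) (R : Prog) : Prog :=
  .cond (.intLe a b) (.cond (.intLe b a) (.cond (.realLe e (.lit 0)) R .skip) R) .skip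

/-- The choice of the last facet of the sub-hull at hand in the shifted order. -/
def lastFacetP : Prog :=
  .cond (.intLe (.lit 1) (ic 17))
    (.seq (.setInt (.lit 50) (.sub (ic 17) (.lit 1))) (.setInt (.lit 51) (.lit 2)))
    (.seq (.setInt (.lit 50) (.sub (.hullSize (ic 10) (ic 11)) (.lit 1)))
      (.setInt (.lit 51) (.lit 0)))

/-- The choice of the first facet of the sub-hull at hand in the shifted order. -/
def firstFacetP : Prog :=
  .cond (.intLe (.hullSize (ic 10) (ic 11)) (ic 17))
    (.seq (.setInt (.lit 50) (.lit 0)) (.setInt (.lit 51) (.lit 2)))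
    (.seq (.setInt (.lit 50) (ic 17)) (.setInt (.lit 51) (.lit 0)))

/-- Compare the extreme facets of the sub-hull at hand with the best facets so far. -/
def facetsP : Prog :=
  .cond (.intLe (.lit 2) (.hullSize (ic 10) (ic 11)))
    (.seq
      (.seq lastFacetP (.seq loadFacetP
        (guardP (ic 54) (ic 51) (crossE (rc 54) (rc 55) (rc 50) (rc 51)) (recordP 54 0))))
      (.seq firstFacetP (.seq loadFacetP
        (guardP (ic 51) (ic 56) (crossE (rc 50) (rc 51) (rc 56) (rc 57)) (recordP 56 3)))))
    .skip

end Code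

/-- The cells used by the treatment of the facets. -/
def FacetCell (a : ℤ) : Prop := 0 ≤ a ∧ a < 6 ∨ 50 ≤ a ∧ a < 58

section Facets

variable {n : ℕ} {p : Fin n → Pt} (T : DecompTree p) {i j : ℕ} {o q : Pt}

/-- The facet named in the cells `f`, `f + 1`, `f + 2` is, with respect to `rel`, the best facet of
the sub-hulls in `V`; its normal is in the real cells `c` and `c + 1`. -/
def BestFacet (i j : ℕ) (y : ℝ) (rel : ℝ → ℝ → Prop) (c f dflt : ℤ) (V : Set (ℕ × ℕ))
    (s : State) : Prop :=
  (s.ints c = dflt ∧ ∀ ℓ b : ℕ, (ℓ, b) ∈ V → (T.hull ℓ b).length < 2) ∨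
  ((s.facetAt f).Valid T i j ∧ (s.facetAt f).normal T = s.ptAt c ∧
    s.ints c = shiftedClass y (s.ptAt c) ∧ ∀ ℓ b : ℕ, (ℓ, b) ∈ V → 2 ≤ (T.hull ℓ b).length →
      ∀ k < (T.hull ℓ b).length,
        rel (shiftedKey y (facetNormal p (T.hull ℓ b) k)) (shiftedKey y (s.ptAt c)))

variable {T}

theorem BestFacet.congr {y : ℝ} {rel : ℝ → ℝ → Prop} {c f dflt : ℤ} {V : Set (ℕ × ℕ)}
    {A : ℤ → Prop} {s s' : State} (h : BestFacet T i j y rel c f dflt V s) (hs : AgreeOff A s s')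
    (hA : ¬ A c ∧ ¬ A (c + 1) ∧ ¬ A f ∧ ¬ A (f + 1) ∧ ¬ A (f + 2)) :
    BestFacet T i j y rel c f dflt V s' := by
  have e1 : s'.facetAt f = s.facetAt f := by
    unfold State.facetAt
    rw [(hs _ hA.2.2.1).1, (hs _ hA.2.2.2.1).1, (hs _ hA.2.2.2.2).1]
  have e2 : s'.ptAt c = s.ptAt c := Prod.ext (hs _ hA.1).2 (hs _ hA.2.1).2
  rw [BestFacet, e1, e2, (hs _ hA.1).1]
  exact h

theorem BestFacet.insert_of_lt {y : ℝ} {rel : ℝ → ℝ → Prop} {c f dflt : ℤ} {V : Set (ℕ × ℕ)}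
    {s : State} {ℓ b : ℕ} (h : BestFacet T i j y rel c f dflt V s)
    (hL : (T.hull ℓ b).length < 2) : BestFacet T i j y rel c f dflt (insert (ℓ, b) V) s := by
  refine h.imp (fun h => ⟨h.1, fun l d hld => ?_⟩) fun h =>
    ⟨h.1, h.2.1, h.2.2.1, fun l d hld hl => ?_⟩
  · rcases hld with hld | hld
    · obtain ⟨rfl, rfl⟩ := Prod.mk.inj hld
      exact hL
    · exact h.2 l d hld
  · rcases hld with hld | hld
    · obtain ⟨rfl, rfl⟩ := Prod.mk.inj hld
      exact absurd hl (by omega)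
    · exact h.2.2.2 l d hld hl

/-- The facet of the sub-hull `(ℓ, b)` with the position `k` is loaded. -/
def Loaded (T : DecompTree p) (y : ℝ) (ℓ b k : ℕ) (s : State) : Prop :=
  s.ints 10 = ℓ ∧ s.ints 11 = b ∧ s.ints 50 = k ∧ s.ptAt 50 = facetNormal p (T.hull ℓ b) k ∧
    s.ints 51 = shiftedClass y (facetNormal p (T.hull ℓ b) k)

theorem eval_hullAt {s : State} {ℓ b k : ℕ} {a : ℤ} (hk : k < (T.hull ℓ b).length)
    (h0 : s.ints 10 = ℓ) (h1 : s.ints 11 = b) (ha : s.ints a = k) :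
    (RealExpr.pointX (.hullAt (ic 10) (ic 11) (ic a))).eval (tableInput T i j o q) s =
        (vertex p (T.hull ℓ b) k).1 ∧
      (RealExpr.pointY (.hullAt (ic 10) (ic 11) (ic a))).eval (tableInput T i j o q) s =
        (vertex p (T.hull ℓ b) k).2 := by
  have e : (IntExpr.hullAt (ic 10) (ic 11) (ic a)).eval (tableInput T i j o q) s =
      ((T.hull ℓ b)[k].val : ℕ) := by
    rw [IntExpr.eval, eval_ic, eval_ic, eval_ic, h0, h1, ha]
    simp only [Int.toNat_natCast]
    show eventAt (T.hull ℓ b) k = _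
    rw [eventAt, List.getD_eq_getElem _ _ (by simpa using hk), List.getElem_map]
  have hv : vertex p (T.hull ℓ b) k = p (T.hull ℓ b)[k] := by
    rw [vertex, Nat.mod_eq_of_lt hk, List.getD_eq_getElem _ _ (by simpa using hk),
      List.getElem_map]
  rw [RealExpr.eval, RealExpr.eval, e, pointAt_val, hv]
  exact ⟨rfl, rfl⟩

theorem eval_hullSize {s : State} {ℓ b : ℕ} (h0 : s.ints 10 = ℓ) (h1 : s.ints 11 = b) :
    (IntExpr.hullSize (ic 10) (ic 11)).eval (tableInput T i j o q) s = ((T.hull ℓ b).length : ℕ) := by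
  rw [IntExpr.eval, eval_ic, eval_ic, h0, h1]
  simp only [Int.toNat_natCast]
  rfl

theorem runs_loadFacetP {y : ℝ} {s : State} {ℓ b k : ℕ} (hk : k < (T.hull ℓ b).length)
    (h0 : s.ints 10 = ℓ) (h1 : s.ints 11 = b) (h50 : s.ints 50 = k)
    (h51 : s.ints 51 + halfClass (facetNormal p (T.hull ℓ b) k) =
      shiftedClass y (facetNormal p (T.hull ℓ b) k)) :
    Runs (tableInput T i j o q) loadFacetP s 100 fun s' => Loaded T y ℓ b k s' ∧
      AgreeOff (fun a => 50 ≤ a ∧ a < 54) s s' := by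
  set m := (T.hull ℓ b).length with hm
  have hk' : (k + 1) % m < m := Nat.mod_lt _ (by omega)
  have hv : vertex p (T.hull ℓ b) ((k + 1) % m) = vertex p (T.hull ℓ b) (k + 1) :=
    IsHullList.vertex_mod (k + 1)
  refine (Runs.agree (A := fun a => 50 ≤ a ∧ a < 54) (Q := Loaded T y ℓ b k)
    (Runs.seq (runs_assignInt 52 _) fun s₁ ⟨a1, a2, a3⟩ => Runs.seq
    (Q' := fun s₂ => s₂.ints 52 = ((k + 1) % m : ℕ) ∧ ∀ a, a ≠ 52 → s₂.ints a = s.ints a)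
    (Runs.cond (t := 3) (fun hc => (runs_assignInt 52 _).mono (by simp [IntExpr.cost])
      fun s₂ ⟨b1, b2, b3⟩ => ⟨?wrap, fun a ha => by rw [b2 a ha, a2 a ha]⟩)
      fun hc => (Runs.skip ⟨?stay, a2⟩).mono (by omega) fun s' h => h) fun s₂ ⟨b1, b2⟩ =>
    Runs.seq (Q' := fun s₃ => s₃.reals 50 = (facetNormal p (T.hull ℓ b) k).1 ∧ s₃.ints = s₂.ints)
      ((runs_assignReal 50 _).mono le_rfl fun s₃ ⟨c1, c2, c3⟩ => ⟨?normalX, c3⟩) fun s₃ ⟨c1, c3⟩ =>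
    Runs.seq (Q' := fun s₄ => s₄.ptAt 50 = facetNormal p (T.hull ℓ b) k ∧ s₄.ints = s₂.ints)
      ((runs_assignReal 51 _).mono le_rfl fun s₄ ⟨d1, d2, d3⟩ => ⟨?normal, d3.trans c3⟩)
      fun s₄ ⟨d1, d3⟩ =>
    Runs.seq (runs_halfP (u := s₄.ptAt 50) rfl rfl) fun s₅ ⟨e1, e2, e3⟩ =>
    (runs_assignInt 51 _).mono le_rfl fun s₆ ⟨f1, f2, f3⟩ => ?done)
    (by simp [halfP, Prog.Within])).mono
      (by simp [RealExpr.cost, IntExpr.cost, Test.cost, rc, ic, halfP, Prog.cost]) fun s' h => h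
  case wrap =>
    have s1 : s₁.ints 52 = k + 1 := by rw [a1, IntExpr.eval, eval_ic, h50]; rfl
    rw [Test.Holds, eval_hullSize ((a2 10 (by norm_num)).trans h0)
      ((a2 11 (by norm_num)).trans h1), eval_ic, s1] at hc
    have : k + 1 = m := by omega
    rw [b1, this, Nat.mod_self]
    rfl
  case stay =>
    have s1 : s₁.ints 52 = k + 1 := by rw [a1, IntExpr.eval, eval_ic, h50]; rfl
    rw [Test.Holds, eval_hullSize ((a2 10 (by norm_num)).trans h0)
      ((a2 11 (by norm_num)).trans h1), eval_ic, s1] at hc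
    rw [s1, Nat.mod_eq_of_lt (by omega)]
    push_cast
    rfl
  case normalX =>
    have g0 := (b2 10 (by norm_num)).trans h0
    have g1 := (b2 11 (by norm_num)).trans h1
    rw [c1, RealExpr.eval, (eval_hullAt hk g0 g1 ((b2 50 (by norm_num)).trans h50)).2,
      (eval_hullAt hk' g0 g1 b1).2, hv]
    rfl
  case normal =>
    have g0 := (b2 10 (by norm_num)).trans h0
    have g1 := (b2 11 (by norm_num)).trans h1
    have g50 := (b2 50 (by norm_num)).trans h50
    rw [← c3] at g0 g1 g50 b1
    refine Prod.ext ((d2 50 (by norm_num)).trans c1) (d1.trans ?_)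
    rw [RealExpr.eval, (eval_hullAt hk g0 g1 g50).1,
      (eval_hullAt hk' g0 g1 b1).1, hv]
    rfl
  case done =>
    have g : ∀ a, a ≠ 51 → a ≠ 52 → a ≠ 53 → s₆.ints a = s.ints a := fun a h51 h52 h53 => by
      rw [f2 a h51, e3 a h53, d3, b2 a h52]
    refine ⟨(g _ (by norm_num) (by norm_num) (by norm_num)).trans h0,
      (g _ (by norm_num) (by norm_num) (by norm_num)).trans h1,
      (g _ (by norm_num) (by norm_num) (by norm_num)).trans h50, ?_, ?_⟩
    · rw [← d1]
      exact Prod.ext (congrFun (f3.trans e2) 50) (congrFun (f3.trans e2) 51)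
    · rw [f1, IntExpr.eval, eval_ic, eval_ic, e1, d1, e3 _ (by norm_num), d3, b2 _ (by norm_num),
        h51]

theorem runs_recordP {x : Input} {s : State} {c f : ℤ} (hc : 53 < c) (hf : f < 6) (hf0 : 0 ≤ f) :
    Runs x (recordP c f) s 50 fun s' =>
      s'.facetAt f = ⟨(s.ints 10).toNat, (s.ints 11).toNat, (s.ints 50).toNat⟩ ∧
        s'.ptAt c = s.ptAt 50 ∧ s'.ints c = s.ints 51 := by
  refine (Runs.of_run (by simp [recordP, Prog.LoopFree]) ?_).mono
    (by simp [recordP, IntExpr.cost, RealExpr.cost, rc, ic, Prog.cost]) fun s' h => h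
  have n1 : f ≠ c := by omega
  have n2 : f + 1 ≠ c := by omega
  have n3 : f + 2 ≠ c := by omega
  have n4 : (10 : ℤ) ≠ c := by omega
  have n5 : (11 : ℤ) ≠ c := by omega
  have n6 : (50 : ℤ) ≠ c := by omega
  have n7 : (51 : ℤ) ≠ c := by omega
  have n8 : (11 : ℤ) ≠ f := by omega
  have n9 : (50 : ℤ) ≠ f := by omega
  have n10 : (50 : ℤ) ≠ f + 1 := by omega
  simp [recordP, Prog.run, State.facetAt, State.ptAt, IntExpr.eval, RealExpr.eval, ic, rc, n4, n5,
    n6, n7, n8, n9, n10, n1.symm, n2.symm, n3.symm]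

theorem runs_guardP {x : Input} {s : State} {a b : IntExpr} {e : RealExpr} {R : Prog}
    {t : ℕ} {Q : State → Prop}
    (h : (a.eval x s < b.eval x s ∨ a.eval x s = b.eval x s ∧ e.eval x s ≤ 0) → Runs x R s t Q)
    (h' : ¬ (a.eval x s < b.eval x s ∨ a.eval x s = b.eval x s ∧ e.eval x s ≤ 0) → Q s) :
    Runs x (guardP a b e R) s (2 * (a.cost + b.cost + 1) + (e.cost + 2) + (t + 1)) Q := by
  refine Runs.mono (Runs.cond (t := (b.cost + a.cost + 1) + (e.cost + 2) + (t + 1)) (fun h1 =>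
    Runs.mono (Runs.cond (t := (e.cost + 2) + (t + 1)) (fun h2 => Runs.mono (Runs.cond (t := t + 1)
      (fun h3 => ?_) fun h3 => ?_) ?_ fun s' h => h) fun h2 => ?_) ?_ fun s' h => h) fun h1 => ?_)
      ?_ fun s' h => h
  all_goals simp only [Test.Holds, RealExpr.eval, Int.cast_zero, Test.cost, RealExpr.cost] at *
  · exact (h (Or.inr ⟨le_antisymm h1 h2, h3⟩)).mono (by omega) fun s' h => h
  · exact (Runs.skip (h' fun g => g.elim (fun g => by omega) fun g => h3 g.2)).mono (by omega)
      fun s' h => h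
  · omega
  · exact (h (Or.inl (not_le.1 h2))).mono (by omega) fun s' h => h
  · omega
  · exact (Runs.skip (h' fun g => g.elim (fun g => h1 g.le) fun g => h1 g.1.le)).mono (by omega)
      fun s' h => h
  · omega

/-- Compare the loaded facet with the best one so far. -/
theorem BestFacet.runs_guardP (hj : j < n) {y : ℝ} {rel : ℝ → ℝ → Prop}
    (htrans : ∀ a b c, rel a b → rel b c → rel a c) {c f dflt : ℤ} (hc : 53 < c)
    (hf : f < 6) (hf0 : 0 ≤ f) {V : Set (ℕ × ℕ)} {s : State} {ℓ b k : ℕ} {e₁ e₂ : IntExpr}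
    {e₃ : RealExpr} (h : BestFacet T i j y rel c f dflt V s) (hload : Loaded T y ℓ b k s)
    (hcov : InCover i j ℓ b) (hL : 2 ≤ (T.hull ℓ b).length) (hk : k < (T.hull ℓ b).length)
    (hbest : ∀ k' < (T.hull ℓ b).length, rel (shiftedKey y (facetNormal p (T.hull ℓ b) k'))
      (shiftedKey y (facetNormal p (T.hull ℓ b) k)))
    (hyes : (e₁.eval (tableInput T i j o q) s < e₂.eval (tableInput T i j o q) s ∨
      e₁.eval (tableInput T i j o q) s = e₂.eval (tableInput T i j o q) s ∧
      e₃.eval (tableInput T i j o q) s ≤ 0) → s.ints c = shiftedClass y (s.ptAt c) →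
      s.ptAt c ≠ 0 → rel (shiftedKey y (s.ptAt c)) (shiftedKey y (s.ptAt 50)))
    (hno : ¬ (e₁.eval (tableInput T i j o q) s < e₂.eval (tableInput T i j o q) s ∨
      e₁.eval (tableInput T i j o q) s = e₂.eval (tableInput T i j o q) s ∧
      e₃.eval (tableInput T i j o q) s ≤ 0) → s.ints c ≠ dflt ∧
      (s.ints c = shiftedClass y (s.ptAt c) → s.ptAt c ≠ 0 →
        rel (shiftedKey y (s.ptAt 50)) (shiftedKey y (s.ptAt c)))) :
    Runs (tableInput T i j o q) (guardP e₁ e₂ e₃ (recordP c f)) s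
      (2 * (e₁.cost + e₂.cost + 1) + (e₃.cost + 2) + 51)
      (BestFacet T i j y rel c f dflt (insert (ℓ, b) V)) := by
  obtain ⟨g0, g1, g2, g3, g4⟩ := hload
  have hne : (s.facetAt f).Valid T i j → (s.facetAt f).normal T = s.ptAt c → s.ptAt c ≠ 0 := by
    intro h1 h2
    rw [← h2]
    exact (T.hull_spec _ _ (level_le_clog h1.1.1 hj)).facetNormal_ne_zero h1.2.1 _
  refine WindowedHull.runs_guardP (fun hg => (runs_recordP hc hf hf0).mono le_rfl
    fun s' ⟨a1, a2, a3⟩ => ?_) fun hg => ?_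
  · rw [g0, g1, g2, Int.toNat_natCast, Int.toNat_natCast, Int.toNat_natCast] at a1
    rw [BestFacet, a1, a2, a3, g3, g4]
    refine Or.inr ⟨⟨hcov, hL, hk⟩, rfl, rfl, fun l d hld hl k' hk' => ?_⟩
    rcases hld with hld | hld
    · obtain ⟨rfl, rfl⟩ := Prod.mk.inj hld
      exact hbest k' hk'
    · rcases h with ⟨-, h⟩ | ⟨h1, h2, h3, h4⟩
      · exact absurd (h l d hld) (by omega)
      · rw [← g3]
        exact htrans _ _ _ (h4 l d hld hl k' hk') (hyes hg h3 (hne h1 h2))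
  · rcases h with ⟨h, -⟩ | ⟨h1, h2, h3, h4⟩
    · exact absurd h (hno hg).1
    · refine Or.inr ⟨h1, h2, h3, fun l d hld hl k' hk' => ?_⟩
      rcases hld with hld | hld
      · obtain ⟨rfl, rfl⟩ := Prod.mk.inj hld
        refine htrans _ _ _ (hbest k' hk') ?_
        rw [← g3]
        exact (hno hg).2 h3 (hne h1 h2)
      · exact h4 l d hld hl k' hk'

theorem runs_lastFacetP {s : State} {ℓ b f : ℕ} (hL : 2 ≤ (T.hull ℓ b).length)
    (h0 : s.ints 10 = ℓ) (h1 : s.ints 11 = b) (h17 : s.ints 17 = f) :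
    Runs (tableInput T i j o q) lastFacetP s 30 fun s' =>
      (s'.ints 50 = (if 1 ≤ f then f - 1 else (T.hull ℓ b).length - 1 : ℕ) ∧
        s'.ints 51 = if 1 ≤ f then 2 else 0) ∧ AgreeOff (fun a => 50 ≤ a ∧ a < 54) s s' := by
  refine Runs.agree (Runs.mono (Runs.cond (t := 12) (fun hc => Runs.mono (Runs.seq
    (runs_assignInt 50 _) fun s₁ ⟨a1, a2, a3⟩ => (runs_assignInt 51 _).mono le_rfl
      fun s₂ ⟨b1, b2, b3⟩ => ?_) (by simp [IntExpr.cost, ic]) fun s' h => h)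
    fun hc => Runs.mono (Runs.seq (runs_assignInt 50 _) fun s₁ ⟨a1, a2, a3⟩ =>
      (runs_assignInt 51 _).mono le_rfl fun s₂ ⟨b1, b2, b3⟩ => ?_)
      (by simp [IntExpr.cost, ic]) fun s' h => h) (by simp [Test.cost, IntExpr.cost, ic])
      fun s' h => h) (by simp [lastFacetP, Prog.Within])
  · rw [Test.Holds, IntExpr.eval, eval_ic, h17] at hc
    have hc' : 1 ≤ f := by exact_mod_cast hc
    rw [if_pos hc', if_pos hc', b2 _ (by norm_num), a1, b1]
    refine ⟨?_, rfl⟩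
    rw [IntExpr.eval, eval_ic, h17, IntExpr.eval, Nat.cast_sub hc']
    rfl
  · rw [Test.Holds, IntExpr.eval, eval_ic, h17] at hc
    have hc' : ¬ 1 ≤ f := by exact_mod_cast hc
    rw [if_neg hc', if_neg hc', b2 _ (by norm_num), a1, b1]
    refine ⟨?_, rfl⟩
    rw [IntExpr.eval, eval_hullSize h0 h1, IntExpr.eval, Nat.cast_sub (by omega)]
    rfl

theorem runs_firstFacetP {s : State} {ℓ b f : ℕ} (h0 : s.ints 10 = ℓ) (h1 : s.ints 11 = b)
    (h17 : s.ints 17 = f) :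
    Runs (tableInput T i j o q) firstFacetP s 30 fun s' =>
      (s'.ints 50 = (if (T.hull ℓ b).length ≤ f then 0 else f : ℕ) ∧
        s'.ints 51 = if (T.hull ℓ b).length ≤ f then 2 else 0) ∧
        AgreeOff (fun a => 50 ≤ a ∧ a < 54) s s' := by
  refine Runs.agree (Runs.mono (Runs.cond (t := 12) (fun hc => Runs.mono (Runs.seq
    (runs_assignInt 50 _) fun s₁ ⟨a1, a2, a3⟩ => (runs_assignInt 51 _).mono le_rfl
      fun s₂ ⟨b1, b2, b3⟩ => ?_) (by simp [IntExpr.cost]) fun s' h => h)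
    fun hc => Runs.mono (Runs.seq (runs_assignInt 50 _) fun s₁ ⟨a1, a2, a3⟩ =>
      (runs_assignInt 51 _).mono le_rfl fun s₂ ⟨b1, b2, b3⟩ => ?_)
      (by simp [IntExpr.cost, ic]) fun s' h => h) (by simp [Test.cost, IntExpr.cost, ic])
      fun s' h => h) (by simp [firstFacetP, Prog.Within])
  · rw [Test.Holds, eval_hullSize h0 h1, eval_ic, h17] at hc
    have hc' : (T.hull ℓ b).length ≤ f := by exact_mod_cast hc
    rw [if_pos hc', if_pos hc', b2 _ (by norm_num), a1, b1]
    exact ⟨rfl, rfl⟩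
  · rw [Test.Holds, eval_hullSize h0 h1, eval_ic, h17] at hc
    have hc' : ¬ (T.hull ℓ b).length ≤ f := by exact_mod_cast hc
    rw [if_neg hc', if_neg hc', b2 _ (by norm_num), a1, b1, eval_ic, h17]
    exact ⟨rfl, rfl⟩

/-- Only two facets of a sub-hull can matter, and the rank of the threshold gives their positions;
each is compared once with the best facet so far. -/
theorem runs_facetsP (hj : j < n) {y : ℝ} {V : Set (ℕ × ℕ)} {s : State} {ℓ b f : ℕ}
    (hcov : InCover i j ℓ b) (h0 : s.ints 10 = ℓ) (h1 : s.ints 11 = b) (h17 : s.ints 17 = f)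
    (hf : f = rank (pairKey p) (fun t => t < y) (facetPairs (T.hull ℓ b)))
    (hmax : BestFacet T i j y (· ≤ ·) 54 0 (-1) V s)
    (hmin : BestFacet T i j y (· ≥ ·) 56 3 4 V s) :
    Runs (tableInput T i j o q) facetsP s 600 fun s' =>
      (BestFacet T i j y (· ≤ ·) 54 0 (-1) (insert (ℓ, b) V) s' ∧
        BestFacet T i j y (· ≥ ·) 56 3 4 (insert (ℓ, b) V) s') ∧ AgreeOff FacetCell s s' := by
  have h := T.hull_spec ℓ b (level_le_clog hcov.1 hj)
  refine Runs.agree (Runs.mono (Runs.cond (t := 560) (fun hc => ?_) fun hc => ?_)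
    (by simp [Test.cost, IntExpr.cost, ic]) fun s' h => h)
    (by simp [facetsP, lastFacetP, firstFacetP, loadFacetP, guardP, recordP, halfP, Prog.Within,
      FacetCell])
  · rw [Test.Holds, IntExpr.eval, eval_hullSize h0 h1] at hc
    have hL : 2 ≤ (T.hull ℓ b).length := by exact_mod_cast hc
    obtain ⟨hle, hlt, hlast, hfirst⟩ := h.shiftedKey_le hL hf
    have hne := fun k => h.facetNormal_ne_zero hL k
    set m := (T.hull ℓ b).length with hm
    set k₁ := if 1 ≤ f then f - 1 else m - 1 with hk₁
    set k₂ := if m ≤ f then 0 else f with hk₂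
    have hk₁m : k₁ < m := by rw [hk₁]; split_ifs <;> omega
    have hk₂m : k₂ < m := by rw [hk₂]; split_ifs <;> omega
    -- The machine does not know `y`. Whether the key of the chosen facet is below `y` follows from
    -- its position relative to `f`.
    have hcl₁ : (if 1 ≤ f then 2 else 0) + halfClass (facetNormal p (T.hull ℓ b) k₁) =
        shiftedClass y (facetNormal p (T.hull ℓ b) k₁) := by
      have : key (facetNormal p (T.hull ℓ b) k₁) < y ↔ 1 ≤ f := by
        rw [hlt k₁ hk₁m, hk₁]; split_ifs <;> omega
      simp only [shiftedClass, this]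
    have hcl₂ : (if m ≤ f then 2 else 0) + halfClass (facetNormal p (T.hull ℓ b) k₂) =
        shiftedClass y (facetNormal p (T.hull ℓ b) k₂) := by
      have : key (facetNormal p (T.hull ℓ b) k₂) < y ↔ m ≤ f := by
        rw [hlt k₂ hk₂m, hk₂]; split_ifs <;> omega
      simp only [shiftedClass, this]
    -- So the initial classes `-1` for the maximum and `4` for the minimum lose against every facet.
    have hcl : ∀ u, 0 ≤ shiftedClass y u ∧ shiftedClass y u < 4 := by
      intro u
      have := halfClass_mem u
      unfold shiftedClass
      split_ifs <;> omega
    have hpart₁ : Runs (tableInput T i j o q) (.seq lastFacetP (.seq loadFacetP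
        (guardP (ic 54) (ic 51) (crossE (rc 54) (rc 55) (rc 50) (rc 51)) (recordP 54 0)))) s 270
        fun s' => BestFacet T i j y (· ≤ ·) 54 0 (-1) (insert (ℓ, b) V) s' ∧
          AgreeOff (fun a => 0 ≤ a ∧ a < 3 ∨ 50 ≤ a ∧ a < 56) s s' := by
      refine Runs.agree (Runs.mono (Runs.seq (runs_lastFacetP hL h0 h1 h17)
        fun s₁ ⟨⟨a1, a2⟩, a3⟩ => Runs.seq (runs_loadFacetP (y := y) hk₁m
          ((a3 10 (by norm_num)).1.trans h0) ((a3 11 (by norm_num)).1.trans h1) a1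
          (by rw [a2, hcl₁])) fun s₂ ⟨b1, b2⟩ => BestFacet.runs_guardP (c := 54) (f := 0)
          (dflt := -1) (V := V) (rel := (· ≤ ·)) hj (fun _ _ _ h h' => le_trans h h') (by norm_num)
          (by norm_num) (by norm_num)
          (hmax.congr (a3.trans b2) (by norm_num)) b1 hcov hL hk₁m hlast ?_ ?_)
          (by simp [IntExpr.cost, RealExpr.cost, crossE, rc, ic]) fun s' h => h)
          (by simp [guardP, recordP, lastFacetP, loadFacetP, halfP, Prog.Within])
      · intro hg h54 h0
        refine (shiftedKey_le_iff h0 (b1.2.2.2.1 ▸ hne k₁)).2 ?_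
        rw [← h54, b1.2.2.2.1, ← b1.2.2.2.2, ← b1.2.2.2.1]
        exact hg
      · intro hg
        refine ⟨fun h => hg (Or.inl ?_), fun h54 h0 => ?_⟩
        · rw [eval_ic, eval_ic, h, b1.2.2.2.2]
          have := (hcl (facetNormal p (T.hull ℓ b) k₁)).1
          omega
        · refine le_of_not_ge fun hle => hg ?_
          have := (shiftedKey_le_iff h0 (b1.2.2.2.1 ▸ hne k₁)).1 hle
          rw [← h54, b1.2.2.2.1, ← b1.2.2.2.2, ← b1.2.2.2.1] at this
          exact this
    have hpart₂ : ∀ s : State, s.ints 10 = (ℓ : ℕ) → s.ints 11 = (b : ℕ) → s.ints 17 = (f : ℕ) →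
        BestFacet T i j y (· ≥ ·) 56 3 4 V s →
        Runs (tableInput T i j o q) (.seq firstFacetP (.seq loadFacetP
        (guardP (ic 51) (ic 56) (crossE (rc 50) (rc 51) (rc 56) (rc 57)) (recordP 56 3)))) s 270
        fun s' => BestFacet T i j y (· ≥ ·) 56 3 4 (insert (ℓ, b) V) s' ∧
          AgreeOff (fun a => 3 ≤ a ∧ a < 6 ∨ 50 ≤ a ∧ a < 54 ∨ 56 ≤ a ∧ a < 58) s s' := by
      intro s h0 h1 h17 hmin
      refine Runs.agree (Runs.mono (Runs.seq (runs_firstFacetP h0 h1 h17)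
        fun s₁ ⟨⟨a1, a2⟩, a3⟩ => Runs.seq (runs_loadFacetP (y := y) hk₂m
          ((a3 10 (by norm_num)).1.trans h0) ((a3 11 (by norm_num)).1.trans h1) a1
          (by rw [a2, hcl₂])) fun s₂ ⟨b1, b2⟩ => BestFacet.runs_guardP (c := 56) (f := 3)
          (dflt := 4) (V := V) (rel := (· ≥ ·)) hj (fun _ _ _ h h' => ge_trans h h') (by norm_num)
          (by norm_num) (by norm_num)
          (hmin.congr (a3.trans b2) (by norm_num)) b1 hcov hL hk₂m hfirst ?_ ?_)
          (by simp [IntExpr.cost, RealExpr.cost, crossE, rc, ic]) fun s' h => h)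
          (by simp [guardP, recordP, firstFacetP, loadFacetP, halfP, Prog.Within])
      · intro hg h56 h0
        refine (shiftedKey_le_iff (b1.2.2.2.1 ▸ hne k₂) h0).2 ?_
        rw [← h56, b1.2.2.2.1, ← b1.2.2.2.2, ← b1.2.2.2.1]
        exact hg
      · intro hg
        refine ⟨fun h => hg (Or.inl ?_), fun h56 h0 => ?_⟩
        · rw [eval_ic, eval_ic, h, b1.2.2.2.2]
          exact (hcl (facetNormal p (T.hull ℓ b) k₂)).2
        · refine le_of_not_ge fun hle => hg ?_
          have := (shiftedKey_le_iff (b1.2.2.2.1 ▸ hne k₂) h0).1 hle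
          rw [← h56, b1.2.2.2.1, ← b1.2.2.2.2, ← b1.2.2.2.1] at this
          exact this
    exact Runs.mono (Runs.seq hpart₁ fun s₁ ⟨a1, a2⟩ =>
      (hpart₂ s₁ ((a2 10 (by norm_num)).1.trans h0) ((a2 11 (by norm_num)).1.trans h1)
        ((a2 17 (by norm_num)).1.trans h17) (hmin.congr a2 (by norm_num))).mono le_rfl
        fun s₂ ⟨b1, b2⟩ => ⟨a1.congr b2 (by norm_num), b1⟩) (by norm_num) fun s' h => h
  · rw [Test.Holds, IntExpr.eval, eval_hullSize h0 h1] at hc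
    have hL : (T.hull ℓ b).length < 2 := by
      have : ¬ 2 ≤ (T.hull ℓ b).length := by exact_mod_cast hc
      omega
    refine (Runs.skip ⟨?_, ?_⟩).mono (by norm_num) fun s' h => h
    · exact hmax.insert_of_lt hL
    · exact hmin.insert_of_lt hL

end Facets

end WindowedHull

/-! ### The complete program, its running time and the theorem. -/

namespace WindowedHull

open Code

namespace Code

/-- The program: it finds the two facets between which the normal of the stabbed facet lies. -/
def queryP : Prog :=
  .seq setupP (.seq flagP
    (.seq (.setReal (.lit 10) (.lit 1))
      (.seq (.setReal (.lit 11) (.lit 0))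
        (.seq beforeFacetP
          (.seq (.setInt (.lit 41) (ic 42))
            (.seq (.setInt (.lit 54) (.lit (-1)))
              (.seq (.setInt (.lit 56) (.lit 4)) (coverP 10 facetTestP facetsP))))))))

end Code

section Main

variable {n : ℕ} {p : Fin n → Pt} {T : DecompTree p} {i j L : ℕ} {o q : Pt}

/-- The outer walk, whose test contains an inner walk and costs `O(log w)`. The inner one works in
the cells from `20` on and the outer one in those from `10` on, so a test disturbs neither the
search in progress nor the best facets. -/
theorem walkable_facetsP (hij : i ≤ j) (hj : j < n) (hL : L = Nat.log 2 (j - i + 1)) {N : Pt}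
    (hN : StabbedNormal (windowPoints p i j) o q N) {y : ℝ}
    (hy : ∀ u : Pt, key u < y ↔
      if cwAngle (-q) (1, 0) < cwAngle (-q) N then
        key u ≤ key (-q) ∧ cwAngle (-q) u < cwAngle (-q) N
      else key u ≤ key (-q) ∨ cwAngle (-q) u < cwAngle (-q) N) :
    Walkable T i j (tableInput T i j o q) 10 facetTestP facetsP (maxCost L + 300) 600
      (fun t => t < y) L fun V s => Prepared (windowPoints p i j) i j L o q s ∧
        IsBit (s.ints 41) (cwAngle (-q) (1, 0) < cwAngle (-q) N) ∧
        BestFacet T i j y (· ≤ ·) 54 0 (-1) V s ∧ BestFacet T i j y (· ≥ ·) 56 3 4 V s := by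
  have stable : ∀ A : ℤ → Prop, (∀ a, A a → 8 ≤ a ∧ a < 40 ∨ 42 ≤ a ∧ a < 46) →
      ∀ (V : Set (ℕ × ℕ)) (s s' : State), (Prepared (windowPoints p i j) i j L o q s ∧
        IsBit (s.ints 41) (cwAngle (-q) (1, 0) < cwAngle (-q) N) ∧
        BestFacet T i j y (· ≤ ·) 54 0 (-1) V s ∧ BestFacet T i j y (· ≥ ·) 56 3 4 V s) →
      AgreeOff A s s' → (Prepared (windowPoints p i j) i j L o q s' ∧
        IsBit (s'.ints 41) (cwAngle (-q) (1, 0) < cwAngle (-q) N) ∧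
        BestFacet T i j y (· ≤ ·) 54 0 (-1) V s' ∧ BestFacet T i j y (· ≥ ·) 56 3 4 V s') := by
    intro A hA V s s' ⟨h1, h2, h3, h4⟩ h
    have hB := h.mono hA
    refine ⟨h1.congr (fun a ha => ?_) hB, ?_, h3.congr hB (by norm_num), h4.congr hB (by norm_num)⟩
    · omega
    · rwa [(hB 41 (by norm_num)).1]
  refine ⟨fun _ _ h h' => h.trans_lt h', stable _ fun a ha => ?_, fun V s h => h.1.1, ?_, ?_⟩
  · unfold WalkCell at ha; omega
  · intro V s u hJ hu h1 h2
    have hs : s.ptAt 10 = u := Prod.ext h1 h2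
    refine (runs_facetTestP (T := T) hij hj hL hN hy hJ.1 (hs ▸ hu) hJ.2.1).mono le_rfl
      fun s' ⟨h3, h4⟩ => ⟨stable _ (fun a ha => ?_) V s s' hJ h4, hs ▸ h3, fun a ha ha' =>
        (h4 a ?_).1⟩
    · unfold TestCell at ha; omega
    · unfold WalkCell at ha; unfold TestCell; omega
  · intro V s ℓ b ⟨h1, h2, h3, h4⟩ hcov g0 g1 g7
    refine (runs_facetsP hj hcov g0 g1 g7 rfl h3 h4).mono le_rfl fun s' ⟨⟨k1, k2⟩, k3⟩ =>
      ⟨⟨h1.congr (fun a ha => ?_) k3, ?_, k1, k2⟩, fun a ha => (k3 a ?_).1⟩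
    · unfold FacetCell at ha; omega
    · rwa [(k3 41 (by unfold FacetCell; omega)).1]
    · unfold WalkCell at ha; unfold FacetCell; omega

/-- The factor in the bound for the running time. -/
def timeFactor : ℕ := 15000 + 14 * maxCost 0 + 3 * (roundCost 10 beforeE + roundCost 10 afterE)

theorem runs_queryP (hij : i ≤ j) (hj : j < n) (hL : L = Nat.log 2 (j - i + 1)) {N : Pt}
    (hN : StabbedNormal (windowPoints p i j) o q N) {y : ℝ}
    (hy : ∀ u : Pt, key u < y ↔
      if cwAngle (-q) (1, 0) < cwAngle (-q) N then
        key u ≤ key (-q) ∧ cwAngle (-q) u < cwAngle (-q) N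
      else key u ≤ key (-q) ∨ cwAngle (-q) u < cwAngle (-q) N)
    (hD : (mergedNormals T i j).Nonempty) (s : State) :
    Runs (tableInput T i j o q) queryP s (timeFactor * (L + 1) ^ 2) fun s' =>
      ((s'.facetAt 0).Valid T i j ∧ (s'.facetAt 3).Valid T i j) ∧
      (∀ x ∈ mergedNormals T i j, shiftedKey y x ≤ shiftedKey y ((s'.facetAt 0).normal T)) ∧
      ∀ x ∈ mergedNormals T i j, shiftedKey y ((s'.facetAt 3).normal T) ≤ shiftedKey y x := by
  set S := windowPoints p i j
  have h10 : ((1, 0) : Pt) ≠ 0 := by simp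
  refine Runs.mono (Runs.seq (runs_setupP (x := tableInput T i j o q) hij s) fun s₁ a1 =>
    Runs.seq (runs_flagP (T := T) (s := s₁) hij hj hL hN.dir_ne_zero (by rw [hL]; exact a1))
    fun s₂ (a2 : Prepared S i j L o q s₂) =>
    Runs.seq (Q' := fun s₃ => s₃.reals 10 = 1 ∧ Prepared S i j L o q s₃)
      (((runs_assignReal 10 _).agree (A := fun a => a = 10) rfl).mono le_rfl
        fun s₃ ⟨b1, b2⟩ => ⟨?real1, a2.congr ?_ b2⟩) fun s₃ ⟨b1, b2⟩ =>
    Runs.seq (Q' := fun s₄ => s₄.ptAt 10 = (1, 0) ∧ Prepared S i j L o q s₄)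
      (((runs_assignReal 11 _).agree (A := fun a => a = 11) rfl).mono le_rfl
        fun s₄ ⟨c1, c2⟩ => ⟨?real2, b2.congr ?_ c2⟩) fun s₄ ⟨c1, c2⟩ =>
    Runs.seq (Q' := fun s₅ => IsBit (s₅.ints 42) (cwAngle (-q) (1, 0) < cwAngle (-q) N) ∧
        Prepared S i j L o q s₅)
      ((runs_beforeFacetP (T := T) hij hj hL hN c2 (c1 ▸ h10)).mono le_rfl
        fun s₅ ⟨d1, d2⟩ => ⟨c1 ▸ d1, c2.congr ?_ d2⟩) fun s₅ ⟨d1, d2⟩ =>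
    Runs.seq (Q' := fun s₆ => IsBit (s₆.ints 41) (cwAngle (-q) (1, 0) < cwAngle (-q) N) ∧
        Prepared S i j L o q s₆)
      (((runs_assignInt 41 _).agree (A := fun a => a = 41) rfl).mono le_rfl
        fun s₆ ⟨e1, e2⟩ => ⟨?bit, d2.congr ?_ e2⟩) fun s₆ ⟨e1, e2⟩ =>
    Runs.seq ((runs_assignInt 54 _).agree (A := fun a => a = 54) rfl) fun s₇ ⟨f1, f2⟩ =>
    Runs.seq ((runs_assignInt 56 _).agree (A := fun a => a = 56) rfl) fun s₈ ⟨g1, g2⟩ =>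
    (runs_coverP (walkable_facetsP hij hj hL hN hy) hL hij hj (V := ∅) (by norm_num)
      ⟨(e2.congr ?_ f2).congr ?_ g2, ?flag, Or.inl ⟨?max, fun _ _ h => absurd h (by simp)⟩,
        Or.inl ⟨?min, fun _ _ h => absurd h (by simp)⟩⟩).mono le_rfl
      fun s₉ ⟨V, h1, _, _, h2, h3⟩ => ?done) ?time fun s' h => h
  case real1 => exact b1.1.trans (by simp [RealExpr.eval])
  case real2 =>
    exact Prod.ext ((c1.2.1 10 (by norm_num)).trans b1) (c1.1.trans (by simp [RealExpr.eval]))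
  case bit => rw [e1.1, eval_ic]; exact d1
  case flag => rwa [g1.2.1 _ (by norm_num), f1.2.1 _ (by norm_num)]
  case max => rw [g1.2.1 _ (by norm_num), f1.1]; rfl
  case min => rw [g1.1]; rfl
  case done =>
    -- As `D` is not empty, some sub-hull has a facet and the best facets are no longer the initial
    -- ones.
    have none : ∀ F : SubFacet, F.Valid T i j →
        ¬ ∀ ℓ b : ℕ, (ℓ, b) ∈ V → (T.hull ℓ b).length < 2 := fun F hF h =>
      absurd (h _ _ (h1 _ _ hF.1)) (not_lt.2 hF.2.1)
    obtain ⟨_, F, hF, rfl⟩ := hD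
    obtain ⟨m1, m2, -, m3⟩ := h2.resolve_left fun h => none F hF h.2
    obtain ⟨k1, k2, -, k3⟩ := h3.resolve_left fun h => none F hF h.2
    refine ⟨⟨m1, k1⟩, ?_, ?_⟩
    · rintro _ ⟨G, hG, rfl⟩
      rw [m2]
      exact m3 _ _ (h1 _ _ hG.1) hG.2.1 _ hG.2.2
    · rintro _ ⟨G, hG, rfl⟩
      rw [k2]
      exact k3 _ _ (h1 _ _ hG.1) hG.2.1 _ hG.2.2
  case time =>
    -- A maximization costs a multiple of `L + 1`, and the outer walk makes a number of tests that
    -- is linear in `L + 1`; together this is quadratic.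
    have hM : maxCost L = (L + 1) * maxCost 0 := by simp [maxCost]
    have hlog : Nat.log 2 ((tableInput T i j o q).last - (tableInput T i j o q).first + 1) = L :=
      hL.symm
    rw [hlog, hM]
    simp only [RealExpr.cost, IntExpr.cost, ic, timeFactor]
    generalize maxCost 0 = M
    generalize roundCost 10 beforeE + roundCost 10 afterE = R
    nlinarith [Nat.zero_le (L * M), Nat.zero_le (L * R), Nat.zero_le (L * L * R)]
  all_goals
    intro a ha
    unfold TestCell at ha
    omega

theorem windowPoints_finite (p : Fin n → Pt) (i j : ℕ) : (windowPoints p i j).Finite :=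
  (Set.finite_range p).subset fun _ ⟨t, _, _, h⟩ => ⟨t, h⟩

/-- A facet of a sub-hull has two different ends, so the complete hull is not a single point and has
a facet to be stabbed. -/
theorem exists_ne_of_mergedNormals_nonempty (hj : j < n) (hD : (mergedNormals T i j).Nonempty) :
    ∃ x ∈ windowPoints p i j, ∃ y ∈ windowPoints p i j, x ≠ y := by
  obtain ⟨_, F, ⟨hcov, hL, -⟩, rfl⟩ := hD
  have h := T.hull_spec F.level F.block (level_le_clog hcov.1 hj)
  have hmem : ∀ k, vertex p (T.hull F.level F.block) k ∈ windowPoints p i j := fun k => by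
    obtain ⟨t, ht, e⟩ := h.exists_vertex_eq (by omega) k
    have := hcov.1 t (by simpa [canonicalSubset] using ht)
    exact ⟨t, this.1, this.2, e.symm⟩
  exact ⟨_, hmem 0, _, hmem 1, h.vertex_ne_succ hL 0⟩

end Main

end WindowedHull

theorem mainTheorem9 :
    ∃ (P : WindowedHull.Prog) (A K : ℕ),
      ∀ (n : ℕ) (p : Fin n → WindowedHull.Pt) (T : WindowedHull.DecompTree p),
        ∃ extra : ℕ → ℕ → ℕ → ℤ, WindowedHull.SmallExtra A n extra ∧
          ∀ (i j : ℕ), i ≤ j → j < n →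
            ∀ (o q : WindowedHull.Pt), q ≠ 0 →
              (WindowedHull.line o q ∩
                convexHull ℝ (WindowedHull.windowPoints p i j)).Nonempty →
              (WindowedHull.mergedNormals T i j).Nonempty →
              ∃ (m : ℕ) (s : WindowedHull.State),
                WindowedHull.Exec ⟨n, p, T, extra, i, j, o, q⟩ P WindowedHull.State.initial m s ∧
                m ≤ K * (Nat.log 2 (j - i + 1) + 1) ^ 2 ∧
                (s.facetAt 0).Valid T i j ∧ (s.facetAt 3).Valid T i j ∧
                WindowedHull.Adjacent (WindowedHull.mergedNormals T i j)
                  ((s.facetAt 0).normal T) ((s.facetAt 3).normal T) ∧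
                ∃ a b : WindowedHull.Pt,
                  WindowedHull.IsStabbedFacet (WindowedHull.windowPoints p i j) o q a b ∧
                  WindowedHull.Between ((s.facetAt 0).normal T)
                    (WindowedHull.edgeNormal a b) ((s.facetAt 3).normal T) := by
  refine ⟨WindowedHull.Code.queryP, 24, WindowedHull.timeFactor, fun n p T =>
    ⟨WindowedHull.tableWord T, WindowedHull.smallExtra_tableWord T,
      fun i j hij hj o q hq hline hD => ?_⟩⟩
  obtain ⟨a, b, hab, hdir, hside⟩ := WindowedHull.exists_isStabbedFacet
    (WindowedHull.windowPoints_finite p i j) hq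
    (WindowedHull.exists_ne_of_mergedNormals_nonempty hj hD) hline
  have hN : WindowedHull.StabbedNormal (WindowedHull.windowPoints p i j) o q
      (WindowedHull.edgeNormal a b) :=
    ⟨hq, WindowedHull.edgeNormal_ne_zero hab.1.2.2.1, hdir, hside⟩
  obtain ⟨y, -, hy, hkey⟩ := WindowedHull.exists_key_threshold
    (WindowedHull.cwAngle_neg_lt_two_pi hq hN.ne_zero hdir)
  obtain ⟨m, s, hexec, hm, ⟨h0, h3⟩, hmax, hmin⟩ :=
    WindowedHull.runs_queryP hij hj rfl hN hkey hD WindowedHull.State.initial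
  have hu : (s.facetAt 0).normal T ∈ WindowedHull.mergedNormals T i j := ⟨_, h0, rfl⟩
  have hv : (s.facetAt 3).normal T ∈ WindowedHull.mergedNormals T i j := ⟨_, h3, rfl⟩
  have hadj := WindowedHull.adjacent_between_of_shiftedKey hu hv hmax hmin hy
  exact ⟨m, s, hexec, hm, h0, h3, hadj.1, a, b, hab, hadj.2⟩
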